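/- **Conventions.** Let $n\ge 0$, $w\in S_n$, written $w=w_1\cdots w_n$; $wt_{i,j}$ is $w$ with the entries in positions $i,j$ exchanged, $s_i$ is the transposition of $i$ and $i+1$, and $\ell$ is the length. A word $(a_1,\dots,a_\ell)$ of positive integers is a reduced word of $w$ if $w=s_{a_1}\cdots s_{a_\ell}$ with $\ell=\ell(w)$. * $\mathrm{RT}(w)$ is the set of increasing tableaux $T$ (fillings of a Young diagram by positive integers, strictly increasing along rows and down columns) whose column reading word $\mathrm{column}(T)$ (columns from right to left, each read from top to bottom) is a reduced word of $w$. The shape of $T$ is its Young diagram. * A bumpless pipedream of $w$ consists of $n$ pipes in the $n\times n$ grid (matrix coordinates), going north and east only, pipe $k$ entering from the south boundary in column $k$ and leaving through the east boundary in row $w^{-1}(k)$, such that no two pipes share a step, cross more than once, or turn in the same box. A box in which a pipe enters from the west and leaves to the north is an NW elbow; one in which a pipe enters from the south and leaves to the east is an SE elbow. $\mathrm{EG}(w)$ is the set of EG-pipedreams of $w$, i.e. those whose empty boxes form a Young diagram in the northwest corner; this diagram is the shape. The Rothe pipedream of $w$ is the bumpless pipedream of $w$ without NW elbows. A droop swaps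 an SE elbow $e$ with an empty box $t$ strictly southeast of it: if the pipe $L$ through $e$ runs along the westmost column and the northmost row of the rectangle $R$ with corners $e,t$, and $R$ contains no elbow other than $e$, then $L$ is rerouted along the southmost row and eastmost column of $R$, all other pipes being unchanged, and the result is required to be a bumpless pipedream of $w$. * Little map. Bumping a word $a$ at position $t$ decreases $a_t$ by $1$ if $a_t>1$, and increases all other letters by $1$ if $a_t=1$. The Little bump started at $t$: bump at $t$; if the result is reduced, stop; otherwise continue with the unique position $s\ne t$ whose deletion from the result leaves a reduced word. If $a$ is a reduced word of $u$, $k<j$ and $\ell(u)=\ell(ut_{k,j})+1$, then $\theta_{k,u_j}(a)$ is the result of the Little bump of $a$ started at the letter interchanging the values $u_k$ and $u_j$. With $a^c=(n-a_1,\dots,n-a_\ell)$, put $\theta_{k,v}^{-1}(a)=(\theta_{n+1-k,\,n+1-v}(a^c))^c$. * Trees. A permutation $u\in S_n$ is dominant if it avoids $132$. For non-dominant $u$ let $p$ be the largest index for which there are $i<p<j$ with $u_i<u_j<u_p$, and let $q$ be the largest index $j>p$ with $u_j<u_p$ and $u_i<u_j$ for some $i<p$. The children of $u$ are the permutations $ut_{p,q}t_{i,p}$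 with $i<p$ and $\ell(ut_{p,q}t_{i,p})=\ell(ut_{p,q})+1$. The modified LS-tree of $w$ has root $w$, is generated by this rule, and its leaves are dominant. The EG-tree of $w$ is the isomorphic tree whose root is labelled by the Rothe pipedream of $w$ and in which, if $P$ corresponds to $u$, the pipedream corresponding to the child $ut_{p,q}t_{i,p}$ is obtained from $P$ by the droop swapping the SE elbow $(i,u_i)$ and the empty box $(p,u_q)$. * Edelman–Greene insertion of a word, letter by letter: to insert $x$ into a row, append $x$ if no entry exceeds $x$; otherwise let $y$ be the leftmost entry exceeding $x$, replace $y$ by $x$ if the tableau remains increasing (and leave the row unchanged if not), and insert $y$ into the next row. **Theorem 6.1.** For every $w\in S_n$ there is a bijection $\Gamma:\mathrm{RT}(w)\to\mathrm{EG}(w)$ such that $\Gamma(T)$ and $T$ have the same shape for all $T$, and such that $\Gamma$ and $\Gamma^{-1}$ are given by the following constructions (which are well defined). 1. For $T\in\mathrm{RT}(w)$ start with $w^{(0)}=w$ and $\tau^{(0)}=\mathrm{column}(T)$. As long as $u=w^{(m)}$ is not dominant, with indices $p,q$ as above, let $\tau^{(m+1)}=\theta_{p,u_q}(\tau^{(m)})$;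 it is a reduced word of a child $w^{(m+1)}$ of $w^{(m)}$. This gives a path in the modified LS-tree of $w$ from the root to a leaf, and $\Gamma(T)$ is the pipedream at the end of the corresponding path in the EG-tree of $w$. 2. For $P\in\mathrm{EG}(w)$ let $(i_m,j_m)<\dots<(i_1,j_1)$ be its NW elbows, ordered by row and then by column. Let $w'$ be the dominant label of the leaf of the modified LS-tree corresponding to $P$, and let $T'$ be the reduced word tableau for $w'$ whose entry in row $r$ and column $c$ is $r+c-1$. Then $b=\theta_{i_1,j_1}^{-1}\circ\cdots\circ\theta_{i_m,j_m}^{-1}(\mathrm{column}(T'))$ is a reduced word of $w$, and $\Gamma^{-1}(P)$ is the Edelman–Greene insertion tableau of the reverse of $b$. -/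

import Mathlib

/-!
Conventions.  The symmetric group on `{1, …, n}` is the set of permutations of `ℕ` fixing every
number outside `[1, n]`; one-line notation is `w 1, w 2, …, w n`.  Products are compositions, so
`w * swap i j` is `w` with the entries in positions `i` and `j` exchanged.  Boxes of the square
grid have coordinates (row, column) in `[1, n] × [1, n]`, rows counted from the top.  Cells of a
`YoungDiagram` (English convention) are counted from `0`: the cell `(i, j)` is the box
`(i + 1, j + 1)`.
-/

namespace BumplessEG

open Equiv

/-! ### Permutations and reduced words -/

/-- `w` is a permutation of `{1, …, n}`. -/
def InSym (n : ℕ) (w : Perm ℕ) : Prop :=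
  ∀ i, i ∉ Set.Icc 1 n → w i = i

/-- The product `s_{a₁} s_{a₂} ⋯ s_{a_ℓ}`, where `s_i` is the transposition of `i` and `i + 1`. -/
def wordProd (a : List ℕ) : Perm ℕ :=
  (a.map fun i => swap i (i + 1)).prod

/-- The length `ℓ(w)`: the minimum number of simple transpositions `s_i`, `i ≥ 1`, in a
decomposition of `w` (only used for permutations of some `{1, …, n}`). -/
noncomputable def len (w : Perm ℕ) : ℕ :=
  sInf {m | ∃ a : List ℕ, (∀ x ∈ a, 1 ≤ x) ∧ wordProd a = w ∧ a.length = m}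

/-- The word `a` in positive letters is reduced. -/
def IsReduced (a : List ℕ) : Prop :=
  (∀ x ∈ a, 1 ≤ x) ∧ a.length = len (wordProd a)

/-- `a` is a reduced word of `w`. -/
def IsReducedWord (w : Perm ℕ) (a : List ℕ) : Prop :=
  IsReduced a ∧ wordProd a = w

/-! ### Increasing tableaux -/

/-- A filling of a Young diagram with positive integers, strictly increasing along rows and down
columns.  Entries outside the shape are normalised to `0`. -/
@[ext]
structure IncreasingTableau where
  shape : YoungDiagram
  entry : ℕ → ℕ → ℕ
  zeros : ∀ i j, (i, j) ∉ shape → entry i j = 0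
  pos : ∀ i j, (i, j) ∈ shape → 1 ≤ entry i j
  row_strict : ∀ i j₁ j₂, j₁ < j₂ → (i, j₂) ∈ shape → entry i j₁ < entry i j₂
  col_strict : ∀ i₁ i₂ j, i₁ < i₂ → (i₂, j) ∈ shape → entry i₁ j < entry i₂ j

namespace IncreasingTableau

/-- The column reading word: columns from right to left, each from top to bottom. -/
def column (T : IncreasingTableau) : List ℕ :=
  (List.range (T.shape.rowLen 0)).reverse.flatMap fun j =>
    (List.range (T.shape.colLen j)).map fun i => T.entry i j

/-- The list of rows, from top to bottom. -/
def rows (T : IncreasingTableau) : List (List ℕ) :=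
  (List.range (T.shape.colLen 0)).map fun i =>
    (List.range (T.shape.rowLen i)).map fun j => T.entry i j

/-- The frozen filling: the box in row `r` and column `c` holds `r + c - 1`. -/
def IsFrozen (T : IncreasingTableau) : Prop :=
  ∀ i j, (i, j) ∈ T.shape → T.entry i j = i + j + 1

end IncreasingTableau

/-- The reduced word tableaux for `w`. -/
def RT (w : Perm ℕ) : Type :=
  {T : IncreasingTableau // IsReducedWord w T.column}

def RT.shape {w : Perm ℕ} (T : RT w) : YoungDiagram := T.1.shape

/-! ### Edelman–Greene insertion -/

/-- Insert `x` into the tableau with the given list of rows, lying directly below the row `above`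
(`[]` if there is none).  If no entry of the first row exceeds `x`, append `x` to it.  Otherwise
let `y` be the leftmost entry exceeding `x`: it is replaced by `x` if the tableau stays increasing,
i.e. if the new row is strictly increasing and the entry above the new one (if any) is smaller (the
entry below is automatically larger, as it exceeds `y`); in both cases `y` is inserted into the
next row. -/
def egInsert : List ℕ → List (List ℕ) → ℕ → List (List ℕ)
  | _, [], x => [[x]]
  | above, R :: rest, x =>
    match R.findIdx? (fun z => decide (x < z)) with
    | none => (R ++ [x]) :: rest
    | some c =>
      if (R.set c x).Pairwise (· < ·) ∧ ∀ z ∈ above[c]?, z < x then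
        R.set c x :: egInsert (R.set c x) rest (R.getD c 0)
      else
        R :: egInsert R rest (R.getD c 0)

/-- The rows of the insertion tableau `P(a)`. -/
def insertionTableau (a : List ℕ) : List (List ℕ) :=
  a.foldl (fun T x => egInsert [] T x) []

/-! ### Little bumps and the Little map -/

/-- The word obtained from `a` by bumping at (0-based) position `t`: the letter there is decreased
by one, unless it equals `1`, in which case all other letters are increased by one. -/
def bump (a : List ℕ) (t : ℕ) : List ℕ :=
  if a.getD t 0 = 1 then (a.map (· + 1)).set t 1 else a.set t (a.getD t 0 - 1)

/-- `LittleBump a t b`: the Little bump of `a` started at position `t` ends with `b`.  Bump at `t`;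
stop if the result is reduced; otherwise go on with the other position whose deletion leaves a
reduced word (deleting position `t` always does, so that `s ≠ t` has to be asked for). -/
inductive LittleBump : List ℕ → ℕ → List ℕ → Prop
  | done {a : List ℕ} {t : ℕ} : IsReduced (bump a t) → LittleBump a t (bump a t)
  | step {a b : List ℕ} {t s : ℕ} : ¬ IsReduced (bump a t) → s < a.length → s ≠ t →
      IsReduced ((bump a t).eraseIdx s) → LittleBump (bump a t) s b → LittleBump a t b

/-- The letter of `a` at position `t` interchanges the values `x` and `y` when the identity is
transformed into `wordProd a` by successive right multiplication with simple transpositions. -/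
def Interchanges (a : List ℕ) (t x y : ℕ) : Prop :=
  t < a.length ∧
    ({wordProd (a.take t) (a.getD t 0), wordProd (a.take t) (a.getD t 0 + 1)} : Set ℕ) = {x, y}

/-- `LittleMap k v a b`: the Little map `θ_{k,v}` is defined at `a` and sends it to `b`.  Here `a`
is a reduced word of some `w` with `w j = v` for a `j > k` such that
`ℓ(w) = ℓ(w t_{k,j}) + 1`, and `b` results from the Little bump started at the letter
interchanging `w k` and `w j`. -/
def LittleMap (k v : ℕ) (a b : List ℕ) : Prop :=
  IsReduced a ∧ ∃ j t, k < j ∧ wordProd a j = v ∧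
    len (wordProd a) = len (wordProd a * swap k j) + 1 ∧
    Interchanges a t (wordProd a k) v ∧ LittleBump a t b

/-- The complement `(n - a₁, …, n - a_ℓ)` of a word in the letters `1, …, n - 1`. -/
def compl (n : ℕ) (a : List ℕ) : List ℕ := a.map (n - ·)

/-- `LittleMapInv n k v a b`: the inverse Little map `θ_{k,v}⁻¹`, given by conjugating
`θ_{n+1-k,n+1-v}` with the complement, sends `a` to `b`; all words involved have letters in
`1, …, n - 1`. -/
def LittleMapInv (n k v : ℕ) (a b : List ℕ) : Prop :=
  (∀ x ∈ a, x < n) ∧ (∀ x ∈ b, x < n) ∧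
    LittleMap (n + 1 - k) (n + 1 - v) (compl n a) (compl n b)

/-- `LittleMapInvSeq n [(k₁,v₁), …, (k_m,v_m)] a b`: applying `θ_{k₁,v₁}⁻¹`, then `θ_{k₂,v₂}⁻¹`,
and so on, to `a` gives `b`. -/
inductive LittleMapInvSeq (n : ℕ) : List (ℕ × ℕ) → List ℕ → List ℕ → Prop
  | nil {a : List ℕ} : LittleMapInvSeq n [] a a
  | cons {k v : ℕ} {l : List (ℕ × ℕ)} {a b c : List ℕ} : LittleMapInv n k v a b →
      LittleMapInvSeq n l b c → LittleMapInvSeq n ((k, v) :: l) a c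

/-! ### The modified Lascoux–Schützenberger tree -/

/-- `w` avoids the pattern 132. -/
def IsDominant (n : ℕ) (w : Perm ℕ) : Prop :=
  ¬ ∃ i p j, 1 ≤ i ∧ i < p ∧ p < j ∧ j ≤ n ∧ w i < w j ∧ w j < w p

/-- `p` is the largest position of the "3" in a 132-pattern of `w`, and `q` is the largest
position after `p` with `w q < w p` and `w i < w q` for some `i < p`. -/
def IsTransition (n : ℕ) (w : Perm ℕ) (p q : ℕ) : Prop :=
  IsGreatest {t | ∃ i j, 1 ≤ i ∧ i < t ∧ t < j ∧ j ≤ n ∧ w i < w j ∧ w j < w t} p ∧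
  IsGreatest {j | p < j ∧ j ≤ n ∧ w j < w p ∧ ∃ i, 1 ≤ i ∧ i < p ∧ w i < w j} q

/-- The index set `I(u, k)`. -/
def coverSet (u : Perm ℕ) (k : ℕ) : Set ℕ :=
  {i | 1 ≤ i ∧ i < k ∧ len (u * swap i k) = len u + 1}

/-! ### Bumpless pipedreams -/

/-- A labelling of the edges of the grid: `south i j` is the label of the pipe crossing the bottom
edge of the box `(i, j)` (so `south (i - 1) j` belongs to its top edge), `east i j` the label of
the pipe crossing its right edge (so `east i (j - 1)` belongs to its left edge); the label `0`
means that there is no pipe. -/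
@[ext]
structure EdgeLabelling where
  south : ℕ → ℕ → ℕ
  east : ℕ → ℕ → ℕ

namespace EdgeLabelling

variable (P : EdgeLabelling) (i j : ℕ)

def IsBlank : Prop :=
  P.east i (j - 1) = 0 ∧ P.south i j = 0 ∧ P.south (i - 1) j = 0 ∧ P.east i j = 0

/-- A pipe enters from the west and leaves to the north. -/
def IsNWElbow : Prop :=
  P.east i (j - 1) ≠ 0 ∧ P.south (i - 1) j = P.east i (j - 1) ∧ P.south i j = 0 ∧ P.east i j = 0

/-- A pipe enters from the south and leaves to the east. -/
def IsSEElbow : Prop :=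
  P.south i j ≠ 0 ∧ P.east i j = P.south i j ∧ P.east i (j - 1) = 0 ∧ P.south (i - 1) j = 0

def IsHorizontal : Prop :=
  P.east i (j - 1) ≠ 0 ∧ P.east i j = P.east i (j - 1) ∧ P.south i j = 0 ∧ P.south (i - 1) j = 0

def IsVertical : Prop :=
  P.south i j ≠ 0 ∧ P.south (i - 1) j = P.south i j ∧ P.east i (j - 1) = 0 ∧ P.east i j = 0

def IsCrossing : Prop :=
  P.east i (j - 1) ≠ 0 ∧ P.east i j = P.east i (j - 1) ∧
    P.south i j ≠ 0 ∧ P.south (i - 1) j = P.south i j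

instance : Decidable (P.IsBlank i j) := by unfold IsBlank; infer_instance

instance : Decidable (P.IsNWElbow i j) := by unfold IsNWElbow; infer_instance

end EdgeLabelling

/-- The box `(i, j)` lies in the `n × n` grid. -/
def InGrid (n i j : ℕ) : Prop := 1 ≤ i ∧ i ≤ n ∧ 1 ≤ j ∧ j ≤ n

/-- A bumpless pipedream of `w` in the `n × n` grid.  Pipe `k` enters through the south boundary in
column `k` and leaves through the east boundary in row `w⁻¹ k`; nothing meets the north and west
boundaries.  Each box is one of the six tiles, so pipes go north or east only, do not share a step
and do not bump; two pipes cross at most once. -/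
@[ext]
structure BPD (n : ℕ) (w : Perm ℕ) extends EdgeLabelling where
  south_off : ∀ i j, ¬ InGrid n i j → south i j = 0
  east_off : ∀ i j, ¬ InGrid n i j → east i j = 0
  south_boundary : ∀ j, 1 ≤ j → j ≤ n → south n j = j
  east_boundary : ∀ i, 1 ≤ i → i ≤ n → east i n = w i
  tile : ∀ i j, InGrid n i j →
    toEdgeLabelling.IsBlank i j ∨ toEdgeLabelling.IsNWElbow i j ∨
    toEdgeLabelling.IsSEElbow i j ∨ toEdgeLabelling.IsHorizontal i j ∨
    toEdgeLabelling.IsVertical i j ∨ toEdgeLabelling.IsCrossing i j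
  cross_once : ∀ i j i' j', InGrid n i j → InGrid n i' j' →
    toEdgeLabelling.IsCrossing i j → toEdgeLabelling.IsCrossing i' j' →
    s(east i j, south i j) = s(east i' j', south i' j') → i = i' ∧ j = j'

namespace BPD

variable {n : ℕ} {w : Perm ℕ}

/-- The empty boxes, as 0-based cells. -/
def emptyCells (P : BPD n w) : Finset (ℕ × ℕ) :=
  (Finset.range n ×ˢ Finset.range n).filter fun c => P.IsBlank (c.1 + 1) (c.2 + 1)

/-- The NW elbows, listed in increasing order (by row, then by column). -/
def nwElbows (P : BPD n w) : List (ℕ × ℕ) :=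
  (List.range' 1 n ×ˢ List.range' 1 n).filter fun c => P.IsNWElbow c.1 c.2

/-- The empty boxes form a Young diagram in the northwest corner. -/
def IsEG (P : BPD n w) : Prop := IsLowerSet (P.emptyCells : Set (ℕ × ℕ))

/-- The Rothe pipedream: the one without NW elbows. -/
def IsRothe (P : BPD n w) : Prop := ∀ i j, InGrid n i j → ¬ P.IsNWElbow i j

/-- `P'` is obtained from `P` by the droop that swaps the SE elbow `(a, b)` with the empty box
`(c, d)` strictly southeast of it.  In the rectangle with these corners, the pipe through the
elbow fills the westmost column and northmost row, and there is no other elbow; this pipe is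
rerouted along the southmost row and eastmost column, and all other pipes are left unchanged. -/
structure IsDroop (P P' : BPD n w) (a b c d : ℕ) : Prop where
  elbow_mem : InGrid n a b
  box_mem : InGrid n c d
  row_lt : a < c
  col_lt : b < d
  elbow : P.IsSEElbow a b
  box : P.IsBlank c d
  west : ∀ i, a ≤ i → i < c → P.south i b = P.south a b
  north : ∀ j, b ≤ j → j < d → P.east a j = P.south a b
  no_elbow : ∀ i j, a ≤ i → i ≤ c → b ≤ j → j ≤ d → (i, j) ≠ (a, b) →
    ¬ P.IsNWElbow i j ∧ ¬ P.IsSEElbow i j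
  free_south : ∀ i, a ≤ i → i < c → P.south i d = 0
  free_east : ∀ j, b ≤ j → j < d → P.east c j = 0
  new_south : ∀ i j, P'.south i j =
    if a ≤ i ∧ i < c ∧ j = b then 0
    else if a ≤ i ∧ i < c ∧ j = d then P.south a b
    else P.south i j
  new_east : ∀ i j, P'.east i j =
    if b ≤ j ∧ j < d ∧ i = a then 0
    else if b ≤ j ∧ j < d ∧ i = c then P.south a b
    else P.east i j

end BPD

/-- The EG-pipedreams of `w`. -/
def EG (n : ℕ) (w : Perm ℕ) : Type := {P : BPD n w // P.IsEG}

/-- The Young diagram formed by the empty boxes of an EG-pipedream. -/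
def EG.shape {n : ℕ} {w : Perm ℕ} (P : EG n w) : YoungDiagram := ⟨P.1.emptyCells, P.2⟩

/-! ### The two constructions -/

/-- `EGNode n w u P`: some node of the modified LS-tree of `w` is labelled `u` and the corresponding
node of the Edelman–Greene tree of `w` is labelled `P`.  The roots are `w` and its Rothe pipedream.
A node with a non-dominant label `u` and indices `p, q` has one child for each
`i ∈ I(u t_{p,q}, p)`, labelled `u t_{p,q} t_{i,p}`; the pipedream of the child is obtained by the
droop swapping `(i, u i)` and `(p, u q)`. -/
inductive EGNode (n : ℕ) (w : Perm ℕ) : Perm ℕ → BPD n w → Prop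
  | root {P : BPD n w} : P.IsRothe → EGNode n w w P
  | child {u : Perm ℕ} {P P' : BPD n w} {p q i : ℕ} : EGNode n w u P → IsTransition n u p q →
      i ∈ coverSet (u * swap p q) p → BPD.IsDroop P P' i (u i) p (u q) →
      EGNode n w (u * swap p q * swap i p) P'

/-- `Path n w a₀ u a P`: starting with the reduced word `a₀` of `w`, iterate the Little maps
`θ_{p, u q}` along the modified LS-tree and perform the corresponding steps of the
Edelman–Greene tree; after some number of steps, the current permutation is `u`, the
current reduced word (of `u`) is `a`, and the current bumpless pipedream of `w` is `P`. -/
inductive Path (n : ℕ) (w : Perm ℕ) (a₀ : List ℕ) : Perm ℕ → List ℕ → BPD n w → Prop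
  | root {P : BPD n w} : P.IsRothe → Path n w a₀ w a₀ P
  | step {u : Perm ℕ} {a a' : List ℕ} {P P' : BPD n w} {p q i : ℕ} : Path n w a₀ u a P →
      IsTransition n u p q → LittleMap p (u q) a a' →
      i ∈ coverSet (u * swap p q) p → IsReducedWord (u * swap p q * swap i p) a' →
      BPD.IsDroop P P' i (u i) p (u q) →
      Path n w a₀ (u * swap p q * swap i p) a' P'

/-- The construction of `Γ` applied to `T` ends in `P`: the path started with the column reading
word of `T` reaches a dominant permutation together with the pipedream `P`. -/
def GammaConstruction {n : ℕ} {w : Perm ℕ} (T : RT w) (P : EG n w) : Prop :=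
  ∃ u a, Path n w T.1.column u a P.1 ∧ IsDominant n u

/-- The inverse construction applied to `P` ends in `T`: let `u` be the (dominant) label of a leaf
of the modified LS-tree corresponding to `P`, and `T'` the reduced word tableau for `u`, which is
frozen.  Apply to the column reading word of `T'` the inverse Little maps `θ_{i,j}⁻¹` for the NW
elbows `(i, j)` of `P` in increasing order; then `T` is the insertion tableau of the reverse of the
resulting word, which is a reduced word of `w`. -/
def InverseConstruction {n : ℕ} {w : Perm ℕ} (P : EG n w) (T : RT w) : Prop :=
  ∃ (u : Perm ℕ) (T' : RT u) (b : List ℕ), EGNode n w u P.1 ∧ IsDominant n u ∧ T'.1.IsFrozen ∧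
    LittleMapInvSeq n P.1.nwElbows T'.1.column b ∧ IsReducedWord w b ∧
    T.1.rows = insertionTableau b.reverse

end BumplessEG

/-! Every step of the tree from `u` to a child passes through `y = u * swap p q`, which is covered
by `u`. Since `p` and `q` are as large as possible, `u` is the only cover of `y` of the form `y *
swap p q'` with `p < q' ≤ n` (`IsTransition.eq_of_inv_eq`), while the children are the covers `y *
swap i p` with `i < p`. The Little map is therefore a bijection from the reduced words of `u` to the
reduced words of all children together. Complementing the letters turns bumps around, so a Little
bump can be retraced from its last letter (`State.retrace`, `LittleMap.inv`), and the uniqueness of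
`q` tells where a backward bump must arrive (`IsStep.exists_littleMap_to`). Single bumps are
controlled by one fact: a nonreduced word that becomes reduced on deleting some letter has exactly
one other such letter (`exists_partner`, `no_third`).

This bijection restricts to tableaux of a given shape. Little bumps commute with Coxeter–Knuth moves
(`simulates_of_ck`) and preserve descents (`State.descents`), and any relation with these two
properties carries column reading words of tableaux to column reading words of tableaux of the same
shape (`IsBisim.exists_tableau`): descents make the columns increase, and the row inequalities
follow by performing the same sequence of Coxeter–Knuth moves on both words (`IsBisim.lt_of_rect`).
At a leaf the label is dominant and has only one reduced word tableau, the frozen one, whose shape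
is the Rothe diagram of the label (`IncreasingTableau.isFrozen_of_isDominant`,
`IncreasingTableau.IsFrozen.inRothe_iff`). So a tableau is determined by the path it follows, and
its shape can be read off at the end.

For pipedreams, the invariant `BPD.Matches` says that before some frontier box the pipedream
occupies the same edges as the Rothe pipedream of the current label, and that beyond the frontier
its empty boxes form the Rothe diagram of the label and take no part in 132-patterns. Each droop is
possible, creates one NW elbow strictly before the old frontier, and makes it the new frontier.
Hence the process ends, the NW elbows in increasing order list the steps from last to first, and at
a dominant label the empty boxes form a Young diagram. Conversely, a pipedream can be reconstructed
box by box from the southeast corner, the only ambiguity being whether a box with free south and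
east edges is empty or a NW elbow (`BPD.west_north_eq`). Comparing a given EG-pipedream with a node
in this way, one finds that it has an elbow in the transition box and that the pipe through this
elbow names the child to choose; so it is reached (`BPD.exists_egNode`). -/

namespace BumplessEG

open Equiv

/-! ### Inversions and reduced words -/

/-- `w` moves only finitely many numbers. -/
def FinSupp (w : Perm ℕ) : Prop := ∃ N, ∀ i, N ≤ i → w i = i

lemma finSupp_one : FinSupp 1 := ⟨0, fun _ _ => rfl⟩

lemma FinSupp.mul {u v : Perm ℕ} (hu : FinSupp u) (hv : FinSupp v) : FinSupp (u * v) := by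
  obtain ⟨N, hN⟩ := hu
  obtain ⟨M, hM⟩ := hv
  refine ⟨max N M, fun i hi => ?_⟩
  rw [Perm.mul_apply, hM i (le_trans (le_max_right _ _) hi), hN i (le_trans (le_max_left _ _) hi)]

lemma finSupp_swap (i j : ℕ) : FinSupp (swap i j) :=
  ⟨i + j + 1, fun k hk => swap_apply_of_ne_of_ne (by omega) (by omega)⟩

lemma InSym.finSupp {n : ℕ} {w : Perm ℕ} (hw : InSym n w) : FinSupp w :=
  ⟨n + 1, fun i hi => hw i (by simp; omega)⟩

lemma InSym.zero {n : ℕ} {w : Perm ℕ} (hw : InSym n w) : w 0 = 0 := hw 0 (by simp)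

/-- The inversions of `w`, as pairs of positions. -/
def inversions (w : Perm ℕ) : Set (ℕ × ℕ) := {x | x.1 < x.2 ∧ w x.2 < w x.1}

/-- The number of inversions of `w`. -/
noncomputable def inv (w : Perm ℕ) : ℕ := (inversions w).ncard

lemma FinSupp.finite {w : Perm ℕ} (hw : FinSupp w) : (inversions w).Finite := by
  obtain ⟨N, hN⟩ := hw
  refine (Set.finite_Iio N |>.prod (Set.finite_Iio N)).subset ?_
  rintro ⟨i, j⟩ ⟨h1, h2⟩
  simp only at h1 h2
  have hj : j < N := by
    by_contra hj
    have h3 := hN j (by omega)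
    have h4 := hN (w i) (by omega)
    have h5 := w.injective h4
    omega
  exact ⟨by simp only [Set.mem_Iio]; omega, hj⟩

/-- The involution on pairs of positions comparing the inversions of `w` and `w * swap i j`. -/
def flipPair (i j : ℕ) (x : ℕ × ℕ) : ℕ × ℕ :=
  if swap i j x.1 < swap i j x.2 then (swap i j x.1, swap i j x.2) else x

lemma flipPair_flipPair (i j : ℕ) {x : ℕ × ℕ} (hx : x.1 < x.2) :
    flipPair i j (flipPair i j x) = x := by
  unfold flipPair
  split_ifs with _ h2
  · simp
  · simp at h2; omega
  · rfl

/-- Inversions are carried along by the transposition of positions, except for those pairs whose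
order it would reverse; these stay where they are and remain inversions because `w i < w j`. As the
map is injective, lengths are compared by counting the inversions it misses. -/
lemma flipPair_mem {w : Perm ℕ} {i j : ℕ} (hij : i < j) (hw : w i < w j) {x : ℕ × ℕ}
    (hx : x ∈ inversions w) : flipPair i j x ∈ inversions (w * swap i j) := by
  obtain ⟨a, b⟩ := x
  obtain ⟨h1, h2⟩ := hx
  simp only at h1 h2
  unfold flipPair
  split_ifs with h
  · exact ⟨h, by simpa using h2⟩
  · refine ⟨h1, ?_⟩
    simp only [Perm.mul_apply]
    simp only [swap_apply_def] at h ⊢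
    split_ifs at h ⊢ <;> subst_vars <;> omega

lemma flipPair_image_subset {w : Perm ℕ} {i j : ℕ} (hij : i < j) (hw : w i < w j) :
    flipPair i j '' inversions w ⊆ inversions (w * swap i j) := by
  rintro _ ⟨x, hx, rfl⟩
  exact flipPair_mem hij hw hx

lemma flipPair_not_mem_image {w : Perm ℕ} {i j : ℕ} {x : ℕ × ℕ}
    (h1 : flipPair i j x = x) (h2 : x ∉ inversions w) :
    x ∉ flipPair i j '' inversions w := by
  rintro ⟨y, hy, rfl⟩
  rw [flipPair_flipPair i j hy.1] at h1
  exact h2 (h1 ▸ hy)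

lemma ncard_flipPair_image (w : Perm ℕ) (i j : ℕ) :
    (flipPair i j '' inversions w).ncard = inv w := by
  refine Set.InjOn.ncard_image fun x hx y hy hxy => ?_
  rw [← flipPair_flipPair i j hx.1, hxy, flipPair_flipPair i j hy.1]

lemma inv_lt_inv_mul_swap {w : Perm ℕ} (hf : FinSupp w) {i j : ℕ} (hij : i < j)
    (hw : w i < w j) : inv w < inv (w * swap i j) := by
  rw [← ncard_flipPair_image w i j]
  apply Set.ncard_lt_ncard _ (hf.mul (finSupp_swap i j)).finite
  refine ⟨flipPair_image_subset hij hw, fun h => ?_⟩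
  refine flipPair_not_mem_image (x := (i, j)) ?_ ?_ (h ⟨hij, by simpa using hw⟩)
  · unfold flipPair; simp; omega
  · rintro ⟨-, h⟩; simp only at h; omega

/-- Besides `(i, j)`, the pair `(i, k)` is missed by `flipPair`: both are fixed by it and neither is
an inversion of `w`. -/
lemma inv_mul_swap_of_between {w : Perm ℕ} (hf : FinSupp w) {i j k : ℕ} (hik : i < k)
    (hkj : k < j) (h1 : w i < w k) (h2 : w k < w j) : inv w + 2 ≤ inv (w * swap i j) := by
  have hs : flipPair i j '' inversions w ∪ {(i, j), (i, k)} ⊆ inversions (w * swap i j) := by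
    refine Set.union_subset (flipPair_image_subset (by omega) (by omega)) ?_
    rintro x (rfl | rfl)
    · exact ⟨by simp; omega, by simp; omega⟩
    · refine ⟨hik, ?_⟩
      simp only [Perm.mul_apply, swap_apply_left]
      rwa [swap_apply_of_ne_of_ne (by omega) (by omega)]
  have h := Set.ncard_le_ncard hs (hf.mul (finSupp_swap i j)).finite
  rw [Set.ncard_union_eq ?_ (hf.finite.image _) (Set.toFinite _), ncard_flipPair_image,
    Set.ncard_pair] at h
  · exact h
  · simp; omega
  · rw [Set.disjoint_right]
    rintro x (rfl | rfl)
    · refine flipPair_not_mem_image ?_ ?_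
      · unfold flipPair; simp; omega
      · rintro ⟨-, h⟩; simp only at h; omega
    · refine flipPair_not_mem_image ?_ ?_
      · unfold flipPair
        simp only [swap_apply_left]
        rw [swap_apply_of_ne_of_ne (by omega) (by omega), if_neg (by omega)]
      · rintro ⟨-, h⟩; simp only at h; omega

lemma inv_mul_swap_of_cover {w : Perm ℕ} (hf : FinSupp w) {i j : ℕ} (hij : i < j)
    (hw : w i < w j) (hb : ∀ k, i < k → k < j → ¬ (w i < w k ∧ w k < w j)) :
    inv (w * swap i j) = inv w + 1 := by
  apply le_antisymm _ (inv_lt_inv_mul_swap hf hij hw)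
  have hs : inversions (w * swap i j) ⊆ insert (i, j) (flipPair i j '' inversions w) := by
    rintro ⟨a, b⟩ ⟨h1, h2⟩
    simp only [Perm.mul_apply] at h1 h2
    by_cases h : (a, b) = (i, j)
    · exact Or.inl h
    refine Or.inr ⟨flipPair i j (a, b), ?_, flipPair_flipPair i j h1⟩
    unfold flipPair
    split_ifs with h3
    · exact ⟨h3, h2⟩
    · refine ⟨h1, ?_⟩
      simp only [Prod.mk.injEq] at h h3 ⊢
      have hbi := hb b
      have hai := hb a
      have hne : w a ≠ w b := fun h => by have := w.injective h; omega
      have hn1 : a ≠ i → w a ≠ w i := fun h => w.injective.ne h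
      have hn2 : b ≠ j → w b ≠ w j := fun h => w.injective.ne h
      simp only [swap_apply_def] at h2 h3
      split_ifs at h2 h3 <;> subst_vars <;> omega
  have h := Set.ncard_le_ncard hs ((hf.finite.image _).insert _)
  refine h.trans ((Set.ncard_insert_le _ _).trans ?_)
  rw [ncard_flipPair_image]

/-- The covering relations of the Bruhat order. -/
lemma inv_mul_swap_eq_iff {w : Perm ℕ} (hf : FinSupp w) {i j : ℕ} (hij : i < j) :
    inv (w * swap i j) = inv w + 1 ↔
      w i < w j ∧ ∀ k, i < k → k < j → ¬ (w i < w k ∧ w k < w j) := by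
  refine ⟨fun h => ?_, fun h => inv_mul_swap_of_cover hf hij h.1 h.2⟩
  have hne : w i ≠ w j := w.injective.ne hij.ne
  have hlt : w i < w j := by
    by_contra hlt
    have := inv_lt_inv_mul_swap (hf.mul (finSupp_swap i j)) hij (by simp; omega)
    rw [mul_assoc, swap_mul_self, mul_one] at this
    omega
  refine ⟨hlt, fun k h1 h2 h3 => ?_⟩
  have := inv_mul_swap_of_between hf h1 h2 h3.1 h3.2
  omega

lemma lt_of_inv_mul_swap_lt {w : Perm ℕ} (hf : FinSupp w) {i j : ℕ} (hij : i < j)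
    (h : inv w < inv (w * swap i j)) : w i < w j := by
  have hne : w i ≠ w j := w.injective.ne hij.ne
  by_contra hlt
  have := inv_lt_inv_mul_swap (hf.mul (finSupp_swap i j)) hij (by simp; omega)
  rw [mul_assoc, swap_mul_self, mul_one] at this
  omega

lemma inv_mul_simple {w : Perm ℕ} (hf : FinSupp w) {k : ℕ} (h : w k < w (k + 1)) :
    inv (w * swap k (k + 1)) = inv w + 1 :=
  inv_mul_swap_of_cover hf (by omega) h (by omega)

lemma inv_mul_simple' {w : Perm ℕ} (hf : FinSupp w) {k : ℕ} (h : w (k + 1) < w k) :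
    inv (w * swap k (k + 1)) + 1 = inv w := by
  rw [← inv_mul_simple (k := k) (w := w * swap k (k + 1)) (hf.mul (finSupp_swap k (k + 1)))
      (by simpa using h), mul_assoc,
    swap_mul_self, mul_one]

@[simp] lemma wordProd_nil : wordProd [] = 1 := rfl

@[simp] lemma wordProd_cons (k : ℕ) (a : List ℕ) :
    wordProd (k :: a) = swap k (k + 1) * wordProd a := rfl

@[simp] lemma wordProd_append (a b : List ℕ) :
    wordProd (a ++ b) = wordProd a * wordProd b := by
  simp [wordProd]

lemma finSupp_wordProd (a : List ℕ) : FinSupp (wordProd a) := by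
  induction a with
  | nil => exact finSupp_one
  | cons k a ih => exact (finSupp_swap _ _).mul ih

lemma wordProd_zero {a : List ℕ} (ha : ∀ x ∈ a, 1 ≤ x) : wordProd a 0 = 0 := by
  induction a with
  | nil => rfl
  | cons k a ih =>
    have hk := ha k (by simp)
    rw [wordProd_cons, Perm.mul_apply, ih (fun x hx => ha x (by simp [hx])),
      swap_apply_of_ne_of_ne (by omega) (by omega)]

/-- The value standing on the left of the letter at position `t`. -/
def lo (a : List ℕ) (t : ℕ) : ℕ := wordProd (a.take t) (a.getD t 0)

/-- The value standing on the right of the letter at position `t`. -/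
def hi (a : List ℕ) (t : ℕ) : ℕ := wordProd (a.take t) (a.getD t 0 + 1)

lemma lo_ne_hi (a : List ℕ) (t : ℕ) : lo a t ≠ hi a t :=
  (wordProd (a.take t)).injective.ne (by omega)

lemma inv_wordProd_le (a : List ℕ) : inv (wordProd a) ≤ a.length := by
  induction a using List.reverseRecOn with
  | nil =>
    have : inversions 1 = ∅ :=
       Set.eq_empty_of_forall_notMem fun x hx => hx.1.asymm hx.2
    simp [inv, this]
  | append_singleton a k ih =>
    have h1 : wordProd (a ++ [k]) = wordProd a * swap k (k + 1) := by simp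
    rw [h1, List.length_append, List.length_singleton]
    have hne : wordProd a k ≠ wordProd a (k + 1) := (wordProd a).injective.ne (by omega)
    rcases lt_or_gt_of_ne hne with h | h
    · rw [inv_mul_simple (finSupp_wordProd a) h]; omega
    · have := inv_mul_simple' (finSupp_wordProd a) h; omega

/-- Each letter changes the number of inversions by one, and it goes up exactly when the smaller
value stands on the left. This is the working criterion for reducedness. -/
lemma inv_wordProd_eq_iff (a : List ℕ) :
    inv (wordProd a) = a.length ↔ ∀ t < a.length, lo a t < hi a t := by
  induction a using List.reverseRecOn with
  | nil =>
    have := inv_wordProd_le []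
    simp_all
  | append_singleton a k ih =>
    have h1 : wordProd (a ++ [k]) = wordProd a * swap k (k + 1) := by simp
    have h2 : (∀ t < (a ++ [k]).length, lo (a ++ [k]) t < hi (a ++ [k]) t) ↔
        (∀ t < a.length, lo a t < hi a t) ∧ wordProd a k < wordProd a (k + 1) := by
      have e1 : ∀ t < a.length, lo (a ++ [k]) t = lo a t ∧ hi (a ++ [k]) t = hi a t := by
        intro t ht
        simp [lo, hi, List.take_append_of_le_length ht.le, List.getElem?_append_left ht]
      have e2 : lo (a ++ [k]) a.length = wordProd a k ∧
          hi (a ++ [k]) a.length = wordProd a (k + 1) := by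
        simp [lo, hi]
      constructor
      · intro h
        refine ⟨fun t ht => ?_, ?_⟩
        · have := h t (by simp; omega)
          rwa [(e1 t ht).1, (e1 t ht).2] at this
        · have := h a.length (by simp)
          rwa [e2.1, e2.2] at this
      · rintro ⟨h, h'⟩ t ht
        simp only [List.length_append, List.length_singleton] at ht
        rcases Nat.lt_succ_iff_lt_or_eq.1 ht with ht | rfl
        · rw [(e1 t ht).1, (e1 t ht).2]; exact h t ht
        · rwa [e2.1, e2.2]
    rw [h2, h1, List.length_append, List.length_singleton, ← ih]
    have hle := inv_wordProd_le a
    have hne : wordProd a k ≠ wordProd a (k + 1) := (wordProd a).injective.ne (by omega)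
    rcases lt_or_gt_of_ne hne with h | h
    · rw [inv_mul_simple (finSupp_wordProd a) h]; omega
    · have := inv_mul_simple' (finSupp_wordProd a) h; omega

lemma exists_word {w : Perm ℕ} (hf : FinSupp w) (h0 : w 0 = 0) :
    ∃ a : List ℕ, (∀ x ∈ a, 1 ≤ x) ∧ wordProd a = w ∧ a.length = inv w := by
  induction hm : inv w generalizing w with
  | zero =>
    have hmono : StrictMono w := by
      intro i j hij
      by_contra h
      have h1 : (i, j) ∈ inversions w :=
        ⟨hij, lt_of_le_of_ne (not_lt.1 h) (w.injective.ne hij.ne')⟩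
      rw [inv, Set.ncard_eq_zero hf.finite] at hm
      simp [hm] at h1
    -- A permutation without inversions is an order automorphism of `ℕ`, and the identity is the
    -- only one.
    have h1 : StrictMono.orderIsoOfSurjective w hmono w.surjective = OrderIso.refl ℕ :=
      Subsingleton.elim _ _
    refine ⟨[], by simp, ?_, rfl⟩
    ext i
    have := congrArg (fun f : ℕ ≃o ℕ => f i) h1
    simpa using this.symm
  | succ m ih =>
    -- There is no descent at position `0` because `w 0 = 0`, so the descent found is an admissible
    -- letter.
    have hd : ∃ k, 1 ≤ k ∧ w (k + 1) < w k := by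
      by_contra! h
      have hmono : StrictMono w := by
        apply strictMono_nat_of_lt_succ
        intro k
        have hne : w k ≠ w (k + 1) := w.injective.ne (by omega)
        rcases Nat.eq_zero_or_pos k with rfl | hk
        · omega
        · have := h k hk; omega
      have : inversions w = ∅ :=
        Set.eq_empty_of_forall_notMem fun x hx => (hmono hx.1).asymm hx.2
      simp [inv, this] at hm
    obtain ⟨k, hk, hd⟩ := hd
    have h1 := inv_mul_simple' hf hd
    obtain ⟨a, ha1, ha2, ha3⟩ := ih (w := w * swap k (k + 1)) (hf.mul (finSupp_swap _ _))
      (by rw [Perm.mul_apply, swap_apply_of_ne_of_ne (by omega) (by omega), h0]) (by omega)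
    refine ⟨a ++ [k], ?_, ?_, by simp [ha3]⟩
    · intro x hx
      simp only [List.mem_append, List.mem_singleton] at hx
      rcases hx with hx | rfl
      · exact ha1 x hx
      · exact hk
    · simp [ha2, mul_assoc]

lemma len_eq_inv {w : Perm ℕ} (hf : FinSupp w) (h0 : w 0 = 0) : len w = inv w := by
  obtain ⟨a, ha1, ha2, ha3⟩ := exists_word hf h0
  apply le_antisymm
  · exact Nat.sInf_le ⟨a, ha1, ha2, ha3⟩
  · refine le_csInf ⟨_, a, ha1, ha2, ha3⟩ ?_
    rintro m ⟨b, -, hb, rfl⟩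
    rw [← hb]
    exact inv_wordProd_le b

lemma isReduced_iff_inv {a : List ℕ} :
    IsReduced a ↔ (∀ x ∈ a, 1 ≤ x) ∧ inv (wordProd a) = a.length := by
  refine and_congr_right fun h => ?_
  rw [len_eq_inv (finSupp_wordProd a) (wordProd_zero h), eq_comm]

lemma isReduced_iff {a : List ℕ} :
    IsReduced a ↔ (∀ x ∈ a, 1 ≤ x) ∧ ∀ t < a.length, lo a t < hi a t := by
  rw [isReduced_iff_inv, inv_wordProd_eq_iff]

lemma wordProd_take_succ {a : List ℕ} {t : ℕ} (ht : t < a.length) :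
    wordProd (a.take (t + 1)) = wordProd (a.take t) * swap (a.getD t 0) (a.getD t 0 + 1) := by
  have : a.getD t 0 = a[t] := by simp [ht]
  rw [List.take_add_one, this, wordProd_append]
  simp [ht]

lemma wordProd_take_succ' {a : List ℕ} {t : ℕ} (ht : t < a.length) :
    wordProd (a.take (t + 1)) = swap (lo a t) (hi a t) * wordProd (a.take t) := by
  rw [wordProd_take_succ ht, lo, hi, mul_swap_eq_swap_mul]

/-- Deleting a letter exchanges two values in the product. This is why `lo` and `hi` record values
rather than positions. -/
lemma wordProd_eraseIdx {a : List ℕ} {t : ℕ} (ht : t < a.length) :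
    wordProd (a.eraseIdx t) = swap (lo a t) (hi a t) * wordProd a := by
  have h := wordProd_take_succ' ht
  have h1 : wordProd a = wordProd (a.take (t + 1)) * wordProd (a.drop (t + 1)) := by
    rw [← wordProd_append, List.take_append_drop]
  rw [h1, h, List.eraseIdx_eq_take_drop_succ, wordProd_append, ← mul_assoc, ← mul_assoc,
    swap_mul_self, one_mul]

/-- Two values change their relative position only at a letter interchanging them. -/
lemma exists_flip {a : List ℕ} {x y t₁ t₂ : ℕ} (h12 : t₁ ≤ t₂) (h2 : t₂ ≤ a.length)
    (hx : (wordProd (a.take t₁)).symm x < (wordProd (a.take t₁)).symm y)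
    (hy : (wordProd (a.take t₂)).symm y < (wordProd (a.take t₂)).symm x) :
    ∃ s, t₁ ≤ s ∧ s < t₂ ∧ lo a s = x ∧ hi a s = y := by
  induction t₂, h12 using Nat.le_induction with
  | base => omega
  | succ t h1t ih =>
    by_cases h : (wordProd (a.take t)).symm y < (wordProd (a.take t)).symm x
    · obtain ⟨s, hs⟩ := ih (by omega) h
      exact ⟨s, hs.1, by omega, hs.2.2⟩
    -- The order changes at the letter `t` itself, and an adjacent transposition reverses the order
    -- of two values only if they occupy its two places.
    · refine ⟨t, h1t, by omega, ?_⟩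
      rw [wordProd_take_succ (by omega)] at hy
      have e : ∀ z, (wordProd (a.take t) * swap (a.getD t 0) (a.getD t 0 + 1)).symm z =
          swap (a.getD t 0) (a.getD t 0 + 1) ((wordProd (a.take t)).symm z) := fun z => rfl
      rw [e, e] at hy
      have hxy : (wordProd (a.take t)).symm x ≠ (wordProd (a.take t)).symm y := by
        intro h'
        rw [h'] at hy; omega
      simp only [lo, hi]
      rw [← Equiv.eq_symm_apply, ← Equiv.eq_symm_apply]
      simp only [swap_apply_def] at hy
      constructor <;> split_ifs at hy <;> omega

end BumplessEG

namespace BumplessEG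

open Equiv

/-! ### Little bumps -/

lemma take_eraseIdx_of_le {a : List ℕ} {i k : ℕ} (h : i ≤ k) :
    (a.eraseIdx k).take i = a.take i := by
  rw [List.take_eraseIdx_eq_take_of_le _ _ _ h]

lemma lo_eraseIdx {a : List ℕ} {i k : ℕ} (h : i < k) : lo (a.eraseIdx k) i = lo a i := by
  simp [lo, take_eraseIdx_of_le h.le, List.getElem?_eraseIdx_of_lt h]

lemma hi_eraseIdx {a : List ℕ} {i k : ℕ} (h : i < k) : hi (a.eraseIdx k) i = hi a i := by
  simp [hi, take_eraseIdx_of_le h.le, List.getElem?_eraseIdx_of_lt h]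

/-- The reflection, acting on values, by which the product changes when the letter at position `t`
is deleted. -/
def refl (a : List ℕ) (t : ℕ) : Perm ℕ := swap (lo a t) (hi a t)

lemma refl_mul_self (a : List ℕ) (t : ℕ) : refl a t * refl a t = 1 := swap_mul_self _ _

/-- Deleting from right to left does not disturb the prefixes of the letters still to be deleted, so
the three reflections simply multiply. It is applied when they collapse to a single reflection
already known to lead to `v.length - 1` inversions, which is a contradiction. -/
lemma inv_refl_three {v : List ℕ} {i j k : ℕ} (hij : i < j) (hjk : j < k) (hk : k < v.length) :
    inv (refl v i * (refl v j * (refl v k * wordProd v))) + 3 ≤ v.length := by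
  have h1 := wordProd_eraseIdx hk
  have l1 : (v.eraseIdx k).length = v.length - 1 := List.length_eraseIdx_of_lt hk
  have h2 := wordProd_eraseIdx (a := v.eraseIdx k) (t := j) (by omega)
  have l2 : ((v.eraseIdx k).eraseIdx j).length = v.length - 1 - 1 := by
    rw [List.length_eraseIdx_of_lt (by omega), l1]
  have h3 := wordProd_eraseIdx (a := (v.eraseIdx k).eraseIdx j) (t := i) (by omega)
  have l3 : (((v.eraseIdx k).eraseIdx j).eraseIdx i).length = v.length - 1 - 1 - 1 := by
    rw [List.length_eraseIdx_of_lt (by omega), l2]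
  have h4 := inv_wordProd_le (((v.eraseIdx k).eraseIdx j).eraseIdx i)
  rw [lo_eraseIdx hjk, hi_eraseIdx hjk, h1] at h2
  rw [lo_eraseIdx hij, hi_eraseIdx hij, lo_eraseIdx (hij.trans hjk), hi_eraseIdx (hij.trans hjk),
    h2] at h3
  rw [h3, l3] at h4
  unfold refl
  omega

lemma symm_lo (v : List ℕ) (t : ℕ) : (wordProd (v.take t)).symm (lo v t) = v.getD t 0 := by
  simp [lo]

lemma symm_hi (v : List ℕ) (t : ℕ) : (wordProd (v.take t)).symm (hi v t) = v.getD t 0 + 1 := by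
  simp [hi]

lemma symm_take_succ {v : List ℕ} {t : ℕ} (ht : t < v.length) (z : ℕ) :
    (wordProd (v.take (t + 1))).symm z =
      swap (v.getD t 0) (v.getD t 0 + 1) ((wordProd (v.take t)).symm z) := by
  rw [wordProd_take_succ ht]; rfl

lemma symm_succ_lo {v : List ℕ} {t : ℕ} (ht : t < v.length) :
    (wordProd (v.take (t + 1))).symm (lo v t) = v.getD t 0 + 1 := by
  rw [symm_take_succ ht, symm_lo, swap_apply_left]

lemma symm_succ_hi {v : List ℕ} {t : ℕ} (ht : t < v.length) :
    (wordProd (v.take (t + 1))).symm (hi v t) = v.getD t 0 := by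
  rw [symm_take_succ ht, symm_hi, swap_apply_right]

/-- Follow the relative order of the two values interchanged by the letter `t`. If they start in the
wrong order, an earlier letter has interchanged them; if they end as they stood before `t`, a later
one interchanges them back. In the remaining case the letter `t` contributes an inversion to the
whole product, and `v` has as many inversions as letters. -/
lemma exists_partner {v : List ℕ} {t : ℕ} (ht : t < v.length)
    (hr : inv (wordProd (v.eraseIdx t)) + 1 = v.length) (hn : inv (wordProd v) ≠ v.length) :
    ∃ s < v.length, lo v s = hi v t ∧ hi v s = lo v t := by
  have a0 := symm_lo v t
  have a1 := symm_hi v t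
  have b0 := symm_succ_lo ht
  have b1 := symm_succ_hi ht
  by_cases h0 : hi v t < lo v t
  · obtain ⟨s, -, h1, h2⟩ := exists_flip (a := v) (x := hi v t) (y := lo v t) (Nat.zero_le t)
      ht.le (by rw [List.take_zero, wordProd_nil]; exact h0) (by omega)
    exact ⟨s, by omega, h2⟩
  have hne := lo_ne_hi v t
  by_cases hN : (wordProd v).symm (lo v t) < (wordProd v).symm (hi v t)
  · obtain ⟨s, -, h1, h2⟩ := exists_flip (a := v) (x := hi v t) (y := lo v t)
      (t₁ := t + 1) (t₂ := v.length) ht le_rfl (by omega) (by simpa using hN)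
    exact ⟨s, h1, h2⟩
  exfalso
  have hN' : (wordProd v).symm (lo v t) ≠ (wordProd v).symm (hi v t) :=
    (wordProd v).symm.injective.ne hne
  have e1 : wordProd (v.eraseIdx t) = wordProd v *
      swap ((wordProd v).symm (hi v t)) ((wordProd v).symm (lo v t)) := by
    rw [wordProd_eraseIdx ht, mul_swap_eq_swap_mul, apply_symm_apply, apply_symm_apply, swap_comm]
  have e2 : wordProd v = wordProd (v.eraseIdx t) *
      swap ((wordProd v).symm (hi v t)) ((wordProd v).symm (lo v t)) := by
    rw [e1, mul_assoc, swap_mul_self, mul_one]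
  have h1 := inv_lt_inv_mul_swap (w := wordProd (v.eraseIdx t))
    (i := (wordProd v).symm (hi v t)) (j := (wordProd v).symm (lo v t))
    (finSupp_wordProd _) (by omega) (by
      rw [e1]
      simp only [Perm.mul_apply, swap_apply_left, swap_apply_right, apply_symm_apply]
      omega)
  rw [← e2] at h1
  have := inv_wordProd_le v
  omega

lemma swap_conj_aux {x y z : ℕ} (hxy : x ≠ y) (hxz : x ≠ z) (hyz : y ≠ z) :
    swap x y * (swap x z * swap y z) = swap x z ∧ swap y z * (swap x z * swap x y) = swap x z := by
  constructor <;> ext k <;> simp only [Perm.mul_apply, swap_apply_def] <;>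
    split_ifs <;> omega

/-- Just after `t` and just before `s` the values `x` and `y` are adjacent, so `z` is on the same
side of both. Deleting three letters shows that between `t` and `s` no letter interchanges `y` and
`z`, and none but `r` interchanges `x` and `z`. Then `z` changes sides with respect to `x` exactly
once and with respect to `y` never, which is absurd. -/
lemma no_third_between {v : List ℕ} {t r s x y z : ℕ} (htr : t < r) (hrs : r < s)
    (hs : s < v.length) (h1 : refl v t = swap x y) (h2 : refl v s = swap x y)
    (h3 : refl v r = swap x z) (hxy : x ≠ y) (hxz : x ≠ z) (hyz : y ≠ z)
    (hst : ({lo v t, hi v t} : Set ℕ) = {x, y}) (hss : ({lo v s, hi v s} : Set ℕ) = {x, y})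
    (hsr : ({lo v r, hi v r} : Set ℕ) = {x, z})
    (e1 : inv (refl v t * wordProd v) + 1 = v.length)
    (e2 : inv (refl v r * wordProd v) + 1 = v.length) : False := by
  have three : ∀ {i j k}, i < j → j < k → k < v.length →
      inv (refl v i * (refl v j * (refl v k * wordProd v))) + 3 ≤ v.length :=
    fun h h' h'' => inv_refl_three h h' h''
  have key : ¬ ∃ r', t + 1 ≤ r' ∧ r' < s ∧ refl v r' = swap y z := by
    rintro ⟨r', h4, h5, h6⟩
    obtain ⟨c1, c2⟩ := swap_conj_aux hxy hxz hyz
    rcases lt_trichotomy r r' with h | rfl | h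
    · have := three htr h (by omega)
      rw [h1, h3, h6, ← mul_assoc, ← mul_assoc, mul_assoc (swap x y), c1, ← h3] at this
      omega
    · rw [h3] at h6
      have := congrArg (fun f : Perm ℕ => f x) h6
      simp [swap_apply_of_ne_of_ne hxy hxz] at this
      omega
    · have := three h hrs (by omega)
      rw [h2, h3, h6, ← mul_assoc, ← mul_assoc, mul_assoc (swap y z), c2, ← h3] at this
      omega
  have key2 : ¬ ∃ r', t + 1 ≤ r' ∧ r' < s ∧ r' ≠ r ∧ refl v r' = swap x z := by
    rintro ⟨r', h4, h5, h6, h7⟩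
    rcases lt_or_gt_of_ne h6 with h | h
    · have := three (i := t) (by omega) h (by omega)
      rw [h7, h3, ← mul_assoc (swap x z), swap_mul_self, one_mul] at this
      omega
    · have := three htr h (by omega)
      rw [h7, h3, ← mul_assoc (swap x z), swap_mul_self, one_mul] at this
      omega
  have ht : t < v.length := by omega
  have hr : r < v.length := by omega
  have a0 := symm_lo v s
  have a1 := symm_hi v s
  have b0 := symm_succ_lo ht
  have b1 := symm_succ_hi ht
  have c0 := symm_lo v r
  have c1 := symm_hi v r
  have d0 := symm_succ_lo hr
  have d1 := symm_succ_hi hr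
  have pairs : ∀ {a b c d : ℕ}, ({a, b} : Set ℕ) = {c, d} → (a = c ∧ b = d) ∨ (a = d ∧ b = c) :=
    fun h => Set.pair_eq_pair_iff.1 h
  set f := fun k => (wordProd (v.take k)).symm with hf
  have inj : ∀ k {a b}, a ≠ b → f k a ≠ f k b := fun k a b h => (f k).injective.ne h
  have ft : (f (t + 1) z < f (t + 1) x ↔ f (t + 1) z < f (t + 1) y) := by
    have := inj (t + 1) hxz
    have := inj (t + 1) hyz
    rcases pairs hst with ⟨h, h'⟩ | ⟨h, h'⟩ <;> rw [h] at b0 <;> rw [h'] at b1 <;> 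
      simp only [hf] at * <;> omega
  have fs : (f s z < f s x ↔ f s z < f s y) := by
    have := inj s hxz
    have := inj s hyz
    rcases pairs hss with ⟨h, h'⟩ | ⟨h, h'⟩ <;> rw [h] at a0 <;> rw [h'] at a1 <;>
      simp only [hf] at * <;> omega
  have flip : ∀ {a b t₁ t₂}, t₁ ≤ t₂ → t₂ ≤ v.length → a ≠ b →
      ¬ (f t₁ a < f t₁ b ↔ f t₂ a < f t₂ b) →
      ∃ s, t₁ ≤ s ∧ s < t₂ ∧ refl v s = swap a b := by
    intro a b t₁ t₂ h12 h2 hab h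
    have n1 := inj t₁ hab
    have n2 := inj t₂ hab
    by_cases h' : f t₁ a < f t₁ b
    · obtain ⟨s, q1, q2, q3, q4⟩ := exists_flip h12 h2 h' (by simp only [hf] at *; omega)
      exact ⟨s, q1, q2, by rw [refl, q3, q4]⟩
    · obtain ⟨s, q1, q2, q3, q4⟩ := exists_flip (x := b) (y := a) h12 h2
        (by simp only [hf] at *; omega) (by simp only [hf] at *; omega)
      exact ⟨s, q1, q2, by rw [refl, q3, q4, swap_comm]⟩
  have fy : (f (t + 1) z < f (t + 1) y ↔ f s z < f s y) := by
    by_contra h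
    obtain ⟨r', q1, q2, q3⟩ := flip (by omega) (by omega) hyz.symm h
    exact key ⟨r', q1, q2, by rw [q3, swap_comm]⟩
  have fr1 : (f (t + 1) z < f (t + 1) x ↔ f r z < f r x) := by
    by_contra h
    obtain ⟨r', q1, q2, q3⟩ := flip (by omega) (by omega) hxz.symm h
    exact key2 ⟨r', q1, by omega, by omega, by rw [q3, swap_comm]⟩
  have fr2 : (f (r + 1) z < f (r + 1) x ↔ f s z < f s x) := by
    by_contra h
    obtain ⟨r', q1, q2, q3⟩ := flip (by omega) (by omega) hxz.symm h
    exact key2 ⟨r', by omega, by omega, by omega, by rw [q3, swap_comm]⟩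
  have fr : ¬ (f r z < f r x ↔ f (r + 1) z < f (r + 1) x) := by
    rcases pairs hsr with ⟨h, h'⟩ | ⟨h, h'⟩ <;> rw [h] at c0 d0 <;> rw [h'] at c1 d1 <;>
      simp only [hf] at * <;> omega
  tauto

/-- If `r` lies outside the interval from `t` to `s`, or if its reflection commutes with the one of
`t`, then the reflections of `t` and `s` cancel in the product of three and that of `r` remains.
Otherwise `r` lies between them and shares exactly one value with them. -/
lemma no_third {v : List ℕ} {t s r : ℕ} (hts : t < s) (hs : s < v.length) (hr : r < v.length)
    (hrt : r ≠ t) (hrs : r ≠ s) (h : ({lo v t, hi v t} : Set ℕ) = {lo v s, hi v s})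
    (e1 : inv (wordProd (v.eraseIdx t)) + 1 = v.length)
    (e2 : inv (wordProd (v.eraseIdx r)) + 1 = v.length) : False := by
  have ht : t < v.length := by omega
  rw [wordProd_eraseIdx ht, ← refl] at e1
  rw [wordProd_eraseIdx hr, ← refl] at e2
  have hR : refl v t = refl v s := by
    rcases Set.pair_eq_pair_iff.1 h with ⟨h, h'⟩ | ⟨h, h'⟩
    · rw [refl, refl, h, h']
    · rw [refl, refl, h, h', swap_comm]
  rcases lt_or_gt_of_ne hrt with h1 | h1
  · have := inv_refl_three h1 hts hs
    rw [hR, ← mul_assoc (refl v s), refl_mul_self, one_mul] at this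
    omega
  rcases lt_or_gt_of_ne hrs with h2 | h2
  swap
  · have := inv_refl_three hts h2 hr
    rw [hR, ← mul_assoc (refl v s), refl_mul_self, one_mul] at this
    omega
  have hd : ¬ (refl v t * refl v r * refl v t = refl v r) := by
    intro hd
    have := inv_refl_three h1 h2 hs
    rw [← hR, ← mul_assoc (refl v r), ← mul_assoc, ← mul_assoc, hd] at this
    omega
  have hne := lo_ne_hi v t
  have hne' := lo_ne_hi v r
  by_cases A : lo v r = lo v t
  · by_cases B : hi v r = hi v t
    · apply hd; simp [refl, A, B]
    · exact no_third_between (x := lo v t) (y := hi v t) (z := hi v r) h1 h2 hs rfl hR.symm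
        (by rw [refl, A]) hne (by omega) (by omega) rfl h.symm (by rw [A]) e1 e2
  by_cases A' : lo v r = hi v t
  · by_cases B : hi v r = lo v t
    · apply hd; simp [refl, A', B, swap_comm]
    · exact no_third_between (x := hi v t) (y := lo v t) (z := hi v r) h1 h2 hs
        (by rw [refl, swap_comm]) (by rw [← hR, refl, swap_comm])
        (by rw [refl, A']) (by omega) (by omega) (by omega) (Set.pair_comm _ _)
        (by rw [← h, Set.pair_comm]) (by rw [A']) e1 e2
  by_cases B : hi v r = lo v t
  · exact no_third_between (x := lo v t) (y := hi v t) (z := lo v r) h1 h2 hs rfl hR.symm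
        (by rw [refl, B, swap_comm]) hne (by omega) (by omega) rfl h.symm
        (by rw [B, Set.pair_comm]) e1 e2
  by_cases B' : hi v r = hi v t
  · exact no_third_between (x := hi v t) (y := lo v t) (z := lo v r) h1 h2 hs
        (by rw [refl, swap_comm]) (by rw [← hR, refl, swap_comm])
        (by rw [refl, B', swap_comm]) (by omega) (by omega) (by omega) (Set.pair_comm _ _)
        (by rw [← h, Set.pair_comm]) (by rw [B', Set.pair_comm]) e1 e2
  apply hd
  ext k
  simp only [refl, Perm.mul_apply, swap_apply_def]
  split_ifs <;> omega

lemma isReduced_eraseIdx_inv {v : List ℕ} {t : ℕ} (ht : t < v.length)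
    (h : IsReduced (v.eraseIdx t)) : inv (wordProd (v.eraseIdx t)) + 1 = v.length := by
  rw [(isReduced_iff_inv.1 h).2, List.length_eraseIdx_of_lt ht]
  omega

/-- A nearly reduced word has only two letters whose deletion leaves a reduced word. -/
lemma eq_of_isReduced_eraseIdx {v : List ℕ} {t s s' : ℕ} (hv : ∀ x ∈ v, 1 ≤ x)
    (ht : t < v.length) (hs : s < v.length)
    (hs' : s' < v.length) (hst : s ≠ t) (hst' : s' ≠ t) (hn : ¬ IsReduced v)
    (h : IsReduced (v.eraseIdx t)) (h1 : IsReduced (v.eraseIdx s))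
    (h2 : IsReduced (v.eraseIdx s')) : s = s' := by
  have e := isReduced_eraseIdx_inv ht h
  have e1 := isReduced_eraseIdx_inv hs h1
  have e2 := isReduced_eraseIdx_inv hs' h2
  have hn' : inv (wordProd v) ≠ v.length := fun h => hn (isReduced_iff_inv.2 ⟨hv, h⟩)
  obtain ⟨r, hr, hr1, hr2⟩ := exists_partner ht e hn'
  have hp : ({lo v t, hi v t} : Set ℕ) = {lo v r, hi v r} := by rw [hr1, hr2, Set.pair_comm]
  have hrt : r ≠ t := fun h => lo_ne_hi v t (by rw [← hr1, h])
  have er : inv (wordProd (v.eraseIdx r)) + 1 = v.length := by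
    rw [wordProd_eraseIdx hr, hr1, hr2, swap_comm, ← wordProd_eraseIdx ht, e]
  have key : ∀ {s}, s < v.length → s ≠ t → inv (wordProd (v.eraseIdx s)) + 1 = v.length →
      s = r := by
    intro s hs hst e1
    by_contra hsr
    rcases lt_or_gt_of_ne hrt with h' | h'
    · exact no_third h' ht hs hsr hst hp.symm er e1
    · exact no_third h' hr hs hst hsr hp e e1
  rw [key hs hst e1, key hs' hst' e2]

end BumplessEG

/-! ### Little bumps as sequences of states -/

namespace BumplessEG

open Equiv

@[simp] lemma length_bump (v : List ℕ) (t : ℕ) : (bump v t).length = v.length := by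
  unfold bump; split_ifs <;> simp

lemma bump_eq {v : List ℕ} {t : ℕ} (h : 2 ≤ v.getD t 0) :
    bump v t = v.set t (v.getD t 0 - 1) := by
  rw [bump, if_neg (by omega)]

lemma take_bump {v : List ℕ} {t : ℕ} (h : 2 ≤ v.getD t 0) : (bump v t).take t = v.take t := by
  rw [bump_eq h, List.take_set_of_le le_rfl]

lemma getD_bump {v : List ℕ} {t : ℕ} (h : 2 ≤ v.getD t 0) :
    (bump v t).getD t 0 = v.getD t 0 - 1 := by
  have ht : t < v.length := by
    by_contra h'
    rw [List.getD_eq_default _ _ (by omega)] at h; omega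
  rw [bump_eq h]
  simp [ht]

lemma getD_bump_ne {v : List ℕ} {t s : ℕ} (h : 2 ≤ v.getD t 0) (hs : s ≠ t) :
    (bump v t).getD s 0 = v.getD s 0 := by
  rw [bump_eq h]
  simp [List.getElem?_set_ne hs.symm]

lemma eraseIdx_bump {v : List ℕ} {t : ℕ} (h : 2 ≤ v.getD t 0) :
    (bump v t).eraseIdx t = v.eraseIdx t := by
  rw [bump_eq h, List.eraseIdx_set_eq]

/-- The value on the left of the marked letter persists throughout a Little bump: the bump moves it
to the right, and the letter to be bumped next interchanges the same two values in the opposite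
direction, so has it on its left again. -/
lemma hi_bump {v : List ℕ} {t : ℕ} (h : 2 ≤ v.getD t 0) : hi (bump v t) t = lo v t := by
  rw [hi, lo, take_bump h, getD_bump h, Nat.sub_add_cancel (by omega)]

lemma sum_bump {v : List ℕ} {t : ℕ} (h : 2 ≤ v.getD t 0) : (bump v t).sum < v.sum := by
  have ht : t < v.length := by
    by_contra h'
    rw [List.getD_eq_default _ _ (by omega)] at h; omega
  rw [bump_eq h]
  have h1 : v = v.take t ++ v.getD t 0 :: v.drop (t + 1) := by simp [ht]
  have h2 : v.set t (v.getD t 0 - 1) = v.take t ++ (v.getD t 0 - 1) :: v.drop (t + 1) := by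
    rw [List.set_eq_take_append_cons_drop, if_pos ht]
  rw [h2]
  conv_rhs => rw [h1]
  simp only [List.sum_append, List.sum_cons]
  omega

lemma getD_pos {v : List ℕ} (hv : ∀ x ∈ v, 1 ≤ x) {t : ℕ} (ht : t < v.length) :
    1 ≤ v.getD t 0 := by
  rw [List.getD_eq_getElem _ _ ht]; exact hv _ (List.getElem_mem ht)

lemma mem_bump {v : List ℕ} {t x : ℕ} (h : 2 ≤ v.getD t 0) (hx : x ∈ bump v t) :
    x ∈ v ∨ x = v.getD t 0 - 1 := by
  rw [bump_eq h] at hx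
  exact List.mem_or_eq_of_mem_set hx

/-- A state of a Little bump: deleting the letter of `v` at position `t` leaves a reduced word of
`y`, and the value `y p` stands on the left of this letter. -/
structure State (y : Perm ℕ) (p : ℕ) (v : List ℕ) (t : ℕ) : Prop where
  lt : t < v.length
  pos : ∀ x ∈ v, 1 ≤ x
  prod : wordProd (v.eraseIdx t) = y
  inv_eq : inv y + 1 = v.length
  lo_eq : lo v t = y p

/-- Some earlier entry of `y` is smaller than the entry at position `p`. -/
def HasBelow (y : Perm ℕ) (p : ℕ) : Prop := ∃ i, 1 ≤ i ∧ i < p ∧ y i < y p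

lemma eq_swap_mul_of_eq {y w : Perm ℕ} {a b : ℕ} (h : y = swap a b * w) : w = swap a b * y := by
  rw [h, ← mul_assoc, swap_mul_self, one_mul]

section State

variable {y : Perm ℕ} {p : ℕ} {v : List ℕ} {t : ℕ}

lemma State.isReduced (h : State y p v t) : IsReduced (v.eraseIdx t) := by
  refine isReduced_iff_inv.2 ⟨fun x hx => h.pos x (List.mem_of_mem_eraseIdx hx), ?_⟩
  rw [h.prod, List.length_eraseIdx_of_lt h.lt, ← h.inv_eq]
  omega

lemma State.zero (h : State y p v t) : y 0 = 0 := by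
  rw [← h.prod]
  exact wordProd_zero fun x hx => h.pos x (List.mem_of_mem_eraseIdx hx)

lemma State.finSupp (h : State y p v t) : FinSupp y := h.prod ▸ finSupp_wordProd _

lemma State.wordProd_eq (h : State y p v t) :
    wordProd v = y * swap (y.symm (hi v t)) p := by
  rw [mul_swap_eq_swap_mul, apply_symm_apply, ← h.lo_eq]
  conv_rhs => rw [← h.prod]
  rw [wordProd_eraseIdx h.lt, ← mul_assoc, swap_comm, swap_mul_self, one_mul]

/-- If the marked letter were `1`, lowering it to `0` would give a word for `y * swap 0 p` with only
`inv y + 1` letters. But `y 0 = 0 < y i < y p` with `0 < i < p`, so this permutation has at least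
`inv y + 2` inversions. Consequently the shift in the definition of `bump` never occurs. -/
lemma State.two_le (h : State y p v t) (hb : HasBelow y p) : 2 ≤ v.getD t 0 := by
  have h1 := getD_pos h.pos h.lt
  by_contra h2
  obtain ⟨i, hi1, hip, hi2⟩ := hb
  have hv : v.getD t 0 = 1 := by omega
  have htake : ∀ x ∈ v.take t, 1 ≤ x := fun x hx => h.pos x (List.mem_of_mem_take hx)
  have hg : (v.set t 0).getD t 0 = 0 := by simp [h.lt]
  have hl : lo (v.set t 0) t = 0 := by
    rw [lo, List.take_set_of_le le_rfl, hg, wordProd_zero htake]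
  have hh : hi (v.set t 0) t = y p := by
    rw [hi, List.take_set_of_le le_rfl, hg, ← h.lo_eq, lo, hv]
  have hp := wordProd_eraseIdx (a := v.set t 0) (t := t) (by simp [h.lt])
  rw [List.eraseIdx_set_eq, h.prod, hl, hh] at hp
  have hp' : wordProd (v.set t 0) = y * swap 0 p := by
    rw [mul_swap_eq_swap_mul, h.zero, eq_swap_mul_of_eq hp]
  have hle := inv_wordProd_le (v.set t 0)
  have h0 : y 0 < y i := by
    have := y.injective.ne (show (0 : ℕ) ≠ i by omega)
    have := h.zero
    omega
  have := inv_mul_swap_of_between h.finSupp (by omega) hip h0 hi2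
  rw [hp', List.length_set, ← h.inv_eq] at hle
  omega

lemma State.pos_bump (h : State y p v t) (hb : HasBelow y p) : ∀ x ∈ bump v t, 1 ≤ x := by
  intro x hx
  have h2 := h.two_le hb
  rcases mem_bump h2 hx with hx | rfl
  · exact h.pos x hx
  · omega

lemma mem_coverSet_iff {y : Perm ℕ} (hf : FinSupp y) (h0 : y 0 = 0) {i p : ℕ} :
    i ∈ coverSet y p ↔ 1 ≤ i ∧ i < p ∧ inv (y * swap i p) = inv y + 1 := by
  rw [coverSet, Set.mem_ofPred_eq]
  refine and_congr_right fun h1 => and_congr_right fun h2 => ?_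
  rw [len_eq_inv hf h0, len_eq_inv (hf.mul (finSupp_swap i p))]
  rw [Perm.mul_apply, swap_apply_of_ne_of_ne (by omega) (by omega), h0]

/-- The bump puts `y p` on the right of the marked letter, and in a reduced word the value `y i` on
its left is smaller. A cover `y * swap p i` with `p < i` would need `y p < y i`, hence `i < p`; and
`i ≠ 0` because positive letters never move the value `0`. -/
lemma State.bump_reduced (h : State y p v t) (hb : HasBelow y p) (hr : IsReduced (bump v t)) :
    ∃ i ∈ coverSet y p, wordProd (bump v t) = y * swap i p ∧ lo (bump v t) t = y i ∧
      hi (bump v t) t = y p := by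
  have h2 := h.two_le hb
  have hp := wordProd_eraseIdx (a := bump v t) (t := t) (by simp [h.lt])
  rw [eraseIdx_bump h2, h.prod, hi_bump h2, h.lo_eq] at hp
  obtain ⟨i, hi⟩ := y.surjective (lo (bump v t) t)
  have hlt := (isReduced_iff.1 hr).2 t (by simp [h.lt])
  rw [hi_bump h2, h.lo_eq] at hlt
  have hw : wordProd (bump v t) = y * swap i p := by
    rw [mul_swap_eq_swap_mul, hi, eq_swap_mul_of_eq hp]
  have hinv := (isReduced_iff_inv.1 hr).2
  rw [hw, length_bump, ← h.inv_eq] at hinv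
  have hi0 : i ≠ 0 := by
    rintro rfl
    rw [h.zero, lo, getD_bump h2, take_bump h2] at hi
    have h3 : wordProd (v.take t) 0 = 0 :=
      wordProd_zero fun x hx => h.pos x (List.mem_of_mem_take hx)
    have := (wordProd (v.take t)).injective (h3.trans hi)
    omega
  have hip : i < p := by
    rcases lt_trichotomy i p with h' | rfl | h'
    · exact h'
    · rw [← hi] at hlt; omega
    · rw [swap_comm] at hinv
      have := lt_of_inv_mul_swap_lt h.finSupp h' (by omega)
      omega
  refine ⟨i, (mem_coverSet_iff h.finSupp h.zero).2 ⟨by omega, hip, hinv⟩, hw, hi.symm, ?_⟩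
  rw [hi_bump h2, h.lo_eq]

lemma State.bump_not_reduced (h : State y p v t) (hb : HasBelow y p)
    (hr : ¬ IsReduced (bump v t)) : ∃ s, s ≠ t ∧ State y p (bump v t) s := by
  have h2 := h.two_le hb
  have hlen : t < (bump v t).length := by simp [h.lt]
  have hinv : inv (wordProd ((bump v t).eraseIdx t)) + 1 = (bump v t).length := by
    rw [eraseIdx_bump h2, h.prod, length_bump, h.inv_eq]
  obtain ⟨s, hs, h3, h4⟩ := exists_partner hlen hinv
    (fun h' => hr (isReduced_iff_inv.2 ⟨h.pos_bump hb, h'⟩))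
  refine ⟨s, ?_, hs, h.pos_bump hb, ?_, by rw [length_bump, h.inv_eq], ?_⟩
  · rintro rfl
    exact lo_ne_hi _ _ h3
  · rw [wordProd_eraseIdx hs, h3, h4, swap_comm, ← wordProd_eraseIdx hlen, eraseIdx_bump h2, h.prod]
  · rw [h3, hi_bump h2, h.lo_eq]

/-- The marked position of a state is determined by the word. -/
lemma State.unique {s : ℕ} (h : State y p v t) (h' : State y p v s) : t = s := by
  wlog hts : t ≤ s generalizing t s
  · exact (this h' h (by omega)).symm
  by_contra hne
  have hts : t < s := by omega
  have e := h.wordProd_eq.symm.trans h'.wordProd_eq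
  have hh : hi v t = hi v s := by
    have := congrArg (fun f : Perm ℕ => f p) (mul_left_cancel e)
    simp only [swap_apply_right] at this
    exact y.symm.injective this
  have hl : lo v t = lo v s := h.lo_eq.trans h'.lo_eq.symm
  have b0 := symm_succ_lo h.lt
  have b1 := symm_succ_hi h.lt
  have a0 := symm_lo v s
  have a1 := symm_hi v s
  -- Both letters interchange the same values in the same direction, so a letter `r` between them
  -- interchanges these values back. Deleting `r` also leaves a word of `y`, and `no_third` excludes
  -- three such letters.
  obtain ⟨r, h1, h2, h3, h4⟩ := exists_flip (a := v) (x := hi v t) (y := lo v t)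
    (t₁ := t + 1) (t₂ := s) hts h'.lt.le (by omega) (by rw [hl, hh]; omega)
  have hrl : r < v.length := h2.trans h'.lt
  refine no_third hts h'.lt hrl (by omega) h2.ne (by rw [hl, hh])
    (by rw [h.prod, h.inv_eq]) (r := r) ?_
  rw [wordProd_eraseIdx hrl, h3, h4, swap_comm, ← wordProd_eraseIdx h.lt, h.prod, h.inv_eq]

/-- At `t` the value `y p` now stands on the right, at `s` on the left, so `s ≠ t`. In a reduced
word the partner of `y p` would have to be smaller according to `t` and larger according to `s`.
Thus a bump either stops or goes on, never both. -/
lemma State.not_reduced_of_next {s : ℕ} (h : State y p v t) (hb : HasBelow y p)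
    (h' : State y p (bump v t) s) : s ≠ t ∧ ¬ IsReduced (bump v t) := by
  have h2 := h.two_le hb
  have hlo := h'.lo_eq
  have hst : s ≠ t := by
    rintro rfl
    have h3 : hi (bump v s) s = y p := by rw [hi_bump h2, h.lo_eq]
    exact lo_ne_hi _ _ (hlo.trans h3.symm)
  refine ⟨hst, fun hr => ?_⟩
  obtain ⟨i, -, hw, h4, h5⟩ := h.bump_reduced hb hr
  have e := h'.wordProd_eq.symm.trans hw
  have e' := congrArg (fun f : Perm ℕ => f p) (mul_left_cancel e)
  simp only [swap_apply_right] at e'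
  have h6 := (isReduced_iff.1 hr).2 s (by simpa using h'.lt)
  have h7 := (isReduced_iff.1 hr).2 t (by simpa using h.lt)
  rw [symm_apply_eq] at e'
  omega

lemma State.step {s : ℕ} {b : List ℕ} (h : State y p v t) (hb : HasBelow y p)
    (h' : State y p (bump v t) s) (hl : LittleBump (bump v t) s b) : LittleBump v t b := by
  obtain ⟨h1, h2⟩ := h.not_reduced_of_next hb h'
  exact LittleBump.step h2 (by simpa using h'.lt) h1 h'.isReduced hl

/-- The marked letter is never `1`, so each bump lowers the sum of the letters; this replaces an
induction on derivations of `LittleBump`. -/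
theorem State.induct (hb : HasBelow y p) {C : List ℕ → ℕ → Prop}
    (ih : ∀ v t, State y p v t → (∀ s, State y p (bump v t) s → C (bump v t) s) → C v t)
    (h : State y p v t) : C v t := by
  induction hm : v.sum using Nat.strong_induction_on generalizing v t with
  | _ m ihm =>
    subst hm
    exact ih v t h fun s hs => ihm _ (sum_bump (h.two_le hb)) hs rfl

theorem State.exists_littleBump (h : State y p v t) (hb : HasBelow y p) :
    ∃ b, LittleBump v t b := by
  refine State.induct hb (C := fun v t => ∃ b, LittleBump v t b) ?_ h
  intro v t h ih
  by_cases hr : IsReduced (bump v t)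
  · exact ⟨_, LittleBump.done hr⟩
  · obtain ⟨s, -, hs⟩ := h.bump_not_reduced hb hr
    obtain ⟨b, hb'⟩ := ih s hs
    exact ⟨b, h.step hb hs hb'⟩

lemma State.next_unique {s s' : ℕ} (h : State y p v t) (hb : HasBelow y p)
    (h' : State y p (bump v t) s) (hs : s' < v.length) (hst : s' ≠ t)
    (hr : IsReduced ((bump v t).eraseIdx s')) : s = s' := by
  obtain ⟨h1, h2⟩ := h.not_reduced_of_next hb h'
  refine eq_of_isReduced_eraseIdx (v := bump v t) (t := t) (h.pos_bump hb) (by simpa using h.lt)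
    h'.lt (by simpa using hs) h1 hst h2 ?_ h'.isReduced hr
  rw [eraseIdx_bump (h.two_le hb)]
  exact h.isReduced

/-- What remains to be done after a bump leading to `v`. -/
def After (y : Perm ℕ) (p : ℕ) (v b : List ℕ) : Prop :=
  (IsReduced v ∧ b = v) ∨ ∃ s, State y p v s ∧ LittleBump v s b

lemma State.littleBump_iff (h : State y p v t) (hb : HasBelow y p) {b : List ℕ} :
    LittleBump v t b ↔ After y p (bump v t) b := by
  constructor
  · intro hl
    cases hl with
    | done hr => exact Or.inl ⟨hr, rfl⟩
    | step hn hs hst hr hl =>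
      rename_i s
      obtain ⟨s', -, hs'⟩ := h.bump_not_reduced hb hn
      obtain rfl := h.next_unique hb hs' hs hst hr
      exact Or.inr ⟨_, hs', hl⟩
  · rintro (⟨hr, rfl⟩ | ⟨s, hs, hl⟩)
    · exact LittleBump.done hr
    · exact h.step hb hs hl

theorem State.littleBump_unique (h : State y p v t) (hb : HasBelow y p) :
    ∀ b b', LittleBump v t b → LittleBump v t b' → b = b' := by
  refine State.induct hb (C := fun v t => ∀ b b', LittleBump v t b → LittleBump v t b' → b = b') ?_ h
  intro v t h ih b b' h1 h2
  rw [h.littleBump_iff hb] at h1 h2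
  rcases h1 with ⟨hr, rfl⟩ | ⟨s, hs, hl⟩ <;> rcases h2 with ⟨hr', rfl⟩ | ⟨s', hs', hl'⟩
  · rfl
  · exact absurd hr (h.not_reduced_of_next hb hs').2
  · exact absurd hr' (h.not_reduced_of_next hb hs).2
  · obtain rfl := hs.unique hs'
    exact ih s hs b b' hl hl'

theorem State.littleBump_spec (h : State y p v t) (hb : HasBelow y p) :
    ∀ b, LittleBump v t b → (∃ i ∈ coverSet y p, IsReducedWord (y * swap i p) b) ∧
      ∀ n, (∀ x ∈ v, x < n) → ∀ x ∈ b, x < n := by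
  refine State.induct hb (C := fun v t => ∀ b, LittleBump v t b →
    (∃ i ∈ coverSet y p, IsReducedWord (y * swap i p) b) ∧
      ∀ n, (∀ x ∈ v, x < n) → ∀ x ∈ b, x < n) ?_ h
  intro v t h ih b h1
  have hlt : ∀ n, (∀ x ∈ v, x < n) → ∀ x ∈ bump v t, x < n := by
    intro n hn x hx
    rcases mem_bump (h.two_le hb) hx with hx | rfl
    · exact hn x hx
    · have := hn (v.getD t 0) (by rw [List.getD_eq_getElem _ _ h.lt]; exact List.getElem_mem h.lt)
      omega
  rw [h.littleBump_iff hb] at h1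
  rcases h1 with ⟨hr, rfl⟩ | ⟨s, hs, hl⟩
  · obtain ⟨i, hi, hw, -⟩ := h.bump_reduced hb hr
    exact ⟨⟨i, hi, hr, hw⟩, hlt⟩
  · obtain ⟨h2, h3⟩ := ih s hs b hl
    exact ⟨h2, fun n hn => h3 n (hlt n hn)⟩

end State

/-! ### The Little map -/

/-- The values `u q < u p` begin in increasing order and end reversed, so some letter interchanges
them. Its left value is `u q`, which is the entry of `u * swap p q` at `p`. -/
lemma exists_state_of_isReducedWord {u : Perm ℕ} {p q : ℕ} {a : List ℕ} (ha : IsReducedWord u a)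
    (hpq : p < q) (hc : inv u = inv (u * swap p q) + 1) :
    ∃ t, State (u * swap p q) p a t ∧ Interchanges a t (u p) (u q) := by
  obtain ⟨hr, rfl⟩ := ha
  have hlt : wordProd a q < wordProd a p := by
    have := lt_of_inv_mul_swap_lt (w := wordProd a * swap p q)
      ((finSupp_wordProd a).mul (finSupp_swap _ _)) hpq
      (by rw [mul_assoc, swap_mul_self, mul_one]; omega)
    simpa using this
  obtain ⟨t, -, ht, h1, h2⟩ := exists_flip (a := a) (x := wordProd a q) (y := wordProd a p)
    (Nat.zero_le a.length) le_rfl (by rw [List.take_zero, wordProd_nil]; exact hlt)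
    (by rw [List.take_length, symm_apply_apply, symm_apply_apply]; exact hpq)
  refine ⟨t, ⟨ht, (isReduced_iff.1 hr).1, ?_, ?_, by simpa using h1⟩, ht, ?_⟩
  · rw [wordProd_eraseIdx ht, h1, h2, mul_swap_eq_swap_mul, swap_comm]
  · rw [← hc, (isReduced_iff_inv.1 hr).2]
  · change ({lo a t, hi a t} : Set ℕ) = _
    rw [h1, h2, Set.pair_comm]

lemma LittleMap.state {u : Perm ℕ} {p q : ℕ} {a b : List ℕ} (ha : IsReducedWord u a)
    (h : LittleMap p (u q) a b) :
    p < q ∧ inv u = inv (u * swap p q) + 1 ∧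
      ∃ t, State (u * swap p q) p a t ∧ LittleBump a t b := by
  obtain ⟨hr, rfl⟩ := ha
  obtain ⟨-, j, t, hpj, hj, hlen, ⟨ht, hI⟩, hl⟩ := h
  obtain rfl := (wordProd a).injective hj
  have h0 := wordProd_zero (isReduced_iff.1 hr).1
  have hf := finSupp_wordProd a
  have hc : inv (wordProd a) = inv (wordProd a * swap p j) + 1 := by
    rw [len_eq_inv hf h0] at hlen
    -- `len` agrees with the number of inversions only for permutations fixing `0`, so `p = 0` is
    -- treated apart: no positive letter ever interchanges the value `0` with another.
    rcases Nat.eq_zero_or_pos p with rfl | hp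
    · exfalso
      have h1 := (isReduced_iff.1 hr).2 t ht
      have htake : ∀ x ∈ a.take t, 1 ≤ x := fun x hx =>
        (isReduced_iff.1 hr).1 x (List.mem_of_mem_take hx)
      have h2 := wordProd_zero htake
      rw [h0] at hI
      have h3 := getD_pos (isReduced_iff.1 hr).1 ht
      rcases Set.pair_eq_pair_iff.1 hI with ⟨h4, -⟩ | ⟨-, h4⟩
      · have := (wordProd (a.take t)).injective (h4.trans h2.symm); omega
      · have := (wordProd (a.take t)).injective (h4.trans h2.symm); omega
    · rwa [len_eq_inv (hf.mul (finSupp_swap _ _))] at hlen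
      rw [Perm.mul_apply, swap_apply_of_ne_of_ne (by omega) (by omega), h0]
  obtain ⟨s, hs, -, hI'⟩ := exists_state_of_isReducedWord ⟨hr, rfl⟩ hpj hc
  refine ⟨hpj, hc, t, ?_, hl⟩
  have hlo : lo a t = lo a s ∧ hi a t = hi a s := by
    have h1 := (isReduced_iff.1 hr).2 t ht
    have h2 := (isReduced_iff.1 hr).2 s hs.lt
    have h3 : ({lo a t, hi a t} : Set ℕ) = {lo a s, hi a s} := hI.trans hI'.symm
    rcases Set.pair_eq_pair_iff.1 h3 with h4 | h4
    · exact h4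
    · omega
  refine ⟨ht, hs.pos, ?_, hs.inv_eq, by rw [hlo.1, hs.lo_eq]⟩
  rw [wordProd_eraseIdx ht, hlo.1, hlo.2, ← wordProd_eraseIdx hs.lt, hs.prod]

lemma LittleMap.of_littleBump {u : Perm ℕ} {p q t : ℕ} {a b : List ℕ} (ha : IsReducedWord u a)
    (hpq : p < q) (hc : inv u = inv (u * swap p q) + 1)
    (hs : State (u * swap p q) p a t) (h : LittleBump a t b) : LittleMap p (u q) a b := by
  obtain ⟨s, hs', hI⟩ := exists_state_of_isReducedWord ha hpq hc
  obtain rfl := hs.unique hs'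
  obtain ⟨hr, rfl⟩ := ha
  refine ⟨hr, q, t, hpq, rfl, ?_, hI, h⟩
  have h0 := wordProd_zero (isReduced_iff.1 hr).1
  have hf := finSupp_wordProd a
  rw [len_eq_inv hf h0, len_eq_inv (hf.mul (finSupp_swap _ _)) hs.zero, hc]

theorem exists_littleMap {u : Perm ℕ} {p q : ℕ} {a : List ℕ} (ha : IsReducedWord u a)
    (hpq : p < q) (hc : inv u = inv (u * swap p q) + 1)
    (hb : HasBelow (u * swap p q) p) :
    ∃ b i, LittleMap p (u q) a b ∧ i ∈ coverSet (u * swap p q) p ∧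
      IsReducedWord (u * swap p q * swap i p) b := by
  obtain ⟨t, hs, -⟩ := exists_state_of_isReducedWord ha hpq hc
  obtain ⟨b, hl⟩ := hs.exists_littleBump hb
  obtain ⟨⟨i, hi, hw⟩, -⟩ := hs.littleBump_spec hb b hl
  exact ⟨b, i, LittleMap.of_littleBump ha hpq hc hs hl, hi, hw⟩

theorem LittleMap.unique {u : Perm ℕ} {p q : ℕ} {a b b' : List ℕ} (ha : IsReducedWord u a)
    (hb : HasBelow (u * swap p q) p) (h : LittleMap p (u q) a b) (h' : LittleMap p (u q) a b') :
    b = b' := by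
  obtain ⟨-, -, t, hs, hl⟩ := h.state ha
  obtain ⟨-, -, t', hs', hl'⟩ := h'.state ha
  obtain rfl := hs.unique hs'
  exact hs.littleBump_unique hb _ _ hl hl'

end BumplessEG

namespace BumplessEG

open Equiv

/-! ### Complements -/

/-- The permutation reversing `1, …, n`. -/
def rev (n : ℕ) : Perm ℕ :=
  Function.Involutive.toPerm (fun i => if 1 ≤ i ∧ i ≤ n then n + 1 - i else i) (by
    intro i; dsimp only; split_ifs <;> omega)

lemma rev_apply (n i : ℕ) : rev n i = if 1 ≤ i ∧ i ≤ n then n + 1 - i else i := rfl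

lemma rev_of_mem {n i : ℕ} (h1 : 1 ≤ i) (h2 : i ≤ n) : rev n i = n + 1 - i := by
  rw [rev_apply, if_pos ⟨h1, h2⟩]

lemma rev_mul_rev (n : ℕ) : rev n * rev n = 1 := by
  ext i; simp only [Perm.mul_apply, Perm.one_apply, rev_apply]; split_ifs <;> omega

@[simp] lemma rev_rev (n i : ℕ) : rev n (rev n i) = i := by
  simp only [rev_apply]; split_ifs <;> omega

lemma inSym_rev (n : ℕ) : InSym n (rev n) := by
  intro i hi
  rw [rev_apply, if_neg (by simpa using hi)]

lemma InSym.mul {n : ℕ} {u v : Perm ℕ} (hu : InSym n u) (hv : InSym n v) : InSym n (u * v) :=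
  fun i hi => by rw [Perm.mul_apply, hv i hi, hu i hi]

lemma inSym_swap {n i j : ℕ} (hi : 1 ≤ i) (hi' : i ≤ n) (hj : 1 ≤ j) (hj' : j ≤ n) :
    InSym n (swap i j) := by
  intro k hk
  simp only [Set.mem_Icc] at hk
  exact swap_apply_of_ne_of_ne (by omega) (by omega)

lemma InSym.mem {n : ℕ} {u : Perm ℕ} (hu : InSym n u) {i : ℕ} (h1 : 1 ≤ i) (h2 : i ≤ n) :
    1 ≤ u i ∧ u i ≤ n := by
  by_contra h
  have := u.injective (hu (u i) h)
  omega

lemma InSym.symm {n : ℕ} {u : Perm ℕ} (hu : InSym n u) : InSym n u.symm := by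
  intro i hi
  rw [symm_apply_eq, hu i hi]

lemma inSym_wordProd {n : ℕ} {a : List ℕ} (ha : ∀ x ∈ a, 1 ≤ x) (ha' : ∀ x ∈ a, x < n) :
    InSym n (wordProd a) := by
  induction a with
  | nil => intro i _; rfl
  | cons k a ih =>
    have h1 := ha k (by simp)
    have h2 := ha' k (by simp)
    exact (inSym_swap h1 (by omega) (by omega) (by omega)).mul
      (ih (fun x hx => ha x (by simp [hx])) (fun x hx => ha' x (by simp [hx])))

/-- Conjugation by the reversing permutation. -/
def conj (n : ℕ) (w : Perm ℕ) : Perm ℕ := rev n * w * rev n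

lemma conj_apply (n : ℕ) (w : Perm ℕ) (i : ℕ) : conj n w i = rev n (w (rev n i)) := rfl

lemma conj_conj (n : ℕ) (w : Perm ℕ) : conj n (conj n w) = w := by
  ext i; simp [conj_apply]

lemma conj_mul (n : ℕ) (u v : Perm ℕ) : conj n (u * v) = conj n u * conj n v := by
  ext i; simp [conj_apply]

lemma conj_swap (n i j : ℕ) : conj n (swap i j) = swap (rev n i) (rev n j) := by
  rw [conj, mul_swap_eq_swap_mul, mul_assoc, rev_mul_rev, mul_one]

lemma InSym.conj {n : ℕ} {u : Perm ℕ} (hu : InSym n u) : InSym n (conj n u) :=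
  ((inSym_rev n).mul hu).mul (inSym_rev n)

lemma wordProd_compl {n : ℕ} {a : List ℕ} (ha : ∀ x ∈ a, 1 ≤ x) (ha' : ∀ x ∈ a, x < n) :
    wordProd (compl n a) = conj n (wordProd a) := by
  induction a with
  | nil => ext i; simp [compl, conj_apply]
  | cons k a ih =>
    have h1 := ha k (by simp)
    have h2 := ha' k (by simp)
    have h3 := ih (fun x hx => ha x (by simp [hx])) (fun x hx => ha' x (by simp [hx]))
    have h4 : compl n (k :: a) = (n - k) :: compl n a := rfl
    rw [h4, wordProd_cons, wordProd_cons, h3, conj_mul, conj_swap, rev_of_mem h1 (by omega),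
      rev_of_mem (by omega) (by omega), swap_comm]
    congr 2
    · omega
    · omega

lemma length_compl (n : ℕ) (a : List ℕ) : (compl n a).length = a.length := by simp [compl]

lemma compl_compl {n : ℕ} {a : List ℕ} (ha : ∀ x ∈ a, x < n) : compl n (compl n a) = a := by
  unfold compl
  rw [List.map_map]
  conv_rhs => rw [← List.map_id a]
  exact List.map_congr_left fun x hx => by
    have := ha x hx
    simp; omega

lemma mem_compl {n : ℕ} {a : List ℕ} (ha : ∀ x ∈ a, 1 ≤ x) (ha' : ∀ x ∈ a, x < n) :
    (∀ x ∈ compl n a, 1 ≤ x) ∧ ∀ x ∈ compl n a, x < n := by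
  constructor <;> intro x hx <;> obtain ⟨z, hz, rfl⟩ := List.mem_map.1 hx <;>
    have := ha z hz <;> have := ha' z hz <;> omega

lemma getD_compl {n : ℕ} {a : List ℕ} {t : ℕ} (ht : t < a.length) :
    (compl n a).getD t 0 = n - a.getD t 0 := by
  simp [compl, ht]

lemma compl_take (n : ℕ) (a : List ℕ) (t : ℕ) : (compl n a).take t = compl n (a.take t) := by
  simp [compl, List.map_take]

lemma compl_eraseIdx (n : ℕ) (a : List ℕ) (t : ℕ) :
    compl n (a.eraseIdx t) = (compl n a).eraseIdx t := by
  rw [compl, compl, List.eraseIdx_map]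

section compl

variable {n : ℕ} {a : List ℕ} {t : ℕ}

/-- Complementation reverses values and also positions, so left and right are exchanged. -/
lemma lo_compl (ha : ∀ x ∈ a, 1 ≤ x) (ha' : ∀ x ∈ a, x < n) (ht : t < a.length) :
    lo (compl n a) t = rev n (hi a t) := by
  have h1 : a.getD t 0 ∈ a := by rw [List.getD_eq_getElem _ _ ht]; exact List.getElem_mem ht
  have h2 := ha _ h1
  have h3 := ha' _ h1
  rw [lo, hi, getD_compl ht, compl_take, wordProd_compl
    (fun x hx => ha x (List.mem_of_mem_take hx)) (fun x hx => ha' x (List.mem_of_mem_take hx)),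
    conj_apply, rev_of_mem (i := n - a.getD t 0) (by omega) (by omega)]
  congr 2; omega

lemma hi_compl (ha : ∀ x ∈ a, 1 ≤ x) (ha' : ∀ x ∈ a, x < n) (ht : t < a.length) :
    hi (compl n a) t = rev n (lo a t) := by
  have h1 : a.getD t 0 ∈ a := by rw [List.getD_eq_getElem _ _ ht]; exact List.getElem_mem ht
  have h2 := ha _ h1
  have h3 := ha' _ h1
  rw [lo, hi, getD_compl ht, compl_take, wordProd_compl
    (fun x hx => ha x (List.mem_of_mem_take hx)) (fun x hx => ha' x (List.mem_of_mem_take hx)),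
    conj_apply, rev_of_mem (i := n - a.getD t 0 + 1) (by omega) (by omega)]
  congr 2; omega

lemma isReduced_compl (ha : IsReduced a) (ha' : ∀ x ∈ a, x < n) : IsReduced (compl n a) := by
  rw [isReduced_iff] at ha ⊢
  obtain ⟨h1, h2⟩ := ha
  refine ⟨(mem_compl h1 ha').1, fun t ht => ?_⟩
  rw [length_compl] at ht
  rw [lo_compl h1 ha' ht, hi_compl h1 ha' ht]
  have h4 : a.getD t 0 ∈ a := by rw [List.getD_eq_getElem _ _ ht]; exact List.getElem_mem ht
  have h5 := h1 _ h4
  have h6 := ha' _ h4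
  have h7 := inSym_wordProd (a := a.take t) (n := n)
    (fun x hx => h1 x (List.mem_of_mem_take hx)) (fun x hx => ha' x (List.mem_of_mem_take hx))
  have h8 : 1 ≤ lo a t ∧ lo a t ≤ n := h7.mem h5 (by omega)
  have h9 : 1 ≤ hi a t ∧ hi a t ≤ n := h7.mem (by omega) (by omega)
  rw [rev_of_mem h8.1 h8.2, rev_of_mem h9.1 h9.2]
  have := h2 t ht
  omega

lemma isReduced_compl_iff (ha : ∀ x ∈ a, 1 ≤ x) (ha' : ∀ x ∈ a, x < n) :
    IsReduced (compl n a) ↔ IsReduced a := by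
  refine ⟨fun h => ?_, fun h => isReduced_compl h ha'⟩
  have := isReduced_compl h (mem_compl ha ha').2
  rwa [compl_compl ha'] at this

/-- Undoing the interchange later would require a letter with the larger value on its left, which a
reduced word does not contain. -/
lemma IsReduced.lt_of_hi (ha : IsReduced a) (ht : t < a.length) :
    (wordProd a).symm (hi a t) < (wordProd a).symm (lo a t) := by
  have hr := (isReduced_iff.1 ha).2
  by_contra h
  have hne := (wordProd a).symm.injective.ne (lo_ne_hi a t)
  obtain ⟨s, h1, h2, h3, h4⟩ := exists_flip (a := a) (x := hi a t) (y := lo a t)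
    (t₁ := t + 1) (t₂ := a.length) ht le_rfl
    (by rw [symm_succ_lo ht, symm_succ_hi ht]; omega) (by rw [List.take_length]; omega)
  have := hr t ht
  have := hr s h2
  omega

/-- At the first letter `x ≥ n` the prefix still fixes `x + 1`. This value is interchanged with a
smaller one, which then stays to its right for good, at a position beyond `n` that the permutation
does not fix. -/
lemma letters_lt {u : Perm ℕ} (ha : IsReducedWord u a) (hu : InSym n u) : ∀ x ∈ a, x < n := by
  obtain ⟨hr, rfl⟩ := ha
  have h1 := (isReduced_iff.1 hr).1
  have key : ∀ t ≤ a.length, ∀ x ∈ a.take t, x < n := by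
    intro t
    induction t with
    | zero => simp
    | succ t ih =>
      intro ht x hx
      have ih := ih (by omega)
      have h7 := inSym_wordProd (a := a.take t) (n := n)
        (fun x hx => h1 x (List.mem_of_mem_take hx)) ih
      rw [List.take_add_one] at hx
      rcases List.mem_append.1 hx with hx | hx
      · exact ih x hx
      have hx : x = a.getD t 0 := by
        simp [show t < a.length from ht] at hx
        simp [hx, show t < a.length from ht]
      by_contra hn
      have h8 : hi a t = x + 1 := by
        rw [hi, ← hx, h7 _ (by simp; omega)]
      have h9 := hr.lt_of_hi (t := t) (by omega)
      have h10 := (isReduced_iff.1 hr).2 t (by omega)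
      rw [h8, hu.symm (x + 1) (by simp; omega)] at h9
      have h11 := hu ((wordProd a).symm (lo a t)) (by simp; omega)
      rw [apply_symm_apply] at h11
      omega
  intro x hx
  exact key a.length le_rfl x (by rwa [List.take_length])

end compl

lemma inv_conj {n : ℕ} {w : Perm ℕ} (hw : InSym n w) : inv (conj n w) = inv w := by
  obtain ⟨a, h1, h2, h3⟩ := exists_word hw.finSupp hw.zero
  have hr : IsReduced a := isReduced_iff_inv.2 ⟨h1, by rw [h2, h3]⟩
  have hl := letters_lt (n := n) ⟨hr, h2⟩ hw
  have := (isReduced_iff_inv.1 (isReduced_compl hr hl)).2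
  rwa [wordProd_compl h1 hl, h2, length_compl, h3] at this

lemma IsReducedWord.compl {n : ℕ} {w : Perm ℕ} {a : List ℕ} (ha : IsReducedWord w a)
    (hw : InSym n w) : IsReducedWord (conj n w) (compl n a) := by
  have hl := letters_lt ha hw
  refine ⟨isReduced_compl ha.1 hl, ?_⟩
  rw [wordProd_compl (isReduced_iff.1 ha.1).1 hl, ha.2]

/-! ### Inverting the Little map -/

/-- Bumping the complement raises the original letter. The bound `n` keeps the complemented letter
at least `2`, so that no shift takes place. -/
lemma compl_bump {n : ℕ} {v : List ℕ} {t : ℕ} (ht : t < v.length) (h2 : 2 ≤ v.getD t 0)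
    (hn : v.getD t 0 < n) : bump (compl n (bump v t)) t = compl n v := by
  have hlen : t < (bump v t).length := by simp [ht]
  rw [bump_eq (by rw [getD_compl hlen, getD_bump h2]; omega), getD_compl hlen, getD_bump h2,
    bump_eq h2, compl, compl, List.map_set, List.set_set]
  have h3 : n - (v.getD t 0 - 1) - 1 = (v.map (n - ·))[t]'(by simpa using ht) := by
    simp [ht]; 
    rw [List.getD_eq_getElem _ _ ht] at *
    omega
  rw [h3, List.set_getElem_self]

/-- The backward bump visits the complements of the same words in the opposite order, because in
every nonreduced word on the way the two deletable letters are the one by which it was entered and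
the one by which it is left. The statement is in continuation form: the disjunction says what the
backward bump still has to do on arriving at `compl n v`, and the induction over the forward bump
extends it at the front. -/
theorem State.retrace {n : ℕ} {y : Perm ℕ} {p : ℕ} {v : List ℕ} {t : ℕ} (h : State y p v t)
    (hb : HasBelow y p) (hn : ∀ x ∈ v, x < n) : ∀ b, LittleBump v t b →
    ∃ t' i, t' < b.length ∧ i ∈ coverSet y p ∧ wordProd b = y * swap i p ∧ lo b t' = y i ∧
      hi b t' = y p ∧ ∀ z, (IsReduced v ∧ z = compl n v) ∨ (¬ IsReduced v ∧ ∃ r < v.length,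
        r ≠ t ∧ IsReduced (v.eraseIdx r) ∧ LittleBump (compl n v) r z) →
      LittleBump (compl n b) t' z := by
  revert hn
  refine State.induct hb (C := fun v t => (∀ x ∈ v, x < n) → ∀ b, LittleBump v t b →
    ∃ t' i, t' < b.length ∧ i ∈ coverSet y p ∧ wordProd b = y * swap i p ∧ lo b t' = y i ∧
      hi b t' = y p ∧ ∀ z, (IsReduced v ∧ z = compl n v) ∨ (¬ IsReduced v ∧ ∃ r < v.length,
        r ≠ t ∧ IsReduced (v.eraseIdx r) ∧ LittleBump (compl n v) r z) →
      LittleBump (compl n b) t' z) ?_ h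
  intro v t h ih hn b hl
  have h2 := h.two_le hb
  have hvt : v.getD t 0 < n :=
    hn _ (by rw [List.getD_eq_getElem _ _ h.lt]; exact List.getElem_mem h.lt)
  have hn' : ∀ x ∈ bump v t, x < n := by
    intro x hx
    rcases mem_bump h2 hx with hx | rfl
    · exact hn x hx
    · omega
  have hcb := compl_bump h.lt h2 hvt
  have back : ∀ z, (IsReduced v ∧ z = compl n v) ∨ (¬ IsReduced v ∧ ∃ r < v.length,
        r ≠ t ∧ IsReduced (v.eraseIdx r) ∧ LittleBump (compl n v) r z) →
      LittleBump (compl n (bump v t)) t z := by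
    rintro z (⟨hr, rfl⟩ | ⟨hr, r, hrl, hrt, hre, hlr⟩)
    · rw [← hcb]
      exact LittleBump.done (by rw [hcb]; exact isReduced_compl hr hn)
    · refine LittleBump.step (s := r) ?_ (by simpa [length_compl] using hrl) hrt ?_ ?_
      · rwa [hcb, isReduced_compl_iff h.pos hn]
      · rw [hcb, ← compl_eraseIdx]
        exact isReduced_compl hre fun x hx => hn x (List.mem_of_mem_eraseIdx hx)
      · rwa [hcb]
  rw [h.littleBump_iff hb] at hl
  rcases hl with ⟨hr, rfl⟩ | ⟨s, hs, hl⟩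
  · obtain ⟨i, hi, hw, h3, h4⟩ := h.bump_reduced hb hr
    exact ⟨t, i, by simpa using h.lt, hi, hw, h3, h4, back⟩
  · obtain ⟨t', i, h3, hi, hw, h4, h5, h6⟩ := ih s hs hn' b hl
    obtain ⟨hst, hnr⟩ := h.not_reduced_of_next hb hs
    refine ⟨t', i, h3, hi, hw, h4, h5, fun z hz => h6 z (Or.inr ⟨hnr, t, by simpa using h.lt,
      hst.symm, ?_, back z hz⟩)⟩
    rw [eraseIdx_bump h2]
    exact h.isReduced

theorem LittleMap.inv {n : ℕ} {u : Perm ℕ} {p q : ℕ} {a b : List ℕ} (ha : IsReducedWord u a)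
    (hu : InSym n u) (hp : 1 ≤ p) (hq : q ≤ n) (hb : HasBelow (u * swap p q) p)
    (h : LittleMap p (u q) a b) : LittleMapInv n p (u q) b a := by
  obtain ⟨hpq, hc, t, hs, hl⟩ := h.state ha
  have hal := letters_lt ha hu
  set y := u * swap p q with hy
  have hyS : InSym n y := hu.mul (inSym_swap hp (by omega) (by omega) hq)
  have huq : y p = u q := by simp [hy]
  obtain ⟨⟨i₀, hm₀, hbr, hbw⟩, hbl⟩ := hs.littleBump_spec hb b hl
  have hbl := hbl n hal
  obtain ⟨t', i, ht', hic, hw, h4, h5, h6⟩ := hs.retrace hb hal b hl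
  have hbp := (isReduced_iff.1 hbr).1
  obtain ⟨hi1, hip, hinv⟩ := (mem_coverSet_iff hs.finSupp hs.zero).1 hic
  have hyp := hyS.mem hp (by omega)
  have hyi := hyS.mem hi1 (by omega)
  have e1 : n + 1 - p = rev n p := (rev_of_mem hp (by omega)).symm
  have e2 : n + 1 - u q = rev n (y p) := by rw [rev_of_mem hyp.1 hyp.2, huq]
  have e3 : n + 1 - i = rev n i := (rev_of_mem hi1 (by omega)).symm
  have hcw : wordProd (BumplessEG.compl n b) = conj n (y * swap i p) := by
    rw [wordProd_compl hbp hbl, hw]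
  -- The backward bump starts at the letter `t'` where the forward one ended. The reflected index `n
  -- + 1 - i` plays for it the role that `q` plays for the forward bump.
  refine ⟨hbl, hal, isReduced_compl hbr hbl, n + 1 - i, t', by omega, ?_, ?_, ?_, ?_⟩
  · rw [e2, e3, hcw, conj_apply, rev_rev]; simp
  · have e4 : wordProd (BumplessEG.compl n b) * swap (n + 1 - p) (n + 1 - i) =
        wordProd (BumplessEG.compl n (a.eraseIdx t)) := by
      have hel : ∀ x ∈ a.eraseIdx t, x < n := fun x hx => hal x (List.mem_of_mem_eraseIdx hx)
      rw [wordProd_compl (isReduced_iff.1 hs.isReduced).1 hel, hs.prod, hcw, e1, e3, ← conj_swap,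
        ← conj_mul, mul_assoc, swap_comm i p, swap_mul_self, mul_one]
    have e5 := (isReduced_compl hs.isReduced
      (fun x hx => hal x (List.mem_of_mem_eraseIdx hx)) : IsReduced (BumplessEG.compl n _)).2
    rw [e4, ← e5, ← (isReduced_compl hbr hbl).2, length_compl, length_compl,
      List.length_eraseIdx_of_lt hs.lt, ← hs.inv_eq, ← (isReduced_iff_inv.1 hbr).2, hw, hinv]
    omega
  · refine ⟨by rwa [length_compl], ?_⟩
    change ({lo _ t', hi _ t'} : Set ℕ) = _
    rw [lo_compl hbp hbl ht', hi_compl hbp hbl ht', h4, h5, hcw, e1, e2, conj_apply, rev_rev,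
      Set.pair_comm]
    simp
  · exact h6 _ (Or.inl ⟨ha.1, rfl⟩)

/-- The data of a transition: `y` is covered by `u = y * swap p q`, `p < q`, and by
`u' = y * swap i p`, `i < p`. -/
structure IsStep (n : ℕ) (y : Perm ℕ) (i p q : ℕ) : Prop where
  inSym : InSym n y
  one_le : 1 ≤ i
  lt : i < p
  lt' : p < q
  le : q ≤ n
  cover : inv (y * swap i p) = inv y + 1
  cover' : inv (y * swap p q) = inv y + 1

lemma IsStep.below {n : ℕ} {y : Perm ℕ} {i p q : ℕ} (h : IsStep n y i p q) : HasBelow y p :=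
  ⟨i, h.one_le, h.lt, lt_of_inv_mul_swap_lt h.inSym.finSupp h.lt (by rw [h.cover]; omega)⟩

lemma IsStep.inSym_left {n : ℕ} {y : Perm ℕ} {i p q : ℕ} (h : IsStep n y i p q) :
    InSym n (y * swap i p) := by
  obtain ⟨h0, h1, h2, h3, h4, -, -⟩ := h
  exact h0.mul (inSym_swap (by omega) (by omega) (by omega) (by omega))

/-- Reversal exchanges the two covers of `y`, so every statement about Little maps from `y * swap p
q` yields one from `y * swap i p`. -/
lemma IsStep.conj {n : ℕ} {y : Perm ℕ} {i p q : ℕ} (h : IsStep n y i p q) :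
    IsStep n (conj n y) (rev n q) (rev n p) (rev n i) := by
  obtain ⟨h0, h1, h2, h3, h4, h5, h6⟩ := h
  have e1 := rev_of_mem (n := n) (i := i) h1 (by omega)
  have e2 := rev_of_mem (n := n) (i := p) (by omega) (by omega)
  have e3 := rev_of_mem (n := n) (i := q) (by omega) (by omega)
  refine ⟨h0.conj, by omega, by omega, by omega, by omega, ?_, ?_⟩
  · rw [← conj_swap, ← conj_mul, inv_conj, inv_conj h0, swap_comm, h6]
    exact h0.mul (inSym_swap (by omega) (by omega) (by omega) (by omega))
  · rw [← conj_swap, ← conj_mul, inv_conj, inv_conj h0, swap_comm, h5]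
    exact h0.mul (inSym_swap (by omega) (by omega) (by omega) (by omega))

lemma IsStep.littleMapInv_iff {n : ℕ} {y : Perm ℕ} {i p q : ℕ} (h : IsStep n y i p q)
    {a b : List ℕ} : LittleMapInv n p (y p) b a ↔ (∀ x ∈ b, x < n) ∧ (∀ x ∈ a, x < n) ∧
      LittleMap (rev n p) ((BumplessEG.conj n (y * swap i p)) (rev n i)) (BumplessEG.compl n b)
        (BumplessEG.compl n a) := by
  obtain ⟨h0, h1, h2, h3, h4, h5, h6⟩ := h
  have h7 := h0.mem (i := p) (by omega) (by omega)
  rw [LittleMapInv, conj_apply, rev_rev, Perm.mul_apply, swap_apply_left, rev_of_mem h7.1 h7.2,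
    rev_of_mem (by omega) (by omega)]

theorem IsStep.littleMapInv_unique {n : ℕ} {y : Perm ℕ} {i p q : ℕ} (h : IsStep n y i p q)
    {a a' b : List ℕ} (hb : IsReducedWord (y * swap i p) b) (h1 : LittleMapInv n p (y p) b a)
    (h2 : LittleMapInv n p (y p) b a') : a = a' := by
  rw [h.littleMapInv_iff] at h1 h2
  have hbc := hb.compl (n := n) h.inSym_left
  have e : BumplessEG.conj n (y * swap i p) * swap (rev n p) (rev n i) = BumplessEG.conj n y := by
    rw [← conj_swap, ← conj_mul, mul_assoc, swap_comm i p, swap_mul_self, mul_one]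
  have := h1.2.2.unique hbc (by rw [e]; exact h.conj.below) h2.2.2
  rw [← compl_compl h1.2.1, this, compl_compl h2.2.1]

/-- Bumping backwards from `b` ends at a reduced word of some cover `y * swap p q'` with `p < q' ≤
n`; by `hq` this must be `y * swap p q`. Retracing this backward bump is a forward bump ending at
`b`. -/
theorem IsStep.exists_littleMap_to {n : ℕ} {y : Perm ℕ} {i p q : ℕ} (h : IsStep n y i p q)
    (hq : ∀ q', p < q' → q' ≤ n → inv (y * swap p q') = inv y + 1 → q' = q) {b : List ℕ}
    (hb : IsReducedWord (y * swap i p) b) :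
    ∃ a, IsReducedWord (y * swap p q) a ∧ LittleMap p (y p) a b := by
  have hbc := hb.compl (n := n) h.inSym_left
  have hc := h.conj
  have e : BumplessEG.conj n (y * swap i p) * swap (rev n p) (rev n i) = BumplessEG.conj n y := by
    rw [← conj_swap, ← conj_mul, mul_assoc, swap_comm i p, swap_mul_self, mul_one]
  have hbel : HasBelow (BumplessEG.conj n (y * swap i p) * swap (rev n p) (rev n i)) (rev n p) := by
    rw [e]; exact hc.below
  have hinv : inv (BumplessEG.conj n (y * swap i p)) =
      inv (BumplessEG.conj n (y * swap i p) * swap (rev n p) (rev n i)) + 1 := by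
    rw [e, inv_conj h.inSym_left, inv_conj h.inSym, h.cover]
  obtain ⟨d, j, h1, h2, h3⟩ := exists_littleMap hbc hc.lt' hinv hbel
  rw [e] at h2 h3
  have hp : 1 ≤ p ∧ p ≤ n := by have := h.lt; have := h.lt'; have := h.le; omega
  have hrp := rev_of_mem hp.1 hp.2
  obtain ⟨hj1, hj2, hj3⟩ := (mem_coverSet_iff hc.inSym.finSupp hc.inSym.zero).1 h2
  have hjS : InSym n (BumplessEG.conj n y * swap j (rev n p)) :=
    hc.inSym.mul (inSym_swap (by omega) (by omega) (by omega) (by omega))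
  have hdS := letters_lt h3 hjS
  have hjq : rev n j = q := by
    have hrj := rev_of_mem (n := n) (i := j) (by omega) (by omega)
    apply hq _ (by omega) (by omega)
    rw [← inv_conj (h.inSym.mul (inSym_swap (by omega) (by omega) (by omega) (by omega))),
      conj_mul, conj_swap, rev_rev, swap_comm, hj3, inv_conj h.inSym]
  refine ⟨BumplessEG.compl n d, ?_, ?_⟩
  · have := h3.compl (n := n) hjS
    rwa [conj_mul, conj_swap, conj_conj, rev_rev, hjq, swap_comm] at this
  · have h4 := h1.inv hbc h.inSym_left.conj (hc.one_le.trans hc.lt.le) hc.le hbel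
    have h5 := h4.2.2
    have hbl := letters_lt hb h.inSym_left
    have h7 := h.inSym.mem (i := p) (by omega) (by omega)
    rw [compl_compl hbl, conj_apply, rev_rev, Perm.mul_apply, swap_apply_left, hrp,
      rev_of_mem h7.1 h7.2] at h5
    convert h5 using 1 <;> omega

end BumplessEG

namespace BumplessEG

open Equiv

/-! ### Coxeter–Knuth moves -/

/-- The Coxeter–Knuth moves on three consecutive letters, in one direction. -/
inductive Knuth : ℕ → ℕ → ℕ → ℕ → ℕ → ℕ → Prop
  | bac {a b c : ℕ} : a < b → b < c → Knuth b a c b c a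
  | acb {a b c : ℕ} : a < b → b < c → Knuth a c b c a b
  | braid (k : ℕ) : Knuth k (k + 1) k (k + 1) k (k + 1)

/-- `v'` is obtained from `v` by a Coxeter–Knuth move at the positions `i, i + 1, i + 2`. -/
def CK (i : ℕ) (v v' : List ℕ) : Prop :=
  ∃ A B x y z x' y' z', A.length = i ∧ v = A ++ x :: y :: z :: B ∧
    v' = A ++ x' :: y' :: z' :: B ∧ (Knuth x y z x' y' z' ∨ Knuth x' y' z' x y z)

lemma CK.symm {i : ℕ} {v v' : List ℕ} (h : CK i v v') : CK i v' v := by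
  obtain ⟨A, B, x, y, z, x', y', z', h1, h2, h3, h4⟩ := h
  exact ⟨A, B, x', y', z', x, y, z, h1, h3, h2, h4.symm⟩

lemma CK.of_knuth {A B : List ℕ} {x y z x' y' z' : ℕ} (h : Knuth x y z x' y' z') :
    CK A.length (A ++ x :: y :: z :: B) (A ++ x' :: y' :: z' :: B) :=
  ⟨A, B, x, y, z, x', y', z', rfl, rfl, rfl, Or.inl h⟩

lemma CK.length_eq {i : ℕ} {v v' : List ℕ} (h : CK i v v') : v'.length = v.length := by
  obtain ⟨A, B, x, y, z, x', y', z', h1, rfl, rfl, -⟩ := h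
  simp

lemma simple_comm {i j : ℕ} (h : i + 1 < j) (w : Perm ℕ) :
    swap i (i + 1) * (swap j (j + 1) * w) = swap j (j + 1) * (swap i (i + 1) * w) := by
  rw [← mul_assoc, ← mul_assoc]
  congr 1
  ext k
  simp only [Perm.mul_apply, swap_apply_def]
  split_ifs <;> omega

lemma simple_braid (k : ℕ) (w : Perm ℕ) :
    swap k (k + 1) * (swap (k + 1) (k + 1 + 1) * (swap k (k + 1) * w)) =
      swap (k + 1) (k + 1 + 1) * (swap k (k + 1) * (swap (k + 1) (k + 1 + 1) * w)) := by
  simp only [← mul_assoc]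
  congr 1
  ext k
  simp only [Perm.mul_apply, swap_apply_def]
  split_ifs <;> omega

lemma Knuth.prod {x y z x' y' z' : ℕ} (h : Knuth x y z x' y' z') (w : Perm ℕ) :
    swap x (x + 1) * (swap y (y + 1) * (swap z (z + 1) * w)) =
      swap x' (x' + 1) * (swap y' (y' + 1) * (swap z' (z' + 1) * w)) := by
  cases h with
  | bac h1 h2 => rw [simple_comm (i := y) (j := z) (by omega)]
  | acb h1 h2 => rw [simple_comm (i := x) (j := y) (by omega)]
  | braid k => rw [simple_braid]

lemma CK.wordProd_eq {i : ℕ} {v v' : List ℕ} (h : CK i v v') : wordProd v' = wordProd v := by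
  obtain ⟨A, B, x, y, z, x', y', z', h1, rfl, rfl, h | h⟩ := h
  · simp only [wordProd_append, wordProd_cons, h.prod]
  · simp only [wordProd_append, wordProd_cons, h.prod]

lemma Knuth.pos {x y z x' y' z' : ℕ} (h : Knuth x y z x' y' z') :
    (1 ≤ x ∧ 1 ≤ y ∧ 1 ≤ z) ↔ (1 ≤ x' ∧ 1 ≤ y' ∧ 1 ≤ z') := by
  cases h <;> omega

lemma CK.pos {i : ℕ} {v v' : List ℕ} (h : CK i v v') (hv : ∀ x ∈ v, 1 ≤ x) :
    ∀ x ∈ v', 1 ≤ x := by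
  obtain ⟨A, B, x, y, z, x', y', z', h1, rfl, rfl, h | h⟩ := h
  all_goals
    have h2 := h.pos
    simp only [List.mem_append, List.mem_cons] at hv ⊢
    have hx := hv x (by simp)
    have hy := hv y (by simp)
    have hz := hv z (by simp)
    rintro u (hu | rfl | rfl | rfl | hu)
    · exact hv u (by simp [hu])
    · omega
    · omega
    · omega
    · exact hv u (by simp [hu])

lemma CK.isReduced {i : ℕ} {v v' : List ℕ} (h : CK i v v') (hv : IsReduced v) : IsReduced v' := by
  rw [isReduced_iff_inv] at hv ⊢
  exact ⟨h.pos hv.1, by rw [h.wordProd_eq, h.length_eq, hv.2]⟩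

lemma CK.isReducedWord {i : ℕ} {u : Perm ℕ} {v v' : List ℕ} (h : CK i v v')
    (hv : IsReducedWord u v) : IsReducedWord u v' :=
  ⟨h.isReduced hv.1, h.wordProd_eq.trans hv.2⟩

lemma state_append_iff {y : Perm ℕ} {p c : ℕ} {A B : List ℕ} :
    State y p (A ++ c :: B) A.length ↔ (∀ x ∈ A ++ c :: B, 1 ≤ x) ∧
      wordProd A * wordProd B = y ∧ inv y + 1 = (A ++ c :: B).length ∧ wordProd A c = y p := by
  have h1 : (A ++ c :: B).eraseIdx A.length = A ++ B := by simp [List.eraseIdx_append]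
  have h2 : lo (A ++ c :: B) A.length = wordProd A c := by simp [lo]
  constructor
  · rintro ⟨-, h3, h4, h5, h6⟩
    rw [h1, wordProd_append] at h4
    rw [h2] at h6
    exact ⟨h3, h4, h5, h6⟩
  · rintro ⟨h3, h4, h5, h6⟩
    exact ⟨by simp, h3, by rw [h1, wordProd_append, h4], h5, by rw [h2, h6]⟩

lemma bump_append {A B : List ℕ} {c : ℕ} (hc : 2 ≤ c) :
    bump (A ++ c :: B) A.length = A ++ (c - 1) :: B := by
  rw [bump_eq (by simpa using hc)]
  simp

section window

variable {Y : Perm ℕ} {p x y z t : ℕ} {A B : List ℕ}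

lemma state_window_zero : State Y p (A ++ x :: y :: z :: B) A.length ↔
    (∀ u ∈ A ++ x :: y :: z :: B, 1 ≤ u) ∧
      wordProd A * (swap y (y + 1) * (swap z (z + 1) * wordProd B)) = Y ∧
      inv Y + 1 = A.length + B.length + 3 ∧ wordProd A x = Y p := by
  rw [state_append_iff]
  simp only [wordProd_cons, List.length_append, List.length_cons]
  exact and_congr_right fun _ => and_congr_right fun _ => and_congr_left fun _ => by omega

lemma state_window_one : State Y p (A ++ x :: y :: z :: B) (A.length + 1) ↔
    (∀ u ∈ A ++ x :: y :: z :: B, 1 ≤ u) ∧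
      wordProd A * (swap x (x + 1) * (swap z (z + 1) * wordProd B)) = Y ∧
      inv Y + 1 = A.length + B.length + 3 ∧ wordProd A (swap x (x + 1) y) = Y p := by
  have h := state_append_iff (y := Y) (p := p) (A := A ++ [x]) (c := y) (B := z :: B)
  simp only [List.append_assoc, List.singleton_append, List.length_append,
    wordProd_append, wordProd_cons, wordProd_nil, mul_one, List.length_cons, List.length_nil,
    zero_add, mul_assoc, Perm.mul_apply] at h
  rw [h]
  exact and_congr_right fun _ => and_congr_right fun _ => and_congr_left fun _ => by omega

lemma state_window_two : State Y p (A ++ x :: y :: z :: B) (A.length + 2) ↔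
    (∀ u ∈ A ++ x :: y :: z :: B, 1 ≤ u) ∧
      wordProd A * (swap x (x + 1) * (swap y (y + 1) * wordProd B)) = Y ∧
      inv Y + 1 = A.length + B.length + 3 ∧
      wordProd A (swap x (x + 1) (swap y (y + 1) z)) = Y p := by
  have h := state_append_iff (y := Y) (p := p) (A := A ++ [x, y]) (c := z) (B := B)
  simp only [List.append_assoc, List.cons_append, List.nil_append, List.length_append,
    List.length_cons, List.length_nil,
    wordProd_append, wordProd_cons, wordProd_nil, mul_one, mul_assoc,
    Perm.mul_apply] at h
  rw [h]
  exact and_congr_right fun _ => and_congr_right fun _ => and_congr_left fun _ => by omega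

lemma bump_window_zero (h : 2 ≤ x) :
    bump (A ++ x :: y :: z :: B) A.length = A ++ (x - 1) :: y :: z :: B := bump_append h

lemma bump_window_one (h : 2 ≤ y) :
    bump (A ++ x :: y :: z :: B) (A.length + 1) = A ++ x :: (y - 1) :: z :: B := by
  have := bump_append (A := A ++ [x]) (B := z :: B) h
  simpa using this

lemma bump_window_two (h : 2 ≤ z) :
    bump (A ++ x :: y :: z :: B) (A.length + 2) = A ++ x :: y :: (z - 1) :: B := by
  have := bump_append (A := A ++ [x, y]) (B := B) h
  simpa using this

lemma two_le_window_zero (h : State Y p (A ++ x :: y :: z :: B) A.length) (hb : HasBelow Y p) :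
    2 ≤ x := by
  have := h.two_le hb
  simpa using this

lemma two_le_window_one (h : State Y p (A ++ x :: y :: z :: B) (A.length + 1))
    (hb : HasBelow Y p) : 2 ≤ y := by
  have := h.two_le hb
  rw [show A ++ x :: y :: z :: B = (A ++ [x]) ++ y :: z :: B by simp,
    show A.length + 1 = (A ++ [x]).length by simp, List.getD_append_right _ _ _ _ le_rfl] at this
  simpa using this

lemma two_le_window_two (h : State Y p (A ++ x :: y :: z :: B) (A.length + 2))
    (hb : HasBelow Y p) : 2 ≤ z := by
  have := h.two_le hb
  rw [show A ++ x :: y :: z :: B = (A ++ [x, y]) ++ z :: B by simp,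
    show A.length + 2 = (A ++ [x, y]).length by simp, List.getD_append_right _ _ _ _ le_rfl] at this
  simpa using this

/-- Outside of the window of a Coxeter–Knuth move nothing changes. -/
lemma state_outside {x' y' z' : ℕ} (h : State Y p (A ++ x :: y :: z :: B) t)
    (hb : HasBelow Y p)
    (hck : Knuth x y z x' y' z' ∨ Knuth x' y' z' x y z)
    (ht : t < A.length ∨ A.length + 3 ≤ t) :
    State Y p (A ++ x' :: y' :: z' :: B) t ∧
      ∃ A' B', A'.length = A.length ∧
        bump (A ++ x :: y :: z :: B) t = A' ++ x :: y :: z :: B' ∧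
        bump (A ++ x' :: y' :: z' :: B) t = A' ++ x' :: y' :: z' :: B' := by
  have hpos := (CK.pos ⟨A, B, x, y, z, x', y', z', rfl, rfl, rfl, hck⟩ h.pos)
  have h2 := h.two_le hb
  have hprod : ∀ w : Perm ℕ, swap x (x + 1) * (swap y (y + 1) * (swap z (z + 1) * w)) =
      swap x' (x' + 1) * (swap y' (y' + 1) * (swap z' (z' + 1) * w)) := fun w => by
    rcases hck with hck | hck <;> rw [hck.prod]
  rcases ht with ht | ht
  · obtain ⟨A₁, c, A₂, rfl, rfl⟩ : ∃ A₁ c A₂, A = A₁ ++ c :: A₂ ∧ t = A₁.length :=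
      ⟨A.take t, A[t], A.drop (t + 1), by simp, by simp [ht.le]⟩
    have e : ∀ x y z, A₁ ++ c :: A₂ ++ x :: y :: z :: B = A₁ ++ c :: (A₂ ++ x :: y :: z :: B) := by
      simp
    rw [e] at h h2 hpos ⊢
    rw [e]
    have hc : 2 ≤ c := by simpa using h2
    rw [state_append_iff] at h ⊢
    refine ⟨⟨hpos, ?_, by simpa using h.2.2.1, h.2.2.2⟩, A₁ ++ (c - 1) :: A₂, B, by simp, ?_, ?_⟩
    · rw [← h.2.1]
      simp only [wordProd_append, wordProd_cons, hprod]
    · rw [bump_append hc]; simp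
    · rw [bump_append hc]; simp
  · have htl := h.lt
    simp only [List.length_append, List.length_cons] at htl
    obtain ⟨B₁, c, B₂, rfl, rfl⟩ : ∃ B₁ c B₂, B = B₁ ++ c :: B₂ ∧ t = A.length + 3 + B₁.length :=
      ⟨B.take (t - A.length - 3), B[t - A.length - 3], B.drop (t - A.length - 3 + 1), by simp,
        by simp; omega⟩
    have e : ∀ x y z, A ++ x :: y :: z :: (B₁ ++ c :: B₂) =
        (A ++ x :: y :: z :: B₁) ++ c :: B₂ := by
      simp
    have e' : ∀ x y z : ℕ, A.length + 3 + B₁.length = (A ++ x :: y :: z :: B₁).length := by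
      intros; simp; omega
    rw [e] at h h2 hpos ⊢
    rw [e x]
    have hc : 2 ≤ c := by
      rw [e' x y z, List.getD_append_right _ _ _ _ le_rfl] at h2
      simpa using h2
    have hw : wordProd (A ++ x' :: y' :: z' :: B₁) = wordProd (A ++ x :: y :: z :: B₁) := by
      simp only [wordProd_append, wordProd_cons, hprod]
    have hbump : ∀ x y z, bump (A ++ x :: y :: z :: B₁ ++ c :: B₂) (A.length + 3 + B₁.length) =
        A ++ x :: y :: z :: (B₁ ++ (c - 1) :: B₂) := by
      intro x y z
      rw [e' x y z, bump_append hc]; simp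
    refine ⟨?_, A, B₁ ++ (c - 1) :: B₂, rfl, hbump _ _ _, hbump _ _ _⟩
    rw [e' x y z, state_append_iff] at h
    rw [e' x' y' z', state_append_iff]
    exact ⟨hpos, by rw [hw, h.2.1], by simpa using h.2.2.1, by rw [hw, h.2.2.2]⟩

end window

/-- Bumps of two words related by a Coxeter–Knuth move end in words related by such a move. -/
def Simulates (Y : Perm ℕ) (p i : ℕ) (v v' : List ℕ) : Prop :=
  ∃ t t' b b', State Y p v t ∧ State Y p v' t' ∧ LittleBump v t b ∧ LittleBump v' t' b' ∧ CK i b b'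

lemma Simulates.symm {Y : Perm ℕ} {p i : ℕ} {v v' : List ℕ} (h : Simulates Y p i v v') :
    Simulates Y p i v' v := by
  obtain ⟨t, t', b, b', h1, h2, h3, h4, h5⟩ := h
  exact ⟨t', t, b', b, h2, h1, h4, h3, h5.symm⟩

/-- A simultaneous version of `After`. -/
def AfterPair (Y : Perm ℕ) (p i : ℕ) (v v' : List ℕ) : Prop :=
  ∃ b b', After Y p v b ∧ After Y p v' b' ∧ CK i b b'

section simulation

variable {Y : Perm ℕ} {p x y z : ℕ} {A B : List ℕ}

lemma State.after {v : List ℕ} {t : ℕ} {b : List ℕ} (h : State Y p v t) (hb : HasBelow Y p)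
    (ha : After Y p (bump v t) b) : After Y p v b :=
  Or.inr ⟨t, h, (h.littleBump_iff hb).2 ha⟩

lemma AfterPair.simulates {v v' : List ℕ} {t t' i : ℕ} (hb : HasBelow Y p)
    (h : State Y p v t) (h' : State Y p v' t') (hs : AfterPair Y p i (bump v t) (bump v' t')) :
    Simulates Y p i v v' := by
  obtain ⟨b, b', h1, h2, h3⟩ := hs
  exact ⟨t, t', b, b', h, h', (h.littleBump_iff hb).2 h1, (h'.littleBump_iff hb).2 h2, h3⟩

lemma AfterPair.left {v v' : List ℕ} {t i : ℕ} (hb : HasBelow Y p)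
    (h : State Y p v t) (hs : AfterPair Y p i (bump v t) v') : AfterPair Y p i v v' := by
  obtain ⟨b, b', h1, h2, h3⟩ := hs
  exact ⟨b, b', h.after hb h1, h2, h3⟩

lemma AfterPair.right {v v' : List ℕ} {t' i : ℕ} (hb : HasBelow Y p)
    (h : State Y p v' t') (hs : AfterPair Y p i v (bump v' t')) : AfterPair Y p i v v' := by
  obtain ⟨b, b', h1, h2, h3⟩ := hs
  exact ⟨b, b', h1, h.after hb h2, h3⟩

/-- Coxeter–Knuth moves preserve reducedness, so two words related by a move either both end their
bumps at once or can be bumped further together. -/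
lemma afterPair_of_simulates {v v' : List ℕ} {i : ℕ} (hck : CK i v v')
    (hv : IsReduced v ∨ ∃ s, State Y p v s) (hs : (∃ s, State Y p v s) → Simulates Y p i v v') :
    AfterPair Y p i v v' := by
  rcases hv with hv | hv
  · exact ⟨v, v', Or.inl ⟨hv, rfl⟩, Or.inl ⟨hck.isReduced hv, rfl⟩, hck⟩
  · obtain ⟨t, t', b, b', h1, h2, h3, h4, h5⟩ := hs hv
    exact ⟨b, b', Or.inr ⟨t, h1, h3⟩, Or.inr ⟨t', h2, h4⟩, h5⟩

lemma State.bump_or {v : List ℕ} {t : ℕ} (h : State Y p v t) (hb : HasBelow Y p) :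
    IsReduced (bump v t) ∨ ∃ s, State Y p (bump v t) s := by
  by_cases hr : IsReduced (bump v t)
  · exact Or.inl hr
  · obtain ⟨s, -, hs⟩ := h.bump_not_reduced hb hr
    exact Or.inr ⟨s, hs⟩

lemma simple_apply_of_lt {i k : ℕ} (h : k < i) : swap i (i + 1) k = k :=
  swap_apply_of_ne_of_ne (by omega) (by omega)

lemma simple_apply_of_gt {i k : ℕ} (h : i + 1 < k) : swap i (i + 1) k = k :=
  swap_apply_of_ne_of_ne (by omega) (by omega)

/-- The marked letter can be transported backwards along a Coxeter–Knuth move. -/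
lemma exists_state_of_knuth {x' y' z' t : ℕ} (hk : Knuth x y z x' y' z') (hb : HasBelow Y p)
    (h : State Y p (A ++ x' :: y' :: z' :: B) t) : ∃ t', State Y p (A ++ x :: y :: z :: B) t' := by
  by_cases ht : t < A.length ∨ A.length + 3 ≤ t
  · exact ⟨t, (state_outside h hb (Or.inr hk) ht).1⟩
  have hpos := (CK.of_knuth (A := A) (B := B) hk).symm.pos h.pos
  have ht : t = A.length ∨ t = A.length + 1 ∨ t = A.length + 2 := by omega
  cases hk with
  | bac h1 h2 =>
    rcases ht with rfl | rfl | rfl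
    · refine ⟨A.length, ?_⟩
      rw [state_window_zero] at h ⊢
      rw [simple_comm (i := y) (j := z) (by omega)]
      exact ⟨hpos, h.2⟩
    · refine ⟨A.length + 2, ?_⟩
      rw [state_window_one] at h
      rw [state_window_two, simple_apply_of_gt (i := y) (by omega)]
      exact ⟨hpos, h.2⟩
    · refine ⟨A.length + 1, ?_⟩
      rw [state_window_two] at h
      rw [state_window_one]
      rw [simple_apply_of_lt (i := z) (by omega)] at h
      exact ⟨hpos, h.2⟩
  | acb h1 h2 =>
    rcases ht with rfl | rfl | rfl
    · refine ⟨A.length + 1, ?_⟩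
      rw [state_window_zero] at h
      rw [state_window_one, simple_apply_of_gt (i := x) (by omega)]
      exact ⟨hpos, h.2⟩
    · refine ⟨A.length, ?_⟩
      rw [state_window_one, simple_apply_of_lt (i := y) (by omega)] at h
      rw [state_window_zero]
      exact ⟨hpos, h.2⟩
    · refine ⟨A.length + 2, ?_⟩
      rw [state_window_two] at h ⊢
      refine ⟨hpos, by rw [simple_comm (i := x) (j := y) (by omega)]; exact h.2.1, h.2.2.1, ?_⟩
      rw [← h.2.2.2]
      congr 1
      simp only [swap_apply_def]
      split_ifs <;> omega
  | braid _ =>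
    rcases ht with rfl | rfl | rfl
    · refine ⟨A.length + 2, ?_⟩
      rw [state_window_zero] at h
      rw [state_window_two]
      refine ⟨hpos, h.2.1, h.2.2.1, ?_⟩
      rw [← h.2.2.2]
      congr 1
      simp only [swap_apply_def]
      split_ifs <;> omega
    -- Deleting the middle letter leaves two equal adjacent letters, so the remaining word is not
    -- reduced.
    · exfalso
      rw [state_window_one] at h
      have h3 := inv_wordProd_le (A ++ B)
      have h4 := h.2.1
      rw [← mul_assoc (swap (x + 1) _), swap_mul_self, one_mul, ← wordProd_append] at h4
      rw [h4, List.length_append] at h3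
      have := h.2.2.1
      omega
    · refine ⟨A.length, ?_⟩
      rw [state_window_two] at h
      rw [state_window_zero]
      refine ⟨hpos, h.2.1, h.2.2.1, ?_⟩
      rw [← h.2.2.2]
      congr 1
      simp only [swap_apply_def]
      split_ifs <;> omega

end simulation

end BumplessEG

/-! ### Little bumps commute with Coxeter–Knuth moves, and they preserve descents -/

namespace BumplessEG

open Equiv

section simulation

variable {Y : Perm ℕ} {p x y z : ℕ} {A B : List ℕ} {N : ℕ}

/-- The induction hypothesis of the simulation theorem. -/
def SimulatesBelow (Y : Perm ℕ) (p N : ℕ) : Prop :=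
  ∀ i w w', CK i w w' → w.sum + w'.sum < N → (∃ s, State Y p w s) → Simulates Y p i w w'

lemma SimulatesBelow.afterPair {w w' : List ℕ} {i : ℕ} (ih : SimulatesBelow Y p N)
    (hck : CK i w w') (hN : w.sum + w'.sum < N) (hv : IsReduced w ∨ ∃ s, State Y p w s) :
    AfterPair Y p i w w' :=
  afterPair_of_simulates hck hv (ih i w w' hck hN)

lemma State.pos_of_knuth {x' y' z' t : ℕ} (h : State Y p (A ++ x :: y :: z :: B) t)
    (hk : Knuth x y z x' y' z') : ∀ u ∈ A ++ x' :: y' :: z' :: B, 1 ≤ u :=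
  (CK.of_knuth hk).pos h.pos

lemma State.bumped_pos {v w : List ℕ} {t : ℕ} (h : State Y p v t) (hb : HasBelow Y p)
    (hw : bump v t = w) : ∀ u ∈ w, 1 ≤ u := hw ▸ h.pos_bump hb

lemma State.bumped_or {v w : List ℕ} {t : ℕ} (h : State Y p v t) (hb : HasBelow Y p)
    (hw : bump v t = w) : IsReduced w ∨ ∃ s, State Y p w s := hw ▸ h.bump_or hb

/-- The same letter is bumped in both words. Usually the inequalities survive and the words are
still related by the same move; only collisions of letters that differed by one need further bumps
before the induction hypothesis applies. -/
lemma simulates_bac (hb : HasBelow Y p) (ih : SimulatesBelow Y p N) {t : ℕ}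
    (hyx : y < x) (hxz : x < z)
    (hN : (A ++ x :: y :: z :: B).sum + (A ++ x :: z :: y :: B).sum = N)
    (ht : ¬ (t < A.length ∨ A.length + 3 ≤ t)) (h : State Y p (A ++ x :: y :: z :: B) t) :
    Simulates Y p A.length (A ++ x :: y :: z :: B) (A ++ x :: z :: y :: B) := by
  have hpos := h.pos_of_knuth (Knuth.bac hyx hxz)
  have ht : t = A.length ∨ t = A.length + 1 ∨ t = A.length + 2 := by omega
  simp only [List.sum_append, List.sum_cons] at hN
  rcases ht with rfl | rfl | rfl
  · have h' : State Y p (A ++ x :: z :: y :: B) A.length := by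
      have h1 := state_window_zero.1 h
      rw [state_window_zero]
      exact ⟨hpos, by rw [← simple_comm (i := y) (j := z) (by omega)]; exact h1.2.1, h1.2.2⟩
    have h2 := two_le_window_zero h hb
    have e := bump_window_zero (A := A) (B := B) (y := y) (z := z) h2
    have e' := bump_window_zero (A := A) (B := B) (y := z) (z := y) h2
    refine AfterPair.simulates hb h h' ?_
    rw [e, e']
    by_cases hc : y < x - 1
    · exact ih.afterPair (CK.of_knuth (.bac hc (by omega)))
        (by simp only [List.sum_append, List.sum_cons]; omega) (h.bumped_or hb e)
    -- The bumped `x` meets `y`. In both words the other copy of `y` is next, and bumping it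
    -- restores the inequalities.
    · obtain rfl : x = y + 1 := by omega
      rw [Nat.add_sub_cancel] at *
      have s : State Y p (A ++ y :: y :: z :: B) (A.length + 1) := by
        have h1 := state_window_zero.1 h
        rw [state_window_one]
        exact ⟨h.bumped_pos hb e, h1.2.1, h1.2.2.1, by rw [swap_apply_left]; exact h1.2.2.2⟩
      have s' : State Y p (A ++ y :: z :: y :: B) (A.length + 2) := by
        have h1 := state_window_zero.1 h'
        rw [state_window_two]
        refine ⟨h'.bumped_pos hb e', ?_, h1.2.2.1, ?_⟩
        · rw [simple_comm (i := y) (j := z) (by omega)]; exact h1.2.1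
        · rw [simple_apply_of_lt (i := z) (by omega), swap_apply_left]; exact h1.2.2.2
      have k2 := two_le_window_one s hb
      have f := bump_window_one (A := A) (B := B) (x := y) (z := z) k2
      have f' := bump_window_two (A := A) (B := B) (x := y) (y := z) k2
      refine AfterPair.left hb s (AfterPair.right hb s' ?_)
      rw [f, f']
      exact ih.afterPair (CK.of_knuth (.bac (by omega) (by omega)))
        (by simp only [List.sum_append, List.sum_cons]; omega) (s.bumped_or hb f)
  · have h' : State Y p (A ++ x :: z :: y :: B) (A.length + 2) := by
      have h1 := state_window_one.1 h
      rw [state_window_two, simple_apply_of_lt (i := z) (by omega)]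
      exact ⟨hpos, h1.2⟩
    have h2 := two_le_window_one h hb
    have e := bump_window_one (A := A) (B := B) (x := x) (z := z) h2
    have e' := bump_window_two (A := A) (B := B) (x := x) (y := z) h2
    refine AfterPair.simulates hb h h' ?_
    rw [e, e']
    exact ih.afterPair (CK.of_knuth (.bac (by omega) (by omega)))
        (by simp only [List.sum_append, List.sum_cons]; omega) (h.bumped_or hb e)
  · have h' : State Y p (A ++ x :: z :: y :: B) (A.length + 1) := by
      have h1 := state_window_two.1 h
      rw [simple_apply_of_gt (i := y) (by omega)] at h1
      rw [state_window_one]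
      exact ⟨hpos, h1.2⟩
    have h2 := two_le_window_two h hb
    have e := bump_window_two (A := A) (B := B) (x := x) (y := y) h2
    have e' := bump_window_one (A := A) (B := B) (x := x) (z := y) h2
    refine AfterPair.simulates hb h h' ?_
    rw [e, e']
    by_cases hc : x < z - 1
    · exact ih.afterPair (CK.of_knuth (.bac hyx hc))
        (by simp only [List.sum_append, List.sum_cons]; omega) (h.bumped_or hb e)
    obtain rfl : z = x + 1 := by omega
    rw [Nat.add_sub_cancel] at *
    have s' : State Y p (A ++ x :: x :: y :: B) A.length := by
      have h1 := state_window_one.1 h'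
      rw [state_window_zero]
      rw [swap_apply_right] at h1
      exact ⟨h'.bumped_pos hb e', h1.2⟩
    have k2 := two_le_window_zero s' hb
    have f' := bump_window_zero (A := A) (B := B) (y := x) (z := y) k2
    refine AfterPair.right hb s' ?_
    rw [f']
    -- Here `z` has met `x`, and the right word has been bumped once more at its first letter. If `y
    -- = x - 1`, the words are now the two sides of a braid relation, and the left one needs no
    -- second bump. If `y < x - 1`, the two copies of `x` in the left word cancel through `y`, so
    -- its first letter is bumped too.
    by_cases hc' : y = x - 1
    · obtain rfl : x = y + 1 := by omega
      rw [Nat.add_sub_cancel] at *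
      exact ih.afterPair (CK.of_knuth (.braid y)).symm
        (by simp only [List.sum_append, List.sum_cons]; omega) (h.bumped_or hb e)
    · have s : State Y p (A ++ x :: y :: x :: B) A.length := by
        have h1 := state_window_zero.1 s'
        rw [state_window_zero]
        refine ⟨h.bumped_pos hb e, ?_, h1.2.2⟩
        rw [simple_comm (i := y) (j := x) (by omega)]
        exact h1.2.1
      have f := bump_window_zero (A := A) (B := B) (y := y) (z := x) k2
      refine AfterPair.left hb s ?_
      rw [f]
      exact ih.afterPair (CK.of_knuth (.bac (by omega) (by omega)))
        (by simp only [List.sum_append, List.sum_cons]; omega) (s.bumped_or hb f)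

/-- The analysis mirrors `simulates_bac`: when the bumped `y` meets `z`, the outcome is a braid
relation if `x = z - 1` and one further bump in both words otherwise; when the bumped `z` meets `x`,
both words are bumped once more at the other copy of `x`. -/
lemma simulates_acb (hb : HasBelow Y p) (ih : SimulatesBelow Y p N) {t : ℕ}
    (hxz : x < z) (hzy : z < y)
    (hN : (A ++ x :: y :: z :: B).sum + (A ++ y :: x :: z :: B).sum = N)
    (ht : ¬ (t < A.length ∨ A.length + 3 ≤ t)) (h : State Y p (A ++ x :: y :: z :: B) t) :
    Simulates Y p A.length (A ++ x :: y :: z :: B) (A ++ y :: x :: z :: B) := by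
  have hpos := h.pos_of_knuth (Knuth.acb hxz hzy)
  have ht : t = A.length ∨ t = A.length + 1 ∨ t = A.length + 2 := by omega
  simp only [List.sum_append, List.sum_cons] at hN
  rcases ht with rfl | rfl | rfl
  · have h' : State Y p (A ++ y :: x :: z :: B) (A.length + 1) := by
      have h1 := state_window_zero.1 h
      rw [state_window_one, simple_apply_of_lt (i := y) (by omega)]
      exact ⟨hpos, h1.2⟩
    have h2 := two_le_window_zero h hb
    have e := bump_window_zero (A := A) (B := B) (y := y) (z := z) h2
    have e' := bump_window_one (A := A) (B := B) (x := y) (z := z) h2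
    refine AfterPair.simulates hb h h' ?_
    rw [e, e']
    exact ih.afterPair (CK.of_knuth (.acb (by omega) (by omega)))
        (by simp only [List.sum_append, List.sum_cons]; omega) (h.bumped_or hb e)
  · have h' : State Y p (A ++ y :: x :: z :: B) A.length := by
      have h1 := state_window_one.1 h
      rw [simple_apply_of_gt (i := x) (by omega)] at h1
      rw [state_window_zero]
      exact ⟨hpos, h1.2⟩
    have h2 := two_le_window_one h hb
    have e := bump_window_one (A := A) (B := B) (x := x) (z := z) h2
    have e' := bump_window_zero (A := A) (B := B) (y := x) (z := z) h2
    refine AfterPair.simulates hb h h' ?_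
    rw [e, e']
    by_cases hc : z < y - 1
    · exact ih.afterPair (CK.of_knuth (.acb hxz hc))
        (by simp only [List.sum_append, List.sum_cons]; omega) (h.bumped_or hb e)
    obtain rfl : y = z + 1 := by omega
    rw [Nat.add_sub_cancel] at *
    have s : State Y p (A ++ x :: z :: z :: B) (A.length + 2) := by
      have h1 := state_window_one.1 h
      rw [state_window_two]
      refine ⟨h.bumped_pos hb e, h1.2.1, h1.2.2.1, ?_⟩
      rw [swap_apply_left]; exact h1.2.2.2
    have k2 := two_le_window_two s hb
    have f := bump_window_two (A := A) (B := B) (x := x) (y := z) k2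
    refine AfterPair.left hb s ?_
    rw [f]
    by_cases hc' : x = z - 1
    · obtain rfl : z = x + 1 := by omega
      rw [Nat.add_sub_cancel] at *
      exact ih.afterPair (CK.of_knuth (.braid x))
        (by simp only [List.sum_append, List.sum_cons]; omega) (s.bumped_or hb f)
    · have s' : State Y p (A ++ z :: x :: z :: B) (A.length + 2) := by
        have h1 := state_window_zero.1 h'
        rw [state_window_two, simple_apply_of_gt (i := x) (by omega), swap_apply_left]
        refine ⟨h'.bumped_pos hb e', ?_, h1.2.2⟩
        rw [← simple_comm (i := x) (j := z) (by omega)]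
        exact h1.2.1
      have f' := bump_window_two (A := A) (B := B) (x := z) (y := x) k2
      refine AfterPair.right hb s' ?_
      rw [f']
      exact ih.afterPair (CK.of_knuth (.acb (by omega) (by omega)))
        (by simp only [List.sum_append, List.sum_cons]; omega) (s.bumped_or hb f)
  · have h' : State Y p (A ++ y :: x :: z :: B) (A.length + 2) := by
      have h1 := state_window_two.1 h
      rw [state_window_two]
      refine ⟨hpos, by rw [← simple_comm (i := x) (j := y) (by omega)]; exact h1.2.1, h1.2.2.1, ?_⟩
      rw [← h1.2.2.2]
      congr 1
      simp only [swap_apply_def]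
      split_ifs <;> omega
    have h2 := two_le_window_two h hb
    have e := bump_window_two (A := A) (B := B) (x := x) (y := y) h2
    have e' := bump_window_two (A := A) (B := B) (x := y) (y := x) h2
    refine AfterPair.simulates hb h h' ?_
    rw [e, e']
    by_cases hc : x < z - 1
    · exact ih.afterPair (CK.of_knuth (.acb hc (by omega)))
        (by simp only [List.sum_append, List.sum_cons]; omega) (h.bumped_or hb e)
    obtain rfl : z = x + 1 := by omega
    rw [Nat.add_sub_cancel] at *
    have s : State Y p (A ++ x :: y :: x :: B) A.length := by
      have h1 := state_window_two.1 h
      rw [state_window_zero]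
      refine ⟨h.bumped_pos hb e, ?_, h1.2.2.1, ?_⟩
      · rw [← simple_comm (i := x) (j := y) (by omega)]; exact h1.2.1
      · rw [← h1.2.2.2, simple_apply_of_lt (i := y) (by omega), swap_apply_right]
    have s' : State Y p (A ++ y :: x :: x :: B) (A.length + 1) := by
      have h1 := state_window_two.1 h'
      rw [state_window_one, simple_apply_of_lt (i := y) (by omega)]
      refine ⟨h'.bumped_pos hb e', h1.2.1, h1.2.2.1, ?_⟩
      rw [← h1.2.2.2, swap_apply_right, simple_apply_of_lt (i := y) (by omega)]
    have k2 := two_le_window_zero s hb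
    have f := bump_window_zero (A := A) (B := B) (y := y) (z := x) k2
    have f' := bump_window_one (A := A) (B := B) (x := y) (z := x) k2
    refine AfterPair.left hb s (AfterPair.right hb s' ?_)
    rw [f, f']
    exact ih.afterPair (CK.of_knuth (.acb (by omega) (by omega)))
        (by simp only [List.sum_append, List.sum_cons]; omega) (s.bumped_or hb f)

/-- Only an outer letter can be marked. One bump on the left corresponds to two on the right, where
the first produces equal neighbours, and the braid relation becomes a commutation of distant
letters. -/
lemma simulates_braid {k : ℕ} (hb : HasBelow Y p) (ih : SimulatesBelow Y p N) {t : ℕ}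
    (hN : (A ++ k :: (k + 1) :: k :: B).sum + (A ++ (k + 1) :: k :: (k + 1) :: B).sum = N)
    (ht : ¬ (t < A.length ∨ A.length + 3 ≤ t)) (h : State Y p (A ++ k :: (k + 1) :: k :: B) t) :
    Simulates Y p A.length (A ++ k :: (k + 1) :: k :: B) (A ++ (k + 1) :: k :: (k + 1) :: B) := by
  have hpos := h.pos_of_knuth (Knuth.braid k)
  have ht : t = A.length ∨ t = A.length + 1 ∨ t = A.length + 2 := by omega
  simp only [List.sum_append, List.sum_cons] at hN
  rcases ht with rfl | rfl | rfl
  · have h' : State Y p (A ++ (k + 1) :: k :: (k + 1) :: B) (A.length + 2) := by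
      have h1 := state_window_zero.1 h
      rw [state_window_two]
      refine ⟨hpos, h1.2.1, h1.2.2.1, ?_⟩
      rw [swap_apply_right, simple_apply_of_lt (by omega)]
      exact h1.2.2.2
    have h2 := two_le_window_zero h hb
    have e := bump_window_zero (A := A) (B := B) (y := k + 1) (z := k) h2
    have e' := bump_window_two (A := A) (B := B) (x := k + 1) (y := k) (z := k + 1) (by omega)
    refine AfterPair.simulates hb h h' ?_
    rw [e, e']
    rw [Nat.add_sub_cancel] at *
    have s' : State Y p (A ++ (k + 1) :: k :: k :: B) (A.length + 1) := by
      have h1 := state_window_two.1 h'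
      rw [swap_apply_right] at h1
      rw [state_window_one]
      exact ⟨h'.bumped_pos hb e', h1.2⟩
    have f' := bump_window_one (A := A) (B := B) (x := k + 1) (z := k) h2
    refine AfterPair.right hb s' ?_
    rw [f']
    exact ih.afterPair (CK.of_knuth (.acb (by omega) (by omega)))
        (by simp only [List.sum_append, List.sum_cons]; omega) (h.bumped_or hb e)
  · exfalso
    rw [state_window_one] at h
    have h3 := inv_wordProd_le (A ++ B)
    have h4 := h.2.1
    rw [← mul_assoc (swap k _), swap_mul_self, one_mul, ← wordProd_append] at h4
    rw [h4, List.length_append] at h3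
    have := h.2.2.1
    omega
  · have h' : State Y p (A ++ (k + 1) :: k :: (k + 1) :: B) A.length := by
      have h1 := state_window_two.1 h
      rw [simple_apply_of_lt (i := k + 1) (by omega), swap_apply_left] at h1
      rw [state_window_zero]
      exact ⟨hpos, h1.2⟩
    have h2 := two_le_window_two h hb
    have e := bump_window_two (A := A) (B := B) (x := k) (y := k + 1) h2
    have e' := bump_window_zero (A := A) (B := B) (x := k + 1) (y := k) (z := k + 1) (by omega)
    refine AfterPair.simulates hb h h' ?_
    rw [e, e']
    rw [Nat.add_sub_cancel] at *
    have s' : State Y p (A ++ k :: k :: (k + 1) :: B) (A.length + 1) := by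
      have h1 := state_window_zero.1 h'
      rw [state_window_one, swap_apply_left]
      exact ⟨h'.bumped_pos hb e', h1.2⟩
    have f' := bump_window_one (A := A) (B := B) (x := k) (z := k + 1) h2
    refine AfterPair.right hb s' ?_
    rw [f']
    exact ih.afterPair (CK.of_knuth (.bac (by omega) (by omega))).symm
        (by simp only [List.sum_append, List.sum_cons]; omega) (h.bumped_or hb e)

theorem simulates_of_ck (hb : HasBelow Y p) {i : ℕ} {v v' : List ℕ} (hck : CK i v v')
    (h : ∃ t, State Y p v t) : Simulates Y p i v v' := by
  induction hm : v.sum + v'.sum using Nat.strong_induction_on generalizing i v v' with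
  | _ N ihN =>
    have ih : SimulatesBelow Y p N := fun i w w' h1 h2 h3 => ihN _ h2 h1 h3 rfl
    obtain ⟨A, B, x, y, z, x', y', z', rfl, rfl, rfl, hk⟩ := hck
    by_cases hout : ∃ t, State Y p (A ++ x :: y :: z :: B) t ∧ (t < A.length ∨ A.length + 3 ≤ t)
    · obtain ⟨t, h, ht⟩ := hout
      obtain ⟨h', A', B', hA, e, e'⟩ := state_outside h hb hk ht
      refine AfterPair.simulates hb h h' ?_
      have l1 := sum_bump (h.two_le hb)
      have l2 := sum_bump (h'.two_le hb)
      rw [e] at l1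
      rw [e'] at l2
      rw [e, e']
      exact ih.afterPair ⟨A', B', x, y, z, x', y', z', hA, rfl, rfl, hk⟩ (by omega)
        (h.bumped_or hb e)
    have key : ∀ {x y z x' y' z' t}, Knuth x y z x' y' z' →
        (A ++ x :: y :: z :: B).sum + (A ++ x' :: y' :: z' :: B).sum = N →
        State Y p (A ++ x :: y :: z :: B) t → ¬ (t < A.length ∨ A.length + 3 ≤ t) →
        Simulates Y p A.length (A ++ x :: y :: z :: B) (A ++ x' :: y' :: z' :: B) := by
      intro x y z x' y' z' t hk hN h ht
      cases hk with
      | bac h1 h2 => exact simulates_bac hb ih h1 h2 hN ht h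
      | acb h1 h2 => exact simulates_acb hb ih h1 h2 hN ht h
      | braid k => exact simulates_braid hb ih hN ht h
    rcases hk with hk | hk
    · obtain ⟨t, h⟩ := h
      exact key hk hm h fun ht => hout ⟨t, h, ht⟩
    · obtain ⟨t, h⟩ := h
      -- For a move read backwards, the marked letter is first transported to the other word and the
      -- simulation is then reversed. A mark outside the window would have been outside in both
      -- words.
      obtain ⟨t', h'⟩ := exists_state_of_knuth hk hb h
      by_cases ht' : t' < A.length ∨ A.length + 3 ≤ t'
      · exact absurd ⟨t', (state_outside h' hb (Or.inl hk) ht').1, ht'⟩ hout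
      · exact (key hk (by omega) h' ht').symm

end simulation

/-! ### Descents are preserved -/

section descents

variable {Y : Perm ℕ} {p : ℕ}

lemma state_two_zero {x y : ℕ} {A B : List ℕ} : State Y p (A ++ x :: y :: B) A.length ↔
    (∀ u ∈ A ++ x :: y :: B, 1 ≤ u) ∧ wordProd A * (swap y (y + 1) * wordProd B) = Y ∧
      inv Y + 1 = A.length + B.length + 2 ∧ wordProd A x = Y p := by
  rw [state_append_iff]
  simp only [wordProd_cons, List.length_append, List.length_cons]
  exact and_congr_right fun _ => and_congr_right fun _ => and_congr_left fun _ => by omega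

lemma state_two_one {x y : ℕ} {A B : List ℕ} : State Y p (A ++ x :: y :: B) (A.length + 1) ↔
    (∀ u ∈ A ++ x :: y :: B, 1 ≤ u) ∧ wordProd A * (swap x (x + 1) * wordProd B) = Y ∧
      inv Y + 1 = A.length + B.length + 2 ∧ wordProd A (swap x (x + 1) y) = Y p := by
  have h := state_append_iff (y := Y) (p := p) (A := A ++ [x]) (c := y) (B := B)
  simp only [List.append_assoc, List.singleton_append, List.length_append,
    wordProd_append, wordProd_cons, wordProd_nil, mul_one, List.length_cons, List.length_nil,
    zero_add, mul_assoc, Perm.mul_apply] at h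
  rw [h]
  exact and_congr_right fun _ => and_congr_right fun _ => and_congr_left fun _ => by omega

lemma exists_eq_append_two {v : List ℕ} {i : ℕ} (h : i + 1 < v.length) :
    ∃ A B x y, A.length = i ∧ v = A ++ x :: y :: B ∧ v.getD i 0 = x ∧ v.getD (i + 1) 0 = y := by
  refine ⟨v.take i, v.drop (i + 2), v[i], v[i + 1], ?_, ?_, ?_, ?_⟩
  · simp; omega
  · rw [List.cons_getElem_drop_succ, List.cons_getElem_drop_succ, List.take_append_drop]
  · simp [show i < v.length by omega]
  · simp [h]

/-- A bump changes the order of two neighbours only if it makes them equal. Then the other one is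
the unique letter to be bumped next, which restores strict inequality in the old direction, so no
bump can stop in between. -/
theorem State.descents (hb : HasBelow Y p) {v : List ℕ} {t : ℕ} (h : State Y p v t) {i : ℕ}
    (hi : i + 1 < v.length) {b : List ℕ} (hl : LittleBump v t b) :
    b.length = v.length ∧ (v.getD i 0 < v.getD (i + 1) 0 → b.getD i 0 < b.getD (i + 1) 0) ∧
      (v.getD (i + 1) 0 < v.getD i 0 → b.getD (i + 1) 0 < b.getD i 0) := by
  induction hm : v.sum using Nat.strong_induction_on generalizing v t with
  | _ N ih =>
    subst hm
    have h2 := h.two_le hb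
    have after : ∀ {w s}, State Y p w s → w.length = v.length → w.sum ≤ v.sum →
        LittleBump w s b → (b = bump w s) ∨ ((bump w s).length = v.length ∧
        b.length = v.length ∧
        ((bump w s).getD i 0 < (bump w s).getD (i + 1) 0 → b.getD i 0 < b.getD (i + 1) 0) ∧
        ((bump w s).getD (i + 1) 0 < (bump w s).getD i 0 → b.getD (i + 1) 0 < b.getD i 0)) := by
      intro w s hw hlen hsum hlw
      rw [hw.littleBump_iff hb] at hlw
      rcases hlw with ⟨-, h3⟩ | ⟨r, hr, hlr⟩
      · exact Or.inl h3
      · have h4 := sum_bump (hw.two_le hb)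
        have h5 := ih _ (by omega) hr (by rw [length_bump]; omega) hlr rfl
        rw [length_bump] at h5 ⊢
        exact Or.inr ⟨hlen, by omega, h5.2⟩
    have hlen : b.length = v.length := by
      rcases after h rfl le_rfl hl with rfl | h'
      · simp
      · exact h'.2.1
    refine ⟨hlen, ?_⟩
    have fin : ∀ {w s}, State Y p w s → w.length = v.length → w.sum ≤ v.sum →
        LittleBump w s b →
        (v.getD i 0 < v.getD (i + 1) 0 → (bump w s).getD i 0 < (bump w s).getD (i + 1) 0) →
        (v.getD (i + 1) 0 < v.getD i 0 → (bump w s).getD (i + 1) 0 < (bump w s).getD i 0) →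
        (v.getD i 0 < v.getD (i + 1) 0 → b.getD i 0 < b.getD (i + 1) 0) ∧
        (v.getD (i + 1) 0 < v.getD i 0 → b.getD (i + 1) 0 < b.getD i 0) := by
      intro w s hw hlen hsum hlw h3 h4
      rcases after hw hlen hsum hlw with rfl | h'
      · exact ⟨h3, h4⟩
      · exact ⟨fun h5 => h'.2.2.1 (h3 h5), fun h5 => h'.2.2.2 (h4 h5)⟩
    by_cases hti : t = i ∨ t = i + 1
    swap
    · apply fin h rfl le_rfl hl
      · rw [getD_bump_ne h2 (by omega), getD_bump_ne h2 (by omega)]; exact id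
      · rw [getD_bump_ne h2 (by omega), getD_bump_ne h2 (by omega)]; exact id
    have next : ∀ {s}, State Y p (bump v t) s → LittleBump (bump v t) s b := by
      intro s hs
      rw [h.littleBump_iff hb] at hl
      rcases hl with ⟨hr, -⟩ | ⟨r, hr, hlr⟩
      · exact absurd hr (h.not_reduced_of_next hb hs).2
      · rwa [hs.unique hr]
    obtain ⟨A, B, x, y, rfl, hv, hx, hy⟩ := exists_eq_append_two hi
    have hsum := sum_bump h2
    rcases hti with rfl | rfl
    · by_cases hc : y + 1 = x
      · subst hc
        have e := bump_append (A := A) (B := y :: B) (c := y + 1) (by rw [← hx]; exact h2)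
        rw [← hv, Nat.add_sub_cancel] at e
        have s : State Y p (bump v A.length) (A.length + 1) := by
          rw [hv, state_two_zero] at h
          have h5 := h.2.2.2
          rw [e, state_two_one]
          refine ⟨?_, h.2.1, h.2.2.1, ?_⟩
          · have := h.1
            simp only [List.mem_append, List.mem_cons] at this ⊢
            rintro u (hu | rfl | rfl | hu)
            · exact this u (by simp [hu])
            · exact this u (by simp)
            · exact this u (by simp)
            · exact this u (by simp [hu])
          · rw [swap_apply_left, h5]
        have s2 := s.two_le hb
        apply fin s (by simp) hsum.le (next s)
        · rw [hx, hy]; omega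
        · rw [getD_bump s2, getD_bump_ne s2 (by omega)]
          rw [getD_bump_ne h2 (by omega)] at s2 ⊢
          rw [getD_bump h2, hx, hy] at *
          omega
      · apply fin h rfl le_rfl hl
        · rw [getD_bump h2, getD_bump_ne h2 (by omega)]; omega
        · rw [getD_bump h2, getD_bump_ne h2 (by omega)]; omega
    · by_cases hc : x + 1 = y
      · subst hc
        have e := bump_append (A := A ++ [x]) (B := B) (c := x + 1) (by rw [← hy]; exact h2)
        simp only [List.append_assoc, List.singleton_append, List.length_append, List.length_cons,
          List.length_nil, zero_add] at e
        rw [← hv, Nat.add_sub_cancel] at e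
        have s : State Y p (bump v (A.length + 1)) A.length := by
          rw [hv, state_two_one] at h
          have h5 := h.2.2.2
          rw [e, state_two_zero]
          refine ⟨?_, h.2.1, h.2.2.1, ?_⟩
          · have := h.1
            simp only [List.mem_append, List.mem_cons] at this ⊢
            rintro u (hu | rfl | rfl | hu)
            · exact this u (by simp [hu])
            · exact this u (by simp)
            · exact this u (by simp)
            · exact this u (by simp [hu])
          · rw [← h5, swap_apply_right]
        have s2 := s.two_le hb
        apply fin s (by simp) hsum.le (next s)
        · rw [getD_bump s2, getD_bump_ne s2 (by omega)]
          rw [getD_bump_ne h2 (by omega)] at s2 ⊢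
          rw [getD_bump h2, hx, hy] at *
          omega
        · rw [hx, hy]; omega
      · apply fin h rfl le_rfl hl
        · rw [getD_bump h2, getD_bump_ne h2 (by omega)]; omega
        · rw [getD_bump h2, getD_bump_ne h2 (by omega)]; omega

end descents

end BumplessEG

/-! ### Relations compatible with descents and Coxeter–Knuth moves -/

namespace BumplessEG

open Equiv

lemma not_isReduced_of_shorter {A X X' B : List ℕ} (h : wordProd X = wordProd X')
    (hl : X'.length < X.length) : ¬ IsReduced (A ++ (X ++ B)) := by
  intro hr
  have h1 := (isReduced_iff_inv.1 hr).2
  have h2 := inv_wordProd_le (A ++ (X' ++ B))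
  simp only [wordProd_append, List.length_append, h] at h1 h2
  omega

lemma IsReduced.ne {A B : List ℕ} {x y : ℕ} (h : IsReduced (A ++ x :: y :: B)) : x ≠ y := by
  rintro rfl
  refine not_isReduced_of_shorter (A := A) (X := [x, x]) (X' := []) (B := B) ?_ (by simp) h
  simp

lemma IsReduced.not_far {A B : List ℕ} {x y : ℕ} (h : IsReduced (A ++ x :: y :: x :: B)) :
    y = x + 1 ∨ x = y + 1 := by
  by_contra hn
  have hne := h.ne
  refine not_isReduced_of_shorter (A := A) (X := [x, y, x]) (X' := [y]) (B := B) ?_ (by simp) h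
  simp only [wordProd_cons, wordProd_nil, mul_one]
  ext k
  simp only [Perm.mul_apply, swap_apply_def]
  split_ifs <;> omega

lemma IsReduced.getD_ne {v : List ℕ} (h : IsReduced v) {i : ℕ} (hi : i + 1 < v.length) :
    v.getD i 0 ≠ v.getD (i + 1) 0 := by
  obtain ⟨A, B, x, y, -, rfl, h1, h2⟩ := exists_eq_append_two hi
  rw [h1, h2]
  exact h.ne

lemma CK.unique {i : ℕ} {v v₁ v₂ : List ℕ} (h₁ : CK i v v₁) (h₂ : CK i v v₂) : v₁ = v₂ := by
  obtain ⟨A, B, x, y, z, x', y', z', rfl, rfl, rfl, hk⟩ := h₁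
  obtain ⟨A', B', a, b, c, a', b', c', hA, hv, rfl, hk'⟩ := h₂
  obtain ⟨rfl, h⟩ := List.append_inj hv hA.symm
  simp only [List.cons.injEq] at h
  obtain ⟨rfl, rfl, rfl, rfl⟩ := h
  suffices x' = a' ∧ y' = b' ∧ z' = c' by rw [this.1, this.2.1, this.2.2]
  rcases hk with hk | hk <;> rcases hk' with hk' | hk' <;> cases hk <;> cases hk' <;> omega

lemma exists_eq_append_three {v : List ℕ} {i : ℕ} (h : i + 2 < v.length) :
    ∃ A B x y z, A.length = i ∧ v = A ++ x :: y :: z :: B ∧ v.getD i 0 = x ∧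
      v.getD (i + 1) 0 = y ∧ v.getD (i + 2) 0 = z := by
  refine ⟨v.take i, v.drop (i + 3), v[i], v[i + 1], v[i + 2], ?_, ?_, ?_, ?_, ?_⟩
  · simp; omega
  · rw [List.cons_getElem_drop_succ, List.cons_getElem_drop_succ, List.cons_getElem_drop_succ,
      List.take_append_drop]
  · simp [show i < v.length by omega]
  · simp [show i + 1 < v.length by omega]
  · simp [h]

/-- With `CK.not_monotone`, this says that in a reduced word the descents alone decide where a move
is possible; by `CK.unique` its result is then determined. -/
lemma IsReduced.exists_ck {v : List ℕ} (h : IsReduced v) {i : ℕ} (hi : i + 2 < v.length)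
    (hn : ¬ (v.getD i 0 < v.getD (i + 1) 0 ↔ v.getD (i + 1) 0 < v.getD (i + 2) 0)) :
    ∃ v', CK i v v' := by
  obtain ⟨A, B, x, y, z, rfl, rfl, h1, h2, h3⟩ := exists_eq_append_three hi
  rw [h1, h2, h3] at hn
  have hxy := h.ne
  have hyz : y ≠ z := by
    have h' : IsReduced ((A ++ [x]) ++ y :: z :: B) := by simpa using h
    exact h'.ne
  by_cases hxz : x = z
  · subst hxz
    rcases h.not_far with rfl | rfl
    · exact ⟨_, CK.of_knuth (.braid x)⟩
    · exact ⟨_, (CK.of_knuth (.braid y)).symm⟩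
  by_cases hlt : x < y
  · by_cases hxz' : x < z
    · exact ⟨_, CK.of_knuth (.acb hxz' (by omega))⟩
    · exact ⟨_, (CK.of_knuth (x := x) (y := z) (z := y) (.bac (by omega) hlt)).symm⟩
  · by_cases hxz' : x < z
    · exact ⟨_, CK.of_knuth (.bac (by omega) hxz')⟩
    · exact ⟨_, (CK.of_knuth (x := y) (y := x) (z := z) (.acb (by omega) (by omega))).symm⟩

lemma CK.not_monotone {i : ℕ} {v v' : List ℕ} (h : CK i v v') : i + 2 < v.length ∧
    ¬ (v.getD i 0 < v.getD (i + 1) 0 ↔ v.getD (i + 1) 0 < v.getD (i + 2) 0) := by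
  obtain ⟨A, B, x, y, z, x', y', z', rfl, rfl, rfl, hk⟩ := h
  refine ⟨by simp, ?_⟩
  have h1 : (A ++ x :: y :: z :: B).getD A.length 0 = x := by simp
  have h2 : (A ++ x :: y :: z :: B).getD (A.length + 1) 0 = y := by simp
  have h3 : (A ++ x :: y :: z :: B).getD (A.length + 2) 0 = z := by simp
  rw [h1, h2, h3]
  rcases hk with hk | hk <;> cases hk <;> omega

/-- A relation between reduced words which is compatible with descents and Coxeter–Knuth moves. -/
structure IsBisim (E : List ℕ → List ℕ → Prop) : Prop where
  left {a b} : E a b → IsReduced a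
  right {a b} : E a b → IsReduced b
  length {a b} : E a b → b.length = a.length
  desc {a b} : E a b → ∀ i, i + 1 < a.length →
    (a.getD i 0 < a.getD (i + 1) 0 ↔ b.getD i 0 < b.getD (i + 1) 0)
  ck {a b a' i} : E a b → CK i a a' → ∃ b', CK i b b' ∧ E a' b'

lemma IsBisim.flip {E : List ℕ → List ℕ → Prop} (h : IsBisim E) : IsBisim fun b a => E a b := by
  refine ⟨h.right, h.left, fun h' => (h.length h').symm, fun h' i hi => ?_, ?_⟩
  · rw [h.length h'] at hi
    exact (h.desc h' i hi).symm
  · intro b a b' i he hck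
    obtain ⟨h1, h2⟩ := hck.not_monotone
    rw [h.length he] at h1
    rw [← h.desc he i (by omega), ← h.desc he (i + 1) (by omega)] at h2
    -- Equal descents provide a move of `a` at `i`; it is matched by a move of `b` at `i`, which can
    -- only be the given one.
    obtain ⟨a', ha'⟩ := (h.left he).exists_ck h1 h2
    obtain ⟨b'', hb, he'⟩ := h.ck he ha'
    rw [hck.unique hb]
    exact ⟨a', ha', he'⟩

lemma LittleBump.length_eq {a b : List ℕ} {t : ℕ} (h : LittleBump a t b) :
    b.length = a.length := by
  induction h with
  | done => simp
  | step _ _ _ _ _ ih => simpa using ih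

/-- The Little map is compatible with descents and Coxeter–Knuth moves. -/
theorem isBisim_littleMap {u : Perm ℕ} {p q : ℕ} (hb : HasBelow (u * swap p q) p) :
    IsBisim fun a b => IsReducedWord u a ∧ LittleMap p (u q) a b := by
  have spec : ∀ {a b}, IsReducedWord u a ∧ LittleMap p (u q) a b → IsReduced b := by
    rintro a b ⟨ha, h⟩
    obtain ⟨-, -, t, hs, hl⟩ := h.state ha
    obtain ⟨⟨i, -, hw⟩, -⟩ := hs.littleBump_spec hb b hl
    exact hw.1
  have len : ∀ {a b}, IsReducedWord u a ∧ LittleMap p (u q) a b → b.length = a.length := by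
    rintro a b ⟨ha, h⟩
    obtain ⟨-, -, t, -, hl⟩ := h.state ha
    exact hl.length_eq
  refine ⟨fun h => h.1.1, spec, len, ?_, ?_⟩
  · intro a b hab i hi
    have hbr := spec hab
    have hlen := len hab
    obtain ⟨ha, h⟩ := hab
    obtain ⟨-, -, t, hs, hl⟩ := h.state ha
    obtain ⟨-, h1, h2⟩ := hs.descents hb hi hl
    have h3 := ha.1.getD_ne hi
    refine ⟨h1, fun h4 => ?_⟩
    by_contra h5
    have := h2 (by omega)
    omega
  · rintro a b a' i ⟨ha, h⟩ hck
    obtain ⟨hpq, hc, t, hs, hl⟩ := h.state ha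
    obtain ⟨t₁, t', b₁, b', h1, h2, h3, h4, h5⟩ := simulates_of_ck hb hck ⟨t, hs⟩
    obtain rfl := hs.unique h1
    obtain rfl := hs.littleBump_unique hb _ _ hl h3
    have ha' := hck.isReducedWord ha
    exact ⟨b', h5, ha', LittleMap.of_littleBump ha' hpq hc h2 h4⟩

/-- A sequence of Coxeter–Knuth moves at given positions. -/
inductive CKSeq : List ℕ → List ℕ → List ℕ → Prop
  | nil (a : List ℕ) : CKSeq [] a a
  | cons {i : ℕ} {l a b c : List ℕ} : CK i a b → CKSeq l b c → CKSeq (i :: l) a c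

lemma CKSeq.append {l l' a b c : List ℕ} (h : CKSeq l a b) (h' : CKSeq l' b c) :
    CKSeq (l ++ l') a c := by
  induction h with
  | nil => exact h'
  | cons h1 _ ih => exact .cons h1 (ih h')

lemma CK.seq {i : ℕ} {a b : List ℕ} (h : CK i a b) : CKSeq [i] a b := .cons h (.nil b)

lemma IsBisim.seq {E : List ℕ → List ℕ → Prop} (hE : IsBisim E) {l a b a' b' : List ℕ}
    (h : E a b) (ha : CKSeq l a a') (hb : CKSeq l b b') : E a' b' := by
  induction ha generalizing b with
  | nil => cases hb; exact h
  | cons h1 _ ih =>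
    cases hb with
    | cons h2 h3 =>
      obtain ⟨b₁, h4, h5⟩ := hE.ck h h1
      rw [h4.unique h2] at h5
      exact ih h5 h3

/-- The positions `o + k - 1, …, o`. -/
def downFrom (o : ℕ) : ℕ → List ℕ
  | 0 => []
  | k + 1 => (o + k) :: downFrom o k

lemma downFrom_append (o k l : ℕ) : downFrom (o + k) l ++ downFrom o k = downFrom o (k + l) := by
  induction l with
  | zero => rfl
  | succ l ih =>
    rw [downFrom, List.cons_append, ih, ← add_assoc k l 1, downFrom, add_assoc]

/-- A large letter moves to the left. -/
lemma ckSeq_move_left {X c S : List ℕ} {f e : ℕ} (hc : (c ++ [e]).Pairwise (· < ·))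
    (hef : e < f) :
    CKSeq (downFrom X.length c.length) (X ++ c ++ f :: e :: S) (X ++ f :: c ++ e :: S) := by
  induction c using List.reverseRecOn generalizing e S with
  | nil => simpa [downFrom] using CKSeq.nil _
  | append_singleton c g ih =>
    have hge : g < e := by
      rw [List.pairwise_append] at hc
      exact hc.2.2 g (by simp) e (by simp)
    have hc' : (c ++ [g]).Pairwise (· < ·) := (List.pairwise_append.1 hc).1
    rw [List.length_append, List.length_singleton, downFrom]
    refine .cons (b := X ++ c ++ f :: g :: e :: S) ?_ ?_
    · have := CK.of_knuth (A := X ++ c) (B := S) (Knuth.acb hge hef)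
      simpa using this
    · have := ih (S := e :: S) hc' (by omega)
      simpa using this

/-- A small letter moves to the left. -/
lemma ckSeq_insert_large {X C S : List ℕ} {c z : ℕ} (hc : (c :: C).Pairwise (· < ·))
    (hz : z < c) : CKSeq (downFrom X.length C.length) (X ++ c :: C ++ z :: S)
      (X ++ c :: z :: C ++ S) := by
  induction C generalizing X c with
  | nil => simpa [downFrom] using CKSeq.nil _
  | cons e C ih =>
    rw [List.pairwise_cons] at hc
    have hce := hc.1 e (by simp)
    have h1 := ih (X := X ++ [c]) hc.2 (by omega)
    have h2 := CK.of_knuth (A := X) (B := C ++ S) (Knuth.bac hz hce)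
    have h3 := downFrom_append X.length 1 C.length
    rw [List.length_cons, add_comm C.length 1, ← h3]
    refine CKSeq.append (b := X ++ c :: e :: z :: C ++ S) ?_ ?_
    · simpa using h1
    · simpa [downFrom] using h2.symm.seq

/-- The letter `z` takes the place of `c`, the first entry of the run exceeding it, and `c` travels
to the front. The positions of the moves depend only on lengths, so the same moves can be performed
on a related word. -/
lemma ckSeq_insert {X D C S : List ℕ} {c z : ℕ} (hr : (D ++ c :: C).Pairwise (· < ·))
    (hD : ∀ x ∈ D, x < z) (hz : z < c) :
    CKSeq (downFrom X.length (D.length + C.length)) (X ++ (D ++ c :: C) ++ z :: S)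
      (X ++ c :: (D ++ z :: C) ++ S) := by
  rw [List.pairwise_append] at hr
  have h1 := ckSeq_insert_large (X := X ++ D) (S := S) hr.2.1 hz
  have h2 := ckSeq_move_left (X := X) (c := D) (f := c) (e := z) (S := C ++ S)
    (by rw [List.pairwise_append]; exact ⟨hr.1, by simp, by simpa using hD⟩) hz
  rw [← downFrom_append]
  refine CKSeq.append (b := X ++ D ++ c :: z :: C ++ S) ?_ ?_
  · simpa using h1
  · simpa using h2

/-- The moves of `ckSeq_insert` on a run about which less is known. Going left, `z` passes the
larger entries until it finds its place and an entry leaves for the front. The index `j` marks that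
place; `c'.getD j 0` is `z` itself, except when `z` already occurs in the run, where a braid
relation puts `z + 1` there. That exception explains the bound `z + 1`. -/
lemma exists_ckSeq_insert {X c S : List ℕ} {f z : ℕ} (hc : (c ++ [f]).Pairwise (· < ·))
    (hz : z < f) (hred : IsReduced (X ++ c ++ f :: z :: S)) :
    ∃ y c', CKSeq (downFrom X.length c.length) (X ++ c ++ f :: z :: S) (X ++ y :: c' ++ S) ∧
      c'.length = c.length + 1 ∧ c'.Pairwise (· < ·) ∧
      (∀ k, k ≤ c.length → c'.getD k 0 ≤ (c ++ [f]).getD k 0) ∧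
      ∃ j, j ≤ c.length ∧ z < (c ++ [f]).getD j 0 ∧ c'.getD j 0 ≤ z + 1 := by
  induction c using List.reverseRecOn generalizing f S with
  | nil =>
    refine ⟨f, [z], by simpa [downFrom] using CKSeq.nil _, rfl, by simp, ?_, 0, le_rfl, ?_, ?_⟩
    · intro k hk
      obtain rfl : k = 0 := by simpa using hk
      simpa using hz.le
    · simpa using hz
    · simp
  | append_singleton c e ih =>
    have hef : e < f := by
      rw [List.pairwise_append] at hc
      exact hc.2.2 e (by simp) f (by simp)
    have hc' : (c ++ [e]).Pairwise (· < ·) := (List.pairwise_append.1 hc).1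
    have elast : (c ++ [e] ++ [f]).getD (c ++ [e]).length 0 = f := by simp
    rw [List.length_append, List.length_singleton, downFrom]
    rcases lt_trichotomy z e with h | rfl | h
    · have hck : CK (X.length + c.length) (X ++ (c ++ [e]) ++ f :: z :: S)
          (X ++ c ++ e :: z :: f :: S) := by
        have := (CK.of_knuth (A := X ++ c) (B := S) (Knuth.bac h hef)).symm
        simpa using this
      obtain ⟨y, c', h1, h2, h3, h4, j, h5, h6, h7⟩ := ih (S := f :: S) hc' h (hck.isReduced hred)
      have hle : ∀ k, k ≤ c.length → (c' ++ [f]).getD k 0 = c'.getD k 0 := fun k hk => by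
        rw [List.getD_append _ _ _ _ (by omega)]
      have hle' : ∀ k, k ≤ c.length → (c ++ [e] ++ [f]).getD k 0 = (c ++ [e]).getD k 0 :=
        fun k hk => by rw [List.getD_append _ _ _ _ (by simp; omega)]
      refine ⟨y, c' ++ [f], .cons hck (by simpa using h1), by simp [h2], ?_, ?_, j, by omega, ?_, ?_⟩
      · rw [List.pairwise_append]
        refine ⟨h3, by simp, ?_⟩
        intro a ha b hb
        obtain rfl : b = f := by simpa using hb
        obtain ⟨k, hk, rfl⟩ := List.getElem_of_mem ha
        have h8 := h4 k (by omega)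
        rw [List.getD_eq_getElem _ _ hk, List.getD_eq_getElem _ _ (by simp; omega)] at h8
        have h9 : (c ++ [e])[k]'(by simp; omega) ∈ c ++ [e] := List.getElem_mem _
        rw [List.pairwise_append] at hc
        exact lt_of_le_of_lt h8 (hc.2.2 _ h9 b (by simp))
      · intro k hk
        rcases Nat.lt_or_ge c.length k with hk' | hk'
        · obtain rfl : k = c.length + 1 := by omega
          rw [← h2]
          simp [h2]
        · rw [hle k hk', hle' k hk']
          exact h4 k hk'
      · rw [hle' j h5]; exact h6
      · rw [hle j h5]; exact h7
    -- In a reduced word `z f z` forces `f` and `z` to be neighbours.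
    · have hf : f = z + 1 := by
        have h' : IsReduced ((X ++ c) ++ z :: f :: z :: S) := by simpa using hred
        have := h'.not_far
        omega
      subst hf
      have hck : CK (X.length + c.length) (X ++ (c ++ [z]) ++ (z + 1) :: z :: S)
          (X ++ c ++ (z + 1) :: z :: (z + 1) :: S) := by
        have := CK.of_knuth (A := X ++ c) (B := S) (Knuth.braid z)
        simpa using this
      have h1 := ckSeq_move_left (X := X) (S := (z + 1) :: S) hc' hef
      refine ⟨z + 1, c ++ [z] ++ [z + 1], .cons hck (by simpa using h1), by simp, hc,
        fun k _ => le_rfl, c.length + 1, le_rfl, ?_, ?_⟩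
      · rw [show c.length + 1 = (c ++ [z]).length by simp, elast]; omega
      · rw [show c.length + 1 = (c ++ [z]).length by simp, elast]
    · have hck : CK (X.length + c.length) (X ++ (c ++ [e]) ++ f :: z :: S)
          (X ++ c ++ f :: e :: z :: S) := by
        have := CK.of_knuth (A := X ++ c) (B := S) (Knuth.acb h hz)
        simpa using this
      have h1 := ckSeq_move_left (X := X) (S := z :: S) hc' hef
      have elast' : (c ++ [e] ++ [z]).getD (c ++ [e]).length 0 = z := by simp
      refine ⟨f, c ++ [e] ++ [z], .cons hck (by simpa using h1), by simp, ?_, ?_,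
        c.length + 1, le_rfl, ?_, ?_⟩
      · rw [List.pairwise_append] at hc ⊢
        refine ⟨hc.1, by simp, ?_⟩
        intro a ha b hb
        obtain rfl : b = z := by simpa using hb
        rcases List.mem_append.1 ha with ha | ha
        · rw [List.pairwise_append] at hc'
          have := hc'.2.2 a ha e (by simp)
          omega
        · obtain rfl : a = e := by simpa using ha
          exact h
      · intro k hk
        rcases Nat.lt_or_ge c.length k with hk' | hk'
        · obtain rfl : k = (c ++ [e]).length := by simp; omega
          rw [elast, elast']; exact hz.le
        · rw [List.getD_append (c ++ [e]) [z] 0 k (by simp; omega),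
            List.getD_append (c ++ [e]) [f] 0 k (by simp; omega)]
      · rw [show c.length + 1 = (c ++ [e]).length by simp, elast]; omega
      · rw [show c.length + 1 = (c ++ [e]).length by simp, elast']; omega

lemma getD_append_two (X S : List ℕ) (x y : ℕ) :
    (X ++ x :: y :: S).getD X.length 0 = x ∧ (X ++ x :: y :: S).getD (X.length + 1) 0 = y := by
  constructor
  · simp
  · simp

/-- Here `D ++ C` and `d` come from two adjacent columns, `D` collecting the letters of the left
column already inserted. Inserting the first letter of `d` into `D ++ C` and performing the same
moves on the related word reduces `m` by one. As inserting never enlarges an entry of the related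
run, the inequalities for the remaining letters carry over; the one for the first letter has to be
recovered from the place `j` where it was inserted. -/
lemma IsBisim.lt_of_rect {E : List ℕ → List ℕ → Prop} (hE : IsBisim E) (m : ℕ) :
    ∀ {X D C d S X' r' d' S' : List ℕ}, E (X ++ (D ++ C) ++ (d ++ S)) (X' ++ r' ++ (d' ++ S')) →
    X'.length = X.length → r'.length = D.length + m → C.length = m → d.length = m →
    d'.length = m → (D ++ C).Pairwise (· < ·) → d.Pairwise (· < ·) →
    r'.Pairwise (· < ·) → d'.Pairwise (· < ·) → (∀ i < m, d.getD i 0 < C.getD i 0) →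
    (∀ x ∈ D, ∀ z ∈ d, x < z) → ∀ i < m, d'.getD i 0 < r'.getD (D.length + i) 0 := by
  induction m with
  | zero => intros; omega
  | succ m ih =>
    intro X D C d S X' r' d' S' h hX hr hC hd hd' sr sd sr' sd' hlt hD
    obtain ⟨c, C, rfl⟩ := List.exists_cons_of_length_eq_add_one hC
    obtain ⟨z, d, rfl⟩ := List.exists_cons_of_length_eq_add_one hd
    obtain ⟨z', d', rfl⟩ := List.exists_cons_of_length_eq_add_one hd'
    simp only [List.length_cons, Nat.add_right_cancel_iff] at hC hd hd'
    have hzc : z < c := by simpa using hlt 0 (by omega)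
    obtain ⟨r, f, rfl⟩ : ∃ r f, r' = r ++ [f] :=
      (List.eq_nil_or_concat' r').resolve_left (by rintro rfl; simp at hr)
    have hr : r.length = D.length + m := by simpa [← add_assoc] using hr
    obtain ⟨ρ, g, hρ⟩ : ∃ ρ g, D ++ c :: C = ρ ++ [g] :=
      (List.eq_nil_or_concat' _).resolve_left (by simp)
    have hρl : ρ.length = D.length + m := by
      have := congrArg List.length hρ
      simp at this; omega
    have hzg : z < g := by
      have hg : g ∈ c :: C := by
        have h1 : (D ++ c :: C).getLast (by simp) = g := by simp [hρ]
        rw [List.getLast_append_of_ne_nil _ (by simp)] at h1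
        rw [← h1]; exact List.getLast_mem _
      rcases List.mem_cons.1 hg with rfl | hg
      · exact hzc
      · rw [List.pairwise_append, List.pairwise_cons] at sr
        have := sr.2.1.1 g hg
        omega
    -- The descent between the run and `z` in the first word is also one in the related word.
    have hfz : z' < f := by
      have h1 := hE.desc h (X.length + D.length + m)
        (by simp; omega)
      have e1 := getD_append_two (X ++ ρ) (d ++ S) g z
      have e2 := getD_append_two (X' ++ r) (d' ++ S') f z'
      have k1 : X ++ (D ++ c :: C) ++ (z :: d ++ S) = X ++ ρ ++ g :: z :: (d ++ S) := by
        rw [hρ]; simp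
      have k2 : X' ++ (r ++ [f]) ++ (z' :: d' ++ S') = X' ++ r ++ f :: z' :: (d' ++ S') := by simp
      rw [show (X ++ ρ).length = X.length + D.length + m by simp; omega] at e1
      rw [show (X' ++ r).length = X.length + D.length + m by simp; omega] at e2
      rw [k1, k2, e1.1, e1.2, e2.1, e2.2] at h1
      have hb := hE.right h
      rw [k2] at hb
      have := hb.ne
      omega
    have hb : IsReduced (X' ++ r ++ f :: z' :: (d' ++ S')) := by
      have := hE.right h
      simpa using this
    obtain ⟨y, r'', h1, h2, h3, h4, j, h5, h6, h7⟩ := exists_ckSeq_insert sr' hfz hb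
    have h8 := ckSeq_insert (X := X) (S := d ++ S) sr (fun x hx => hD x hx z (by simp)) hzc
    rw [hX, hr, ← hC] at h1
    have h9 : E (X ++ c :: (D ++ z :: C) ++ (d ++ S)) (X' ++ y :: r'' ++ (d' ++ S')) :=
      hE.seq (by simpa using h) (by simpa using h8) (by simpa using h1)
    rw [List.pairwise_append, List.pairwise_cons] at sr
    rw [List.pairwise_cons] at sd sd'
    have h10 := ih (X := X ++ [c]) (D := D ++ [z]) (C := C) (d := d) (S := S) (X' := X' ++ [y])
      (r' := r'') (d' := d') (S' := S') (by simpa using h9) (by simp [hX]) (by simp; omega) hC hd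
      hd' (by
        simp only [List.append_assoc, List.singleton_append, List.pairwise_append,
          List.pairwise_cons]
        refine ⟨sr.1, ⟨fun a ha => ?_, sr.2.1.2⟩, fun a ha b hb => ?_⟩
        · have := sr.2.1.1 a ha; omega
        · rcases List.mem_cons.1 hb with rfl | hb
          · exact hD a ha b (by simp)
          · exact sr.2.2 a ha b (by simp [hb])) sd.2 h3 sd'.2
      (fun i hi => by simpa using hlt (i + 1) (by omega))
      (by
        intro x hx w hw
        rcases List.mem_append.1 hx with hx | hx
        · exact hD x hx w (by simp [hw])
        · obtain rfl : x = z := by simpa using hx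
          exact sd.1 w hw)
    simp only [List.length_append, List.length_singleton] at h10
    intro i hi
    rcases Nat.eq_zero_or_pos i with rfl | hi0
    -- If the first letter `z'` were at least the entry at `D.length`, it would be inserted at some
    -- `j > D.length`. A later letter of `d'` would then be smaller than the entry `≤ z' + 1` found
    -- there, although it exceeds `z'`.
    · by_contra hle
      simp only [List.getD_cons_zero, add_zero, not_lt] at hle
      have mono : ∀ {k l}, k < l → l < (r ++ [f]).length →
          (r ++ [f]).getD k 0 < (r ++ [f]).getD l 0 := fun {k l} hkl hl => by
        rw [List.getD_eq_getElem _ _ (by omega), List.getD_eq_getElem _ _ hl]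
        exact List.pairwise_iff_getElem.1 sr' k l (by omega) hl hkl
      have hjD : D.length < j := by
        by_contra hj
        rcases Nat.lt_or_ge j D.length with hj' | hj'
        · have := mono hj' (by simp; omega)
          omega
        · obtain rfl : j = D.length := by omega
          omega
      have h11 := h10 (j - D.length - 1) (by omega)
      rw [show D.length + 1 + (j - D.length - 1) = j by omega] at h11
      have h12 := sd'.1 (d'.getD (j - D.length - 1) 0) (by
        rw [List.getD_eq_getElem _ _ (by omega)]; exact List.getElem_mem _)
      omega
    · obtain ⟨k, rfl⟩ : ∃ k, i = k + 1 := ⟨i - 1, by omega⟩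
      have h11 := h10 k (by omega)
      have h12 := h4 (D.length + 1 + k) (by omega)
      rw [List.getD_cons_succ, show D.length + (k + 1) = D.length + 1 + k by omega]
      omega

end BumplessEG

namespace BumplessEG

open Equiv

/-! ### Column words -/

/-- The first `k` entries of column `j` of a filling. -/
def colBlock (f : ℕ → ℕ → ℕ) (k j : ℕ) : List ℕ := (List.range k).map fun i => f i j

/-- The first `m` columns of a filling, read from right to left, where `h` gives their lengths. -/
def colWord (h : ℕ → ℕ) (f : ℕ → ℕ → ℕ) (m : ℕ) : List ℕ :=
  (List.range m).reverse.flatMap fun j => colBlock f (h j) j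

lemma IncreasingTableau.column_eq (T : IncreasingTableau) :
    T.column = colWord T.shape.colLen T.entry (T.shape.rowLen 0) := rfl

@[simp] lemma length_colBlock (f : ℕ → ℕ → ℕ) (k j : ℕ) : (colBlock f k j).length = k := by
  simp [colBlock]

lemma getD_colBlock (f : ℕ → ℕ → ℕ) {k i : ℕ} (j : ℕ) (h : i < k) :
    (colBlock f k j).getD i 0 = f i j := by
  simp [colBlock, h]

lemma colBlock_congr {f g : ℕ → ℕ → ℕ} {k j : ℕ} (h : ∀ i < k, f i j = g i j) :
    colBlock f k j = colBlock g k j :=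
  List.map_congr_left fun i hi => h i (List.mem_range.1 hi)

@[simp] lemma colWord_zero (h : ℕ → ℕ) (f : ℕ → ℕ → ℕ) : colWord h f 0 = [] := rfl

lemma colWord_succ (h : ℕ → ℕ) (f : ℕ → ℕ → ℕ) (m : ℕ) :
    colWord h f (m + 1) = colBlock f (h m) m ++ colWord h f m := by
  simp [colWord, List.range_succ]

lemma colWord_congr {h : ℕ → ℕ} {f g : ℕ → ℕ → ℕ} {m : ℕ}
    (H : ∀ j < m, ∀ i < h j, f i j = g i j) : colWord h f m = colWord h g m := by
  induction m with
  | zero => rfl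
  | succ m ih =>
    rw [colWord_succ, colWord_succ, ih fun j hj => H j (by omega), colBlock_congr (H m (by omega))]

lemma length_colWord_eq (h : ℕ → ℕ) (f g : ℕ → ℕ → ℕ) (m : ℕ) :
    (colWord h f m).length = (colWord h g m).length := by
  induction m with
  | zero => rfl
  | succ m ih => simp [colWord_succ, ih]

lemma exists_colWord (h : ℕ → ℕ) (f : ℕ → ℕ → ℕ) (m : ℕ) {b : List ℕ}
    (hb : b.length = (colWord h f m).length) : ∃ g, colWord h g m = b := by
  induction m generalizing b with
  | zero => exact ⟨f, by simpa [eq_comm] using hb⟩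
  | succ m ih =>
    rw [colWord_succ, List.length_append, length_colBlock] at hb
    obtain ⟨g, hg⟩ := ih (b := b.drop (h m)) (by simp [hb])
    refine ⟨fun i j => if j = m then b.getD i 0 else g i j, ?_⟩
    rw [colWord_succ, colWord_congr (g := g), hg]
    · conv_rhs => rw [← List.take_append_drop (h m) b]
      congr 1
      apply List.ext_getElem
      · simp; omega
      · intro i h1 h2
        simp only [List.length_take] at h2
        simp [colBlock, show i < b.length by omega]
    · intro j hj i _
      simp [hj.ne]

lemma exists_colWord_eq_append (h : ℕ → ℕ) (f : ℕ → ℕ → ℕ) {j m : ℕ} (hj : j < m) :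
    ∃ X, colWord h f m = X ++ colBlock f (h j) j ++ colWord h f j := by
  induction m, hj using Nat.le_induction with
  | base => exact ⟨[], by simp [colWord_succ]⟩
  | succ m _ ih =>
    obtain ⟨X, hX⟩ := ih
    exact ⟨colBlock f (h m) m ++ X, by simp [colWord_succ, hX]⟩

lemma IsBisim.pairwise {E : List ℕ → List ℕ → Prop} (hE : IsBisim E) {X r S X' r' S' : List ℕ}
    (h : E (X ++ r ++ S) (X' ++ r' ++ S')) (hX : X'.length = X.length)
    (hr : r'.length = r.length) (hp : r.Pairwise (· < ·)) : r'.Pairwise (· < ·) := by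
  rw [← List.isChain_iff_pairwise, List.isChain_iff_getElem] at hp ⊢
  intro i hi
  have h1 := hE.desc h (X.length + i) (by simp; omega)
  have h2 := hp i (by omega)
  have key : ∀ {X r S : List ℕ} (i : ℕ) (hi : i < r.length),
      (X ++ r ++ S).getD (X.length + i) 0 = r[i] := by
    intro X r S i hi
    rw [List.append_assoc, List.getD_append_right _ _ _ _ (by omega), Nat.add_sub_cancel_left,
      List.getD_append _ _ _ _ hi, List.getD_eq_getElem _ _ hi]
  rw [key i (by omega), add_assoc, key (i + 1) (by omega), ← hX, key i (by omega),
    key (i + 1) hi] at h1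
  exact h1.1 h2

lemma pairwise_colBlock {f : ℕ → ℕ → ℕ} {k j : ℕ}
    (h : ∀ i₁ i₂, i₁ < i₂ → i₂ < k → f i₁ j < f i₂ j) : (colBlock f k j).Pairwise (· < ·) := by
  rw [List.pairwise_iff_getElem]
  intro i₁ i₂ h1 h2 hlt
  simpa [colBlock] using h i₁ i₂ hlt (by simpa using h2)

/-- A relation compatible with descents and Coxeter–Knuth moves maps column reading words of
tableaux to column reading words of tableaux of the same shape. -/
theorem IsBisim.exists_tableau {E : List ℕ → List ℕ → Prop} (hE : IsBisim E)
    (T : IncreasingTableau) {b : List ℕ} (h : E T.column b) :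
    ∃ T' : IncreasingTableau, T'.shape = T.shape ∧ T'.column = b := by
  obtain ⟨g, rfl⟩ := exists_colWord _ _ _ (hE.length h)
  rw [T.column_eq] at h
  set H := T.shape.colLen with hH
  set m := T.shape.rowLen 0 with hm
  have hcol : ∀ j i₁ i₂, i₁ < i₂ → i₂ < H j → T.entry i₁ j < T.entry i₂ j := fun j i₁ i₂ h1 h2 =>
    T.col_strict i₁ i₂ j h1 (YoungDiagram.mem_iff_lt_colLen.2 h2)
  have hanti : ∀ j, H (j + 1) ≤ H j := fun j => T.shape.colLen_anti j (j + 1) (by omega)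
  have hmem : ∀ {i j}, (i, j) ∈ T.shape ↔ i < H j := YoungDiagram.mem_iff_lt_colLen
  have hlt : ∀ {i j}, (i, j) ∈ T.shape → j < m := fun {i j} hij =>
    YoungDiagram.mem_iff_lt_rowLen.1 (T.shape.up_left_mem (Nat.zero_le i) le_rfl hij)
  have sorted : ∀ j < m, (colBlock g (H j) j).Pairwise (· < ·) := by
    intro j hj
    obtain ⟨X, hX⟩ := exists_colWord_eq_append H T.entry hj
    obtain ⟨X', hX'⟩ := exists_colWord_eq_append H g hj
    have hl := congrArg List.length hX
    have hl' := congrArg List.length hX'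
    have h1 := length_colWord_eq H T.entry g m
    have h2 := length_colWord_eq H T.entry g j
    simp only [List.length_append, length_colBlock] at hl hl'
    rw [hX, hX'] at h
    exact hE.pairwise h (by omega) (by simp) (pairwise_colBlock (hcol j))
  have gcol : ∀ i₁ i₂ j, i₁ < i₂ → (i₂, j) ∈ T.shape → g i₁ j < g i₂ j := by
    intro i₁ i₂ j h1 h2
    have h3 := List.pairwise_iff_getElem.1 (sorted j (hlt h2)) i₁ i₂
      (by simpa using h1.trans (hmem.1 h2)) (by simpa using hmem.1 h2) h1
    simpa [colBlock] using h3
  have grow : ∀ i j, (i, j + 1) ∈ T.shape → g i j < g i (j + 1) := by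
    intro i j hij
    have hj := hlt hij
    obtain ⟨X, hX⟩ := exists_colWord_eq_append H T.entry hj
    obtain ⟨X', hX'⟩ := exists_colWord_eq_append H g hj
    have hl := congrArg List.length hX
    have hl' := congrArg List.length hX'
    have h1 := length_colWord_eq H T.entry g m
    have h2 := length_colWord_eq H T.entry g (j + 1)
    simp only [List.length_append, length_colBlock] at hl hl'
    rw [hX, hX', colWord_succ, colWord_succ,
      ← List.take_append_drop (H (j + 1)) (colBlock T.entry (H j) j),
      ← List.take_append_drop (H (j + 1)) (colBlock g (H j) j), List.append_assoc (List.take _ _),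
      List.append_assoc (List.take _ _)] at h
    have hi := hmem.1 hij
    have h3 := hanti j
    have take : ∀ (f : ℕ → ℕ → ℕ) i, i < H (j + 1) →
        ((colBlock f (H j) j).take (H (j + 1))).getD i 0 = f i j := by
      intro f i hi
      rw [List.getD_eq_getElem _ _ (by simp; omega)]
      simp [colBlock]
    -- Only the part of column `j` that has neighbours in column `j + 1` is compared; the lower part
    -- of column `j` is absorbed into the suffix.
    have key := hE.lt_of_rect (H (j + 1)) (D := []) h (by omega) (by simp) (by simp)
      (by simpa using h3) (by simpa using h3) (pairwise_colBlock (hcol (j + 1)))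
      ((pairwise_colBlock (hcol j)).sublist (List.take_sublist _ _)) (sorted _ hj)
      ((sorted j (by omega)).sublist (List.take_sublist _ _))
      (fun i hi => by
        rw [take _ i hi]
        change _ < (colBlock T.entry (H (j + 1)) (j + 1)).getD i 0
        rw [getD_colBlock _ _ hi]
        exact T.row_strict i j (j + 1) (by omega) (hmem.2 hi)) (by simp) i hi
    rw [take _ i hi, List.length_nil, zero_add, getD_colBlock _ _ hi] at key
    exact key
  have grow' : ∀ i j₁ j₂, j₁ < j₂ → (i, j₂) ∈ T.shape → g i j₁ < g i j₂ := by
    intro i j₁ j₂ h1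
    induction j₂, h1 using Nat.le_induction with
    | base => exact grow i j₁
    | succ j hj ih =>
      intro h2
      exact (ih (T.shape.up_left_mem le_rfl (by omega) h2)).trans (grow i j h2)
  have gpos : ∀ i j, (i, j) ∈ T.shape → 1 ≤ g i j := by
    intro i j hij
    obtain ⟨X', hX'⟩ := exists_colWord_eq_append H g (hlt hij)
    refine (hE.right h).1 _ ?_
    rw [hX']
    simp only [List.mem_append]
    exact .inl (.inr (List.mem_map.2 ⟨i, List.mem_range.2 (hmem.1 hij), rfl⟩))
  classical
  refine ⟨⟨T.shape, fun i j => if (i, j) ∈ T.shape then g i j else 0, fun i j hij => if_neg hij,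
    fun i j hij => by simpa [hij] using gpos i j hij, fun i j₁ j₂ h1 h2 => ?_,
    fun i₁ i₂ j h1 h2 => ?_⟩, rfl, ?_⟩
  · have h3 := T.shape.up_left_mem le_rfl h1.le h2
    simpa [h2, h3] using grow' i j₁ j₂ h1 h2
  · have h3 := T.shape.up_left_mem h1.le le_rfl h2
    simpa [h2, h3] using gcol i₁ i₂ j h1 h2
  · rw [IncreasingTableau.column_eq]
    exact colWord_congr fun j _ i hi => if_pos (hmem.2 hi)

/-! ### Insertion of the column reading word -/

/-- Append the entries of a column to consecutive rows, starting new rows when they run out. -/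
def attach : List (List ℕ) → List ℕ → List (List ℕ)
  | Ps, [] => Ps
  | [], y :: ys => [y] :: attach [] ys
  | P :: Ps, y :: ys => (P ++ [y]) :: attach Ps ys

@[simp] lemma attach_nil (Ps : List (List ℕ)) : attach Ps [] = Ps := by cases Ps <;> rfl

lemma length_attach (Ps : List (List ℕ)) (ys : List ℕ) :
    (attach Ps ys).length = max Ps.length ys.length := by
  induction ys generalizing Ps with
  | nil => simp
  | cons y ys ih =>
    cases Ps with
    | nil => simp [attach, ih]
    | cons P Ps => simp [attach, ih]

lemma getD_attach (Ps : List (List ℕ)) (ys : List ℕ) (i : ℕ) :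
    (attach Ps ys).getD i [] = Ps.getD i [] ++ ys[i]?.toList := by
  induction ys generalizing Ps i with
  | nil => simp
  | cons y ys ih =>
    cases Ps with
    | nil => cases i with
      | zero => simp [attach]
      | succ i => simpa [attach] using ih [] i
    | cons P Ps => cases i with
      | zero => simp [attach]
      | succ i => simpa [attach] using ih Ps i

lemma findIdx?_append_singleton {P : List ℕ} {x y : ℕ} (hP : ∀ z ∈ P, z < x) (hxy : x < y) :
    (P ++ [y]).findIdx? (fun z => decide (x < z)) = some P.length := by
  rw [List.findIdx?_append, List.findIdx?_eq_none_iff.2 (by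
    intro z hz; have := hP z hz; simp; omega)]
  simp [hxy]

lemma pairwise_append_singleton {P : List ℕ} {x : ℕ} (hs : P.Pairwise (· < ·))
    (hP : ∀ z ∈ P, z < x) : (P ++ [x]).Pairwise (· < ·) :=
  List.pairwise_append.2 ⟨hs, by simp, by simpa using hP⟩

/-- A column is inserted from bottom to top. The new letter `x` replaces the last entry `y` of the
first row and `y` is pushed into the next row, so the part of the column already present moves down
by one row. The replacement is always allowed, since `x` exceeds the rest of its row and the entry
above it. -/
lemma egInsert_attach {j : ℕ} {above : List ℕ} {Ps : List (List ℕ)} {x : ℕ} {ys : List ℕ}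
    (hs : ∀ P ∈ Ps, P.Pairwise (· < ·)) (hxy : (x :: ys).Pairwise (· < ·))
    (hlen : ∀ i < ys.length, (Ps.getD i []).length = j)
    (hlt : ∀ i < (x :: ys).length, ∀ z ∈ Ps.getD i [], z < (x :: ys).getD i 0)
    (ha : ∀ z ∈ above[j]?, z < x) :
    egInsert above (attach Ps ys) x = attach Ps (x :: ys) := by
  induction ys generalizing above Ps x with
  | nil =>
    cases Ps with
    | nil => simp [attach, egInsert]
    | cons P Ps =>
      have h0 : ∀ z ∈ P, z < x := by simpa using hlt 0 (by simp)
      have : P.findIdx? (fun z => decide (x < z)) = none := by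
        rw [List.findIdx?_eq_none_iff]
        intro z hz; have := h0 z hz; simp; omega
      simp [attach, egInsert, this]
  | cons y ys ih =>
    have hxy' : x < y := (List.pairwise_cons.1 hxy).1 y (by simp)
    have hys := (List.pairwise_cons.1 hxy).2
    obtain ⟨P, Ps', hP, hPs', hatt, hatt'⟩ : ∃ P Ps', P = Ps.getD 0 [] ∧
        (∀ i, Ps'.getD i [] = Ps.getD (i + 1) []) ∧
        attach Ps (y :: ys) = (P ++ [y]) :: attach Ps' ys ∧
        attach Ps (x :: y :: ys) = (P ++ [x]) :: attach Ps' (y :: ys) := by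
      cases Ps with
      | nil => exact ⟨[], [], by simp [attach]⟩
      | cons P Ps => exact ⟨P, Ps, by simp [attach]⟩
    have hPl : P.length = j := hP ▸ hlen 0 (by simp)
    have h0 : ∀ z ∈ P, z < x := by
      have := hlt 0 (by simp)
      rw [← hP] at this
      simpa using this
    have hsP : P.Pairwise (· < ·) := by
      cases Ps with
      | nil => simp [hP]
      | cons Q Qs => exact hs P (by simp [hP])
    have hsP' : ∀ Q ∈ Ps', Q.Pairwise (· < ·) := by
      intro Q hQ
      obtain ⟨i, hi, rfl⟩ := List.getElem_of_mem hQ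
      have h1 := hPs' i
      rw [List.getD_eq_getElem _ _ hi] at h1
      rw [h1]
      rcases Nat.lt_or_ge (i + 1) Ps.length with h2 | h2
      · rw [List.getD_eq_getElem _ _ h2]; exact hs _ (List.getElem_mem _)
      · rw [List.getD_eq_default _ _ h2]; simp
    rw [hatt, hatt']
    have hset : (P ++ [y]).set P.length x = P ++ [x] := by simp
    have hget : (P ++ [y]).getD P.length 0 = y := by simp
    simp only [egInsert, findIdx?_append_singleton h0 hxy', hset, hget]
    rw [if_pos ⟨pairwise_append_singleton hsP h0, by rw [hPl]; exact ha⟩]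
    congr 1
    refine ih hsP' hys (fun i hi => ?_) (fun i hi => ?_) ?_
    · rw [hPs']; exact hlen (i + 1) (by simpa using hi)
    · rw [hPs']; simpa using hlt (i + 1) (by simpa using hi)
    · subst hPl; simpa using hxy'

lemma foldr_egInsert {j : ℕ} {Ps : List (List ℕ)} {ys : List ℕ}
    (hs : ∀ P ∈ Ps, P.Pairwise (· < ·)) (hys : ys.Pairwise (· < ·))
    (hlen : ∀ i < ys.length, (Ps.getD i []).length = j)
    (hlt : ∀ i < ys.length, ∀ z ∈ Ps.getD i [], z < ys.getD i 0) :
    ys.foldr (fun x T => egInsert [] T x) Ps = attach Ps ys := by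
  induction ys with
  | nil => simp
  | cons y ys ih =>
    have h1 := List.pairwise_cons.1 hys
    rw [List.foldr_cons, ih h1.2 (fun i hi => hlen i (by simp; omega)) ?_]
    · exact egInsert_attach hs hys (fun i hi => hlen i (by simp; omega)) hlt (by simp)
    · intro i hi z hz
      refine (hlt i (by simp; omega) z hz).trans ?_
      rw [show ys.getD i 0 = (y :: ys).getD (i + 1) 0 from List.getD_cons_succ.symm,
        List.getD_eq_getElem _ _ (show i < (y :: ys).length by simp; omega),
        List.getD_eq_getElem _ _ (show i + 1 < (y :: ys).length by simpa using hi)]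
      exact List.pairwise_iff_getElem.1 hys i (i + 1) (by simp; omega) (by simp; omega) (by omega)

namespace IncreasingTableau

/-- The rows of the tableau formed by the first `m` columns. -/
def rowsUpTo (T : IncreasingTableau) (m : ℕ) : List (List ℕ) :=
  -- Without columns the list of rows must be empty, rather than a list of empty rows, to agree with
  -- the start of the insertion.
  (List.range (if m = 0 then 0 else T.shape.colLen 0)).map fun i =>
    (List.range (min m (T.shape.rowLen i))).map fun j => T.entry i j

lemma getD_rowsUpTo (T : IncreasingTableau) (m i : ℕ) : (T.rowsUpTo m).getD i [] =
    (List.range (min m (T.shape.rowLen i))).map fun j => T.entry i j := by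
  rcases Nat.lt_or_ge i (T.rowsUpTo m).length with h | h
  · rw [List.getD_eq_getElem _ _ h]
    simp [rowsUpTo]
  · rw [List.getD_eq_default _ _ h]
    have : min m (T.shape.rowLen i) = 0 := by
      rcases Nat.eq_zero_or_pos m with rfl | hm
      · simp
      by_contra h1
      have h2 : (i, 0) ∈ T.shape := YoungDiagram.mem_iff_lt_rowLen.2 (by omega)
      rw [YoungDiagram.mem_iff_lt_colLen] at h2
      simp [rowsUpTo, hm.ne'] at h
      omega
    simp [this]

lemma attach_rowsUpTo (T : IncreasingTableau) (m : ℕ) :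
    attach (T.rowsUpTo m) (colBlock T.entry (T.shape.colLen m) m) = T.rowsUpTo (m + 1) := by
  have h0 := T.shape.colLen_anti 0 m (by omega)
  have hl : (attach (T.rowsUpTo m) (colBlock T.entry (T.shape.colLen m) m)).length =
      (T.rowsUpTo (m + 1)).length := by
    rw [length_attach]
    rcases Nat.eq_zero_or_pos m with rfl | hm
    · simp [rowsUpTo]
    · simp [rowsUpTo, hm.ne', h0]
  apply List.ext_getElem hl
  intro i h1 h2
  rw [← List.getD_eq_getElem _ [] h1, ← List.getD_eq_getElem _ [] h2, getD_attach, getD_rowsUpTo,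
    getD_rowsUpTo]
  by_cases hi : i < T.shape.colLen m
  · have h3 := YoungDiagram.mem_iff_lt_rowLen.1 (YoungDiagram.mem_iff_lt_colLen.2 hi)
    rw [min_eq_left (by omega), min_eq_left (by omega), List.range_succ]
    simp [colBlock, hi]
  · have h3 : ¬ m < T.shape.rowLen i := fun h =>
      hi (YoungDiagram.mem_iff_lt_colLen.1 (YoungDiagram.mem_iff_lt_rowLen.2 h))
    rw [min_eq_right (by omega), min_eq_right (by omega)]
    simp [colBlock, hi]

/-- The reversed word reads the columns from left to right, each from bottom to top, and each one is
attached to the rows built so far. -/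
lemma insertion_colWord (T : IncreasingTableau) (m : ℕ) :
    (colWord T.shape.colLen T.entry m).reverse.foldl (fun T x => egInsert [] T x) [] =
      T.rowsUpTo m := by
  induction m with
  | zero => simp [rowsUpTo]
  | succ m ih =>
    rw [colWord_succ, List.reverse_append, List.foldl_append, ih, List.foldl_reverse,
      ← attach_rowsUpTo]
    refine foldr_egInsert (j := m) ?_ ?_ ?_ ?_
    · intro P hP
      obtain ⟨i, -, rfl⟩ := List.mem_map.1 hP
      rw [List.pairwise_iff_getElem]
      intro j₁ j₂ h1 h2 hlt
      simp only [List.length_map, List.length_range, lt_min_iff] at h2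
      simpa using T.row_strict i j₁ j₂ hlt (YoungDiagram.mem_iff_lt_rowLen.2 h2.2)
    · exact pairwise_colBlock fun i₁ i₂ h1 h2 =>
        T.col_strict i₁ i₂ m h1 (YoungDiagram.mem_iff_lt_colLen.2 h2)
    · intro i hi
      rw [length_colBlock] at hi
      have h3 := YoungDiagram.mem_iff_lt_rowLen.1 (YoungDiagram.mem_iff_lt_colLen.2 hi)
      rw [getD_rowsUpTo]
      simp; omega
    · intro i hi z hz
      rw [length_colBlock] at hi
      rw [getD_rowsUpTo] at hz
      obtain ⟨j, hj, rfl⟩ := List.mem_map.1 hz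
      rw [getD_colBlock _ _ hi]
      exact T.row_strict i j m (by simp at hj; omega) (YoungDiagram.mem_iff_lt_colLen.2 hi)

/-- Inserting the reverse of the column reading word of a tableau gives the tableau. -/
theorem insertionTableau_reverse_column (T : IncreasingTableau) :
    insertionTableau T.column.reverse = T.rows := by
  rw [insertionTableau, column_eq, insertion_colWord, rowsUpTo, rows]
  by_cases h : T.shape.rowLen 0 = 0
  · have : T.shape.colLen 0 = 0 := by
      by_contra h1
      have h2 : (0, 0) ∈ T.shape := YoungDiagram.mem_iff_lt_colLen.2 (by omega)
      rw [YoungDiagram.mem_iff_lt_rowLen] at h2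
      omega
    simp [this]
  · rw [if_neg h]
    refine List.map_congr_left fun i _ => ?_
    rw [min_eq_right (T.shape.rowLen_anti 0 i (by omega))]

lemma rows_injective {T T' : IncreasingTableau} (h : T.rows = T'.rows) : T = T' := by
  have hl : T.shape.colLen 0 = T'.shape.colLen 0 := by
    simpa [rows] using congrArg List.length h
  have key : ∀ i < T.shape.colLen 0, (List.range (T.shape.rowLen i)).map (T.entry i) =
      (List.range (T'.shape.rowLen i)).map (T'.entry i) := by
    intro i hi
    have := congrArg (fun l => l.getD i []) h
    simpa [rows, hi, hl ▸ hi] using this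
  have hrow : ∀ i < T.shape.colLen 0, T.shape.rowLen i = T'.shape.rowLen i := fun i hi => by
    simpa using congrArg List.length (key i hi)
  have hmem0 : ∀ {T : IncreasingTableau} {i j}, (i, j) ∈ T.shape → i < T.shape.colLen 0 :=
    fun hij => YoungDiagram.mem_iff_lt_colLen.1 (YoungDiagram.up_left_mem _ le_rfl (by omega) hij)
  have hshape : T.shape = T'.shape := by
    ext ⟨i, j⟩
    simp only [YoungDiagram.mem_cells]
    constructor
    · intro hij
      rw [YoungDiagram.mem_iff_lt_rowLen, ← hrow i (hmem0 hij)]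
      exact YoungDiagram.mem_iff_lt_rowLen.1 hij
    · intro hij
      rw [YoungDiagram.mem_iff_lt_rowLen, hrow i (hl ▸ hmem0 hij)]
      exact YoungDiagram.mem_iff_lt_rowLen.1 hij
  ext i j
  · rw [hshape]
  · by_cases hij : (i, j) ∈ T.shape
    · have h1 := congrArg (fun l => l.getD j 0) (key i (hmem0 hij))
      have h2 := YoungDiagram.mem_iff_lt_rowLen.1 hij
      have h3 := YoungDiagram.mem_iff_lt_rowLen.1 (hshape ▸ hij)
      simpa [h2, h3] using h1
    · rw [T.zeros i j hij, T'.zeros i j (hshape ▸ hij)]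

end IncreasingTableau

end BumplessEG

namespace BumplessEG

open Equiv

/-! ### Rothe diagrams -/

/-- The box `(r, c)` belongs to the Rothe diagram of `u`. -/
def InRothe (u : Perm ℕ) (r c : ℕ) : Prop := c < u r ∧ r < u.symm c

/-- If `u' r` exceeded `u r`, then `u r` would occur in `u'` only after row `r`, so the box `(r, u
r)` would belong to the diagram of `u'`; it is never in the diagram of `u`. -/
lemma apply_le_of_inRothe {u u' : Perm ℕ} (h : ∀ r c, InRothe u r c ↔ InRothe u' r c) {r : ℕ}
    (hr : ∀ i < r, u i = u' i) : u' r ≤ u r := by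
  by_contra! hlt
  have h1 : InRothe u' r (u r) := by
    refine ⟨hlt, ?_⟩
    by_contra! h2
    rcases h2.lt_or_eq with h3 | h3
    · have := hr _ h3
      rw [apply_symm_apply, u.injective.eq_iff] at this
      omega
    · have : u' r = u r := by rw [← h3, apply_symm_apply, h3]
      omega
  exact ((h r (u r)).2 h1).1.false

/-- A permutation is determined by its Rothe diagram. -/
lemma inRothe_injective {u u' : Perm ℕ} (h : ∀ r c, InRothe u r c ↔ InRothe u' r c) : u = u' := by
  ext r
  induction r using Nat.strong_induction_on with
  | _ r ih =>
    exact le_antisymm (apply_le_of_inRothe (fun r c => (h r c).symm) fun i hi => (ih i hi).symm)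
      (apply_le_of_inRothe h ih)

lemma InRothe.pos {u : Perm ℕ} (h0 : u 0 = 0) {r c : ℕ} (h : InRothe u r c) : 1 ≤ r ∧ 1 ≤ c := by
  obtain ⟨h1, h2⟩ := h
  constructor
  · by_contra hr
    obtain rfl : r = 0 := by omega
    omega
  · by_contra hc
    obtain rfl : c = 0 := by omega
    rw [show u.symm 0 = 0 by rw [symm_apply_eq, h0]] at h2
    omega

lemma InRothe.le {n : ℕ} {u : Perm ℕ} (hu : InSym n u) {r c : ℕ} (h : InRothe u r c) :
    r ≤ n ∧ c ≤ n ∧ u.symm c ≤ n := by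
  obtain ⟨h1, h2⟩ := h
  have hr : r ≤ n := by
    by_contra hr
    rw [hu r (by simp; omega)] at h1
    rw [hu.symm c] at h2
    · omega
    · simp only [Set.mem_Icc, not_and, not_le]
      intro hc
      by_contra hc'
      have := (hu.symm.mem hc (by omega)).2
      omega
  have hr1 : 1 ≤ r := by
    by_contra hr1
    obtain rfl : r = 0 := by omega
    rw [hu.zero] at h1
    omega
  have h3 := (hu.mem hr1 hr).2
  have hc : 1 ≤ c := by
    by_contra hc
    obtain rfl : c = 0 := by omega
    rw [hu.symm.zero] at h2
    omega
  exact ⟨hr, by omega, (hu.symm.mem hc (by omega)).2⟩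

/-! ### Dominant permutations -/

lemma IsDominant.avoids {n : ℕ} {u : Perm ℕ} (hu : InSym n u) (h : IsDominant n u) {i p j : ℕ}
    (hi : 1 ≤ i) (hip : i < p) (hpj : p < j) (h1 : u i < u j) : u p ≤ u j := by
  by_contra! h2
  refine h ⟨i, p, j, hi, hip, hpj, ?_, h1, h2⟩
  exact (InRothe.le hu (r := p) (c := u j) ⟨h2, by simpa using hpj⟩).2.2.trans' (by simp)

/-- A box missing above a box of the diagram, or missing to its left, gives a 132-pattern. Moving up
first and then left covers all cases. -/
lemma IsDominant.inRothe_of_le {n : ℕ} {u : Perm ℕ} (hu : InSym n u) (h : IsDominant n u)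
    {r c r' c' : ℕ} (hrc : InRothe u r c) (hr : 1 ≤ r') (hr' : r' ≤ r) (hc : 1 ≤ c')
    (hc' : c' ≤ c) : InRothe u r' c' := by
  have key : InRothe u r' c := by
    rcases hr'.lt_or_eq with hlt | rfl
    · refine ⟨?_, by have := hrc.2; omega⟩
      have hne : u r' ≠ c := fun he => by
        have := hrc.2
        rw [← he, symm_apply_apply] at this
        omega
      by_contra hn
      have h1 := h.avoids hu hr hlt hrc.2 (by rw [apply_symm_apply]; omega)
      rw [apply_symm_apply] at h1
      have := hrc.1
      omega
    · exact hrc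
  refine ⟨by have := key.1; omega, ?_⟩
  by_contra hn
  rcases hc'.lt_or_eq with hlt | rfl
  · have hne : u.symm c' ≠ r' := fun he => by
      rw [symm_apply_eq] at he
      have := key.1
      omega
    have h1 : 1 ≤ u.symm c' := by
      by_contra h0
      have : u.symm c' = 0 := by omega
      rw [symm_apply_eq, hu.zero] at this
      omega
    have h2 := h.avoids hu h1 (by omega : u.symm c' < r') key.2 (by simpa using hlt)
    rw [apply_symm_apply] at h2
    have := key.1
    omega
  · exact hn key.2

/-! ### Column words of frozen fillings -/

lemma wordProd_range'_apply (j k x : ℕ) : wordProd (List.range' j k) x =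
    if j ≤ x ∧ x < j + k then x + 1 else if x = j + k then j else x := by
  induction k generalizing j with
  | zero =>
    simp only [List.range'_zero, wordProd_nil, Perm.one_apply]
    split_ifs <;> omega
  | succ k ih =>
    rw [List.range'_succ, wordProd_cons, Perm.mul_apply, ih, swap_apply_def]
    split_ifs <;> omega

lemma wordProd_apply_of_lt {a : List ℕ} {x : ℕ} (h : ∀ k ∈ a, x < k) : wordProd a x = x := by
  induction a with
  | nil => rfl
  | cons k a ih =>
    have := h k (by simp)
    rw [wordProd_cons, Perm.mul_apply, ih fun k hk => h k (by simp [hk]),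
      swap_apply_of_ne_of_ne (by omega) (by omega)]

lemma symm_wordProd_le (a : List ℕ) (x : ℕ) : (wordProd a).symm x ≤ x + a.length := by
  induction a generalizing x with
  | nil => simp [← Perm.inv_def]
  | cons k a ih =>
    have h1 : (wordProd (k :: a)).symm x = (wordProd a).symm (swap k (k + 1) x) := rfl
    have h2 := ih (swap k (k + 1) x)
    have h3 : swap k (k + 1) x ≤ x + 1 := by rw [swap_apply_def]; split_ifs <;> omega
    rw [h1, List.length_cons]
    omega

lemma IsReduced.prefix {a b : List ℕ} (h : IsReduced (a ++ b)) : IsReduced a := by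
  rw [isReduced_iff] at h ⊢
  refine ⟨fun x hx => h.1 x (by simp [hx]), fun t ht => ?_⟩
  have := h.2 t (by simp; omega)
  rwa [lo, hi, List.take_append_of_le_length ht.le, List.getD_append _ _ _ _ ht] at this

lemma isReduced_append_singleton {a : List ℕ} {k : ℕ} :
    IsReduced (a ++ [k]) ↔ IsReduced a ∧ 1 ≤ k ∧ wordProd a k < wordProd a (k + 1) := by
  constructor
  · intro h
    refine ⟨h.prefix, h.1 k (by simp), ?_⟩
    have := (isReduced_iff.1 h).2 a.length (by simp)
    simpa [lo, hi] using this
  · rintro ⟨h1, h2, h3⟩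
    rw [isReduced_iff] at h1 ⊢
    refine ⟨by simpa [or_imp, forall_and] using ⟨h1.1, h2⟩, fun t ht => ?_⟩
    rw [List.length_append, List.length_singleton] at ht
    rcases Nat.lt_or_ge t a.length with h | h
    · rw [lo, hi, List.take_append_of_le_length h.le, List.getD_append _ _ _ _ h]
      exact h1.2 t h
    · obtain rfl : t = a.length := by omega
      simpa [lo, hi] using h3

/-- Columns `m - 1, …, j` of a filling, where `h` gives their lengths. -/
def colsFrom (h : ℕ → ℕ) (f : ℕ → ℕ → ℕ) (m j : ℕ) : List ℕ :=
  (List.range' j (m - j)).reverse.flatMap fun k => colBlock f (h k) k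

lemma colsFrom_zero (h : ℕ → ℕ) (f : ℕ → ℕ → ℕ) (m : ℕ) : colsFrom h f m 0 = colWord h f m := by
  simp [colsFrom, colWord, List.range_eq_range']

lemma colsFrom_of_le (h : ℕ → ℕ) (f : ℕ → ℕ → ℕ) {m j : ℕ} (hj : m ≤ j) :
    colsFrom h f m j = [] := by
  simp [colsFrom, Nat.sub_eq_zero_of_le hj]

lemma colsFrom_eq {h : ℕ → ℕ} (f : ℕ → ℕ → ℕ) {m : ℕ} (hm : ∀ j, m ≤ j → h j = 0) (j : ℕ) :
    colsFrom h f m j = colsFrom h f m (j + 1) ++ colBlock f (h j) j := by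
  rcases Nat.lt_or_ge j m with hj | hj
  · rw [colsFrom, show m - j = (m - (j + 1)) + 1 by omega, List.range'_succ, colsFrom]
    simp
  · rw [colsFrom_of_le _ _ hj, colsFrom_of_le _ _ (by omega), hm j hj]
    rfl

lemma exists_colWord_eq_colsFrom (h : ℕ → ℕ) (f : ℕ → ℕ → ℕ) {m : ℕ}
    (hm : ∀ j, m ≤ j → h j = 0) (j : ℕ) : ∃ S, colWord h f m = colsFrom h f m j ++ S := by
  induction j with
  | zero => exact ⟨[], by simp [colsFrom_zero]⟩
  | succ j ih =>
    obtain ⟨S, hS⟩ := ih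
    exact ⟨_, by rw [hS, colsFrom_eq f hm, List.append_assoc]⟩

lemma mem_colsFrom {h : ℕ → ℕ} {f : ℕ → ℕ → ℕ} {m j x : ℕ} (hx : x ∈ colsFrom h f m j) :
    ∃ i k, j ≤ k ∧ i < h k ∧ x = f i k := by
  simp only [colsFrom, colBlock, List.mem_flatMap, List.mem_reverse, List.mem_map, List.mem_range,
    List.mem_range'_1] at hx
  obtain ⟨k, hk, i, hi, rfl⟩ := hx
  exact ⟨i, k, hk.1, hi, rfl⟩

lemma colsFrom_apply {h : ℕ → ℕ} {f : ℕ → ℕ → ℕ} {m j : ℕ}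
    (hf : ∀ i k, i < h k → i + k + 1 ≤ f i k) {x : ℕ} (hx : x ≤ j) :
    wordProd (colsFrom h f m j) x = x := by
  refine wordProd_apply_of_lt fun k hk => ?_
  obtain ⟨i, l, h1, h2, rfl⟩ := mem_colsFrom hk
  have := hf i l h2
  omega

lemma colBlock_frozen {f : ℕ → ℕ → ℕ} {k j : ℕ} (h : ∀ i < k, f i j = i + j + 1) :
    colBlock f k j = List.range' (j + 1) k := by
  apply List.ext_getElem (by simp)
  intro i h1 h2
  have := h i (by simpa using h1)
  simp [colBlock, this]
  omega

section frozen

variable {h : ℕ → ℕ} {f : ℕ → ℕ → ℕ} {m : ℕ} (hm : ∀ j, m ≤ j → h j = 0)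
  (hh : Antitone h) (hf : ∀ i k, i < h k → f i k = i + k + 1)

-- Add the columns from right to left. A frozen column `j` multiplies by a cycle which moves the
-- value `j + 1` from position `j + 1` to position `j + 1 + h j` and shifts the entries passed by
-- one place. This creates the column `j + 1` of the Rothe diagram and moves the boxes of the other
-- columns up by one row; since `h` is antitone, all of them are affected.
include hm hh hf in
lemma inRothe_colsFrom (k j : ℕ) (hk : m ≤ j + k) (r c : ℕ) (hr : j < r) (hc : j < c) :
    InRothe (wordProd (colsFrom h f m j)) r c ↔ r - j ≤ h (c - 1) := by
  induction k generalizing j r c with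
  | zero =>
    rw [colsFrom_of_le _ _ (by omega), hm (c - 1) (by omega), wordProd_nil]
    have h1 : (1 : Perm ℕ).symm c = c := rfl
    simp only [InRothe, Perm.one_apply, h1]
    omega
  | succ k ih =>
    rw [colsFrom_eq f hm, wordProd_append, colBlock_frozen fun i hi => hf i j hi]
    set v' := wordProd (colsFrom h f m (j + 1)) with hv'
    have hfix : ∀ x ≤ j + 1, v' x = x := fun x hx =>
      colsFrom_apply (fun i k hi => (hf i k hi).ge) hx
    have hlt : ∀ x, j + 1 < x → j + 1 < v' x := fun x hx => by
      by_contra hn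
      have := v'.injective (hfix (v' x) (by omega))
      omega
    have hanti := hh (show j ≤ c - 1 by omega)
    set z := (v' * wordProd (List.range' (j + 1) (h j))).symm c with hz
    have hz' : v'.symm c = wordProd (List.range' (j + 1) (h j)) z := by
      rw [symm_apply_eq, hz, ← Perm.mul_apply, apply_symm_apply]
    have hzc : v' (wordProd (List.range' (j + 1) (h j)) z) = c := by rw [← hz', apply_symm_apply]
    rw [InRothe, ← hz, Perm.mul_apply]
    simp only [wordProd_range'_apply] at hz' hzc ⊢
    rcases (show c = j + 1 ∨ j + 1 < c by omega) with rfl | hc'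
    · rw [← hfix (j + 1) le_rfl, v'.injective.eq_iff, hfix (j + 1) le_rfl] at hzc
      have hz1 : z = j + 1 + h j := by split_ifs at hzc <;> omega
      rw [hz1, Nat.add_sub_cancel]
      split_ifs with h1 h2
      · have := hlt (r + 1) (by omega); omega
      · rw [hfix _ le_rfl]; omega
      · omega
    · have ih1 := ih (j + 1) (by omega) (r + 1) c (by omega) hc'
      rw [InRothe, hz'] at ih1
      have hzj : ¬ z ≤ j := fun hzj => by
        rw [if_neg (by omega), if_neg (by omega), hfix z (by omega)] at hzc
        omega
      have hzj' : z ≠ j + 1 + h j := fun hzj => by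
        rw [if_neg (by omega), if_pos hzj, hfix _ le_rfl] at hzc
        omega
      split_ifs with h1 h2
      · rw [← Nat.add_sub_add_right r 1 j, ← ih1]
        refine and_congr_right fun _ => ?_
        split_ifs <;> omega
      · rw [hfix _ le_rfl]; omega
      · have ih2 := ih (j + 1) (by omega) r c (by omega) hc'
        rw [InRothe, hz'] at ih2
        have h3 : ¬ r - (j + 1) ≤ h (c - 1) := by omega
        have h4 : ¬ r - j ≤ h (c - 1) := by omega
        rw [iff_false_right h3] at ih2
        rw [iff_false_right h4]
        rintro ⟨h5, h6⟩
        refine ih2 ⟨h5, ?_⟩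
        split_ifs <;> omega

-- Each letter of the frozen column `j` moves the value `j + 1` one place to the right, past a
-- larger value.
include hm hf in
lemma isReduced_colsFrom (k j : ℕ) (hk : m ≤ j + k) : IsReduced (colsFrom h f m j) := by
  induction k generalizing j with
  | zero =>
    rw [colsFrom_of_le _ _ (by omega), isReduced_iff]
    simp
  | succ k ih =>
    rw [colsFrom_eq f hm, colBlock_frozen fun i hi => hf i j hi]
    have h0 := ih (j + 1) (by omega)
    set v' := wordProd (colsFrom h f m (j + 1)) with hv'
    have hfix : ∀ x ≤ j + 1, v' x = x := fun x hx =>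
      colsFrom_apply (fun i k hi => (hf i k hi).ge) hx
    have hlt : ∀ x, j + 1 < x → j + 1 < v' x := fun x hx => by
      by_contra hn
      have := v'.injective (hfix (v' x) (by omega))
      omega
    generalize h j = l
    induction l with
    | zero => simpa using h0
    | succ l ihl =>
      rw [List.range'_concat, ← List.append_assoc, isReduced_append_singleton]
      refine ⟨ihl, by omega, ?_⟩
      rw [wordProd_append, Perm.mul_apply, Perm.mul_apply, wordProd_range'_apply,
        wordProd_range'_apply, if_neg (by omega), if_pos (by omega), if_neg (by omega),
        if_neg (by omega), ← hv', hfix _ le_rfl]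
      exact hlt _ (by omega)

end frozen

namespace IncreasingTableau

variable (T : IncreasingTableau)

lemma le_entry {i j : ℕ} (h : (i, j) ∈ T.shape) : i + j + 1 ≤ T.entry i j := by
  induction i generalizing j with
  | zero =>
    induction j with
    | zero => exact T.pos 0 0 h
    | succ j ih =>
      have := ih (T.shape.up_left_mem le_rfl (by omega) h)
      have := T.row_strict 0 j (j + 1) (by omega) h
      omega
  | succ i ih =>
    have := ih (T.shape.up_left_mem (by omega) le_rfl h)
    have := T.col_strict i (i + 1) j (by omega) h
    omega

lemma colLen_eq_zero {j : ℕ} (h : T.shape.rowLen 0 ≤ j) : T.shape.colLen j = 0 := by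
  by_contra h1
  have h2 : (0, j) ∈ T.shape := YoungDiagram.mem_iff_lt_colLen.2 (by omega)
  rw [YoungDiagram.mem_iff_lt_rowLen] at h2
  omega

lemma colLen_antitone : Antitone T.shape.colLen := fun i j hij => T.shape.colLen_anti i j hij

variable {T}

/-- The Rothe diagram of the permutation given by a frozen tableau is its shape. -/
lemma IsFrozen.inRothe_iff (hT : T.IsFrozen) (r c : ℕ) :
    InRothe (wordProd T.column) (r + 1) (c + 1) ↔ (r, c) ∈ T.shape := by
  rw [column_eq, ← colsFrom_zero, inRothe_colsFrom (fun j => T.colLen_eq_zero) T.colLen_antitone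
    (fun i k hi => hT i k (YoungDiagram.mem_iff_lt_colLen.2 hi)) (T.shape.rowLen 0) 0 (by omega)
    _ _ (by omega) (by omega), YoungDiagram.mem_iff_lt_colLen]
  simp only [Nat.add_sub_cancel]
  omega

lemma IsFrozen.isReduced (hT : T.IsFrozen) : IsReduced T.column := by
  rw [column_eq, ← colsFrom_zero]
  exact isReduced_colsFrom (fun j => T.colLen_eq_zero)
    (fun i k hi => hT i k (YoungDiagram.mem_iff_lt_colLen.2 hi)) (T.shape.rowLen 0) 0 (by omega)

lemma IsFrozen.isReducedWord (hT : T.IsFrozen) {u : Perm ℕ} (h0 : u 0 = 0)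
    (h : ∀ r c, InRothe u (r + 1) (c + 1) ↔ (r, c) ∈ T.shape) : IsReducedWord u T.column := by
  refine ⟨hT.isReduced, inRothe_injective fun r c => ?_⟩
  have h0' := wordProd_zero hT.isReduced.1
  by_cases hrc : 1 ≤ r ∧ 1 ≤ c
  · obtain ⟨r, rfl⟩ := Nat.exists_eq_add_of_le' hrc.1
    obtain ⟨c, rfl⟩ := Nat.exists_eq_add_of_le' hrc.2
    rw [hT.inRothe_iff, h]
  · exact iff_of_false (fun h1 => hrc (h1.pos h0')) fun h1 => hrc (h1.pos h0)

/-- The frozen tableau of a given shape. -/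
def frozen (μ : YoungDiagram) : IncreasingTableau where
  shape := μ
  entry i j := if (i, j) ∈ μ.cells then i + j + 1 else 0
  zeros i j h := if_neg h
  pos i j h := by rw [if_pos (by simpa using h)]; omega
  row_strict i j₁ j₂ h1 h2 := by
    have h3 := μ.up_left_mem le_rfl h1.le h2
    rw [if_pos (by simpa using h3), if_pos (by simpa using h2)]
    omega
  col_strict i₁ i₂ j h1 h2 := by
    have h3 := μ.up_left_mem h1.le le_rfl h2
    rw [if_pos (by simpa using h3), if_pos (by simpa using h2)]
    omega

lemma isFrozen_frozen (μ : YoungDiagram) : (frozen μ).IsFrozen := fun _ _ h => if_pos h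

lemma pairwise_eq_range' {l : List ℕ} {a : ℕ} (hl : l.Pairwise (· < ·)) (ha : ∀ x ∈ l, a ≤ x)
    (hb : ∀ x ∈ l, x < a + l.length) : l = List.range' a l.length := by
  induction l generalizing a with
  | nil => rfl
  | cons x l ih =>
    rw [List.pairwise_cons] at hl
    have hx : x = a := by
      by_contra hne
      have hlt : ∀ y ∈ x :: l, a + 1 ≤ y := by
        have := ha x (by simp)
        intro y hy
        rcases List.mem_cons.1 hy with rfl | hy
        · omega
        · have := hl.1 y hy; omega
      have hsub : (x :: l).toFinset ⊆ Finset.Ico (a + 1) (a + (x :: l).length) := fun y hy => by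
        rw [List.mem_toFinset] at hy
        exact Finset.mem_Ico.2 ⟨hlt y hy, hb y hy⟩
      have hc := Finset.card_le_card hsub
      rw [List.toFinset_card_of_nodup ((List.pairwise_cons.2 hl).imp ne_of_lt), Nat.card_Ico] at hc
      simp at hc
      omega
    subst hx
    rw [List.length_cons, List.range'_succ, ← ih hl.2 (fun y hy => hl.1 y hy)
      fun y hy => by have := hb y (by simp [hy]); simp at this; omega]

/-- Every reduced word tableau of a dominant permutation is frozen. -/
theorem isFrozen_of_isDominant {n : ℕ} {u : Perm ℕ} (hu : InSym n u) (hd : IsDominant n u)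
    (hT : IsReducedWord u T.column) : T.IsFrozen := by
  have hm : ∀ j, T.shape.rowLen 0 ≤ j → T.shape.colLen j = 0 := fun j => T.colLen_eq_zero
  have hle : ∀ i k, i < T.shape.colLen k → i + k + 1 ≤ T.entry i k := fun i k hi =>
    T.le_entry (YoungDiagram.mem_iff_lt_colLen.2 hi)
  set H := T.shape.colLen with hH
  set m := T.shape.rowLen 0 with hm'
  set V : ℕ → Perm ℕ := fun j => wordProd (colsFrom H T.entry m j) with hV
  have hfix : ∀ j x, x ≤ j → V j x = x := fun j x hx => colsFrom_apply hle hx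
  have hgt : ∀ j x, j < x → j < V j x := fun j x hx => by
    by_contra hn
    have := (V j).injective (hfix j (V j x) (by omega))
    omega
  -- Columns are peeled off from the left: what remains still avoids 132 on the positions after `j`,
  -- where it takes the values after `j`.
  have key : ∀ j, (∀ i p k, j < i → i < p → p < k → V j i < V j k → V j p ≤ V j k) ∧
      ∀ l < j, ∀ i < H l, T.entry i l = i + l + 1 := by
    intro j
    induction j with
    | zero =>
      refine ⟨fun i p k h1 h2 h3 h4 => ?_, by simp⟩
      have h5 : V 0 = u := by rw [← hT.2, column_eq, ← colsFrom_zero]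
      rw [h5] at h4 ⊢
      exact hd.avoids hu h1 h2 h3 h4
    | succ j ih =>
      obtain ⟨ih1, ih2⟩ := ih
      have hVj : V j = V (j + 1) * wordProd (colBlock T.entry (H j) j) := by
        simp only [hV]
        rw [colsFrom_eq _ hm j, wordProd_append]
      have hsorted : (colBlock T.entry (H j) j).Pairwise (· < ·) :=
        pairwise_colBlock fun i₁ i₂ h1 h2 =>
          T.col_strict i₁ i₂ j h1 (YoungDiagram.mem_iff_lt_colLen.2 h2)
      have hge : ∀ x ∈ colBlock T.entry (H j) j, j + 1 ≤ x := by
        intro x hx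
        obtain ⟨i, hi, rfl⟩ := List.mem_map.1 hx
        have := hle i j (List.mem_range.1 hi)
        omega
      have hlast : ∀ x ∈ colBlock T.entry (H j) j, x < j + 1 + H j := by
        rcases List.eq_nil_or_concat' (colBlock T.entry (H j) j) with h0 | ⟨d, z, hdz⟩
        · simp [h0]
        have hzmax : ∀ x ∈ colBlock T.entry (H j) j, x ≤ z := by
          rw [hdz] at hsorted ⊢
          intro x hx
          rcases List.mem_append.1 hx with hx | hx
          · exact ((List.pairwise_append.1 hsorted).2.2 x hx z (by simp)).le
          · exact (List.mem_singleton.1 hx).le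
        suffices z < j + 1 + H j from fun x hx => (hzmax x hx).trans_lt this
        have hred : IsReduced (colsFrom H T.entry m (j + 1) ++ d ++ [z]) := by
          obtain ⟨S, hS⟩ := exists_colWord_eq_colsFrom H T.entry hm j
          have h1 := hT.1
          rw [column_eq, hS, colsFrom_eq _ hm j, hdz, ← List.append_assoc] at h1
          exact h1.prefix
        rw [isReduced_append_singleton] at hred
        have hdesc : V j (z + 1) < V j z := by
          rw [hVj, hdz, wordProd_append, ← mul_assoc, ← wordProd_append]
          simpa using hred.2.2
        set M := (V j).symm (j + 1) with hM
        have hM1 : V j M = j + 1 := by rw [hM, apply_symm_apply]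
        have hMle : M ≤ j + 1 + H j := by
          have h1 := symm_wordProd_le (colBlock T.entry (H j) j) (j + 1)
          rw [length_colBlock] at h1
          have h2 : M = (wordProd (colBlock T.entry (H j) j)).symm (j + 1) := by
            rw [hM, symm_apply_eq, hVj, Perm.mul_apply, apply_symm_apply,
              hfix (j + 1) (j + 1) le_rfl]
          omega
        -- The last letter `z` of the column is a descent. To the right of `M`, where the smallest
        -- value `j + 1` stands, a descent would complete a 132-pattern. Since `M ≤ j + 1 + H j`,
        -- there is no room for the `H j` increasing entries but `j + 1, …, j + H j`.
        have hzM : z < M := by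
          by_contra hzM
          have hjM : j < M := by
            by_contra hjM
            have := hfix j M (by omega)
            omega
          have h1 := hgt j (z + 1) (by omega)
          have h2 := (V j).injective.ne (show z + 1 ≠ M by omega)
          rcases (show z = M ∨ M < z by omega) with rfl | h3
          · omega
          · have := ih1 M z (z + 1) hjM h3 (by omega) (by omega)
            omega
        omega
      have hblock := pairwise_eq_range' hsorted hge (by rw [length_colBlock]; exact hlast)
      rw [length_colBlock] at hblock
      refine ⟨fun i p k h1 h2 h3 h4 => ?_, fun l hl i hi => ?_⟩
      -- Removing the frozen column amounts to removing the value `j + 1` and closing the gap, which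
      -- preserves pattern avoidance.
      · have hpre : ∀ x, j + 1 < x →
            V (j + 1) x = V j (if x ≤ j + 1 + H j then x - 1 else x) := by
          intro x hx
          rw [hVj, hblock, Perm.mul_apply, wordProd_range'_apply]
          congr 1
          split_ifs <;> omega
        rw [hpre i h1, hpre k (by omega)] at h4
        rw [hpre p (by omega), hpre k (by omega)]
        refine ih1 _ _ _ ?_ ?_ ?_ h4 <;> split_ifs <;> omega
      · rcases (show l < j ∨ l = j by omega) with hl | rfl
        · exact ih2 l hl i hi
        · have h1 := getD_colBlock T.entry l hi
          rw [hblock] at h1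
          rw [← h1, List.getD_eq_getElem _ _ (by simpa using hi)]
          simp
          omega
  intro i j hij
  exact (key (j + 1)).2 j (by omega) i (YoungDiagram.mem_iff_lt_colLen.1 hij)

end IncreasingTableau

/-- The reduced word tableaux of a dominant permutation have the Rothe diagram as their shape. -/
lemma RT.mem_shape_iff {n : ℕ} {u : Perm ℕ} (hu : InSym n u) (hd : IsDominant n u) (T : RT u)
    (r c : ℕ) : (r, c) ∈ T.1.shape ↔ InRothe u (r + 1) (c + 1) := by
  rw [← (IncreasingTableau.isFrozen_of_isDominant hu hd T.2).inRothe_iff, T.2.2]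

lemma RT.eq_of_isDominant {n : ℕ} {u : Perm ℕ} (hu : InSym n u) (hd : IsDominant n u)
    (T T' : RT u) : T = T' := by
  have hs : T.1.shape = T'.1.shape := by
    ext ⟨r, c⟩
    simp only [YoungDiagram.mem_cells]
    rw [T.mem_shape_iff hu hd, T'.mem_shape_iff hu hd]
  refine Subtype.ext (IncreasingTableau.ext hs ?_)
  ext i j
  by_cases hij : (i, j) ∈ T.1.shape
  · rw [IncreasingTableau.isFrozen_of_isDominant hu hd T.2 i j hij,
      IncreasingTableau.isFrozen_of_isDominant hu hd T'.2 i j (hs ▸ hij)]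
  · rw [T.1.zeros i j hij, T'.1.zeros i j (hs ▸ hij)]

end BumplessEG

namespace BumplessEG

open Equiv

/-- The box `(r, s)` precedes the box `(p, c)`. -/
def Before (r s p c : ℕ) : Prop := r < p ∨ r = p ∧ s < c

namespace BPD

variable {n : ℕ} {w : Perm ℕ} {P P' : BPD n w} {r s : ℕ}

/-! ### Following pipes -/

lemma north_or_east_of_south (P : BPD n w) (h : InGrid n r s) (hs : P.south r s ≠ 0) :
    P.south (r - 1) s = P.south r s ∨ P.east r s = P.south r s := by
  rcases P.tile r s h with h | h | h | h | h | h
  · exact absurd h.2.1 hs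
  · exact absurd h.2.2.1 hs
  · exact .inr h.2.1
  · exact absurd h.2.2.1 hs
  · exact .inl h.2.1
  · exact .inl h.2.2.2

lemma north_or_east_of_west (P : BPD n w) (h : InGrid n r s) (hs : P.east r (s - 1) ≠ 0) :
    P.south (r - 1) s = P.east r (s - 1) ∨ P.east r s = P.east r (s - 1) := by
  rcases P.tile r s h with h | h | h | h | h | h
  · exact absurd h.1 hs
  · exact .inl h.2.1
  · exact absurd h.2.2.1 hs
  · exact .inr h.2.1
  · exact absurd h.2.2.1 hs
  · exact .inr h.2.1

lemma south_or_west_of_north (P : BPD n w) (h : InGrid n r s) (hs : P.south (r - 1) s ≠ 0) :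
    P.south r s = P.south (r - 1) s ∨ P.east r (s - 1) = P.south (r - 1) s := by
  rcases P.tile r s h with h | h | h | h | h | h
  · exact absurd h.2.2.1 hs
  · exact .inr h.2.1.symm
  · exact absurd h.2.2.2 hs
  · exact absurd h.2.2.2 hs
  · exact .inl h.2.1.symm
  · exact .inl h.2.2.2.symm

lemma south_or_west_of_east (P : BPD n w) (h : InGrid n r s) (hs : P.east r s ≠ 0) :
    P.south r s = P.east r s ∨ P.east r (s - 1) = P.east r s := by
  rcases P.tile r s h with h | h | h | h | h | h
  · exact absurd h.2.2.2 hs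
  · exact absurd h.2.2.2 hs
  · exact .inl h.2.1.symm
  · exact .inr h.2.1.symm
  · exact absurd h.2.2.2 hs
  · exact .inr h.2.1.symm

lemma isCrossing_of_ne (P : BPD n w) (h : InGrid n r s) (hs : P.south r s ≠ 0)
    (hw : P.east r (s - 1) ≠ 0) : P.IsCrossing r s := by
  rcases P.tile r s h with h | h | h | h | h | h
  · exact absurd h.1 hw
  · exact absurd h.2.2.1 hs
  · exact absurd h.2.2.1 hw
  · exact absurd h.2.2.1 hs
  · exact absurd h.2.2.1 hw
  · exact h

lemma inGrid_of_south (P : BPD n w) (h : P.south r s ≠ 0) : InGrid n r s := by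
  by_contra hn; exact h (P.south_off r s hn)

lemma inGrid_of_east (P : BPD n w) (h : P.east r s ≠ 0) : InGrid n r s := by
  by_contra hn; exact h (P.east_off r s hn)

/-- Following a pipe to the west until it comes from the south. -/
lemma exists_south_of_east (P : BPD n w) (h : P.east r s ≠ 0) :
    ∃ t ≤ s, P.south r t = P.east r s ∧ ∀ j, t ≤ j → j ≤ s → P.east r j = P.east r s := by
  induction s with
  | zero =>
    have := P.inGrid_of_east h
    exact absurd this.2.2.1 (by omega)
  | succ s ih =>
    rcases P.south_or_west_of_east (P.inGrid_of_east h) h with h1 | h1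
    · refine ⟨s + 1, le_rfl, h1, fun j h2 h3 => ?_⟩
      rw [le_antisymm h3 h2]
    · rw [Nat.add_sub_cancel] at h1
      obtain ⟨t, h2, h3, h4⟩ := ih (by rwa [h1])
      refine ⟨t, by omega, by rw [h3, h1], fun j h5 h6 => ?_⟩
      rcases h6.lt_or_eq with h7 | rfl
      · rw [h4 j h5 (by omega), h1]
      · rfl

/-- Following a pipe to the east until it leaves the row to the north or leaves the grid. -/
lemma exists_north_of_east (P : BPD n w) (h : P.east r s ≠ 0) :
    (∃ t > s, P.south (r - 1) t = P.east r s ∧ ∀ j, s ≤ j → j < t → P.east r j = P.east r s) ∨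
      ∀ j, s ≤ j → j ≤ n → P.east r j = P.east r s := by
  have hg := P.inGrid_of_east h
  induction hk : n - s generalizing s with
  | zero =>
    right
    intro j h1 h2
    rw [show j = s by omega]
  | succ k ih =>
    have hg' : InGrid n r (s + 1) := ⟨hg.1, hg.2.1, by omega, by omega⟩
    rcases P.north_or_east_of_west hg' h with h1 | h1
    · left
      refine ⟨s + 1, by omega, h1, fun j h2 h3 => ?_⟩
      rw [show j = s by omega]
    · rw [Nat.add_sub_cancel] at h1
      rcases ih (by rwa [h1]) hg' (by omega) with ⟨t, h2, h3, h4⟩ | h4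
      · left
        refine ⟨t, by omega, by rw [h3, h1], fun j h5 h6 => ?_⟩
        rcases h5.lt_or_eq with h7 | rfl
        · rw [h4 j h7 h6, h1]
        · rfl
      · right
        intro j h5 h6
        rcases h5.lt_or_eq with h7 | rfl
        · rw [h4 j h7 h6, h1]
        · rfl

lemma exists_north_of_south (P : BPD n w) (h : P.south r s ≠ 0) :
    (∃ t ≥ s, P.south (r - 1) t = P.south r s ∧ ∀ j, s ≤ j → j < t → P.east r j = P.south r s) ∨
      ∀ j, s ≤ j → j ≤ n → P.east r j = P.south r s := by
  rcases P.north_or_east_of_south (P.inGrid_of_south h) h with h1 | h1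
  · exact .inl ⟨s, le_rfl, h1, fun j h2 h3 => by omega⟩
  · rcases P.exists_north_of_east (by rwa [h1]) with ⟨t, h2, h3, h4⟩ | h4
    · exact .inl ⟨t, h2.le, by rw [h3, h1], fun j h5 h6 => by rw [h4 j h5 h6, h1]⟩
    · exact .inr fun j h5 h6 => by rw [h4 j h5 h6, h1]

lemma exists_south_of_north (P : BPD n w) (hg : InGrid n r s) (h : P.south (r - 1) s ≠ 0) :
    ∃ t ≤ s, P.south r t = P.south (r - 1) s ∧
      ∀ j, t ≤ j → j < s → P.east r j = P.south (r - 1) s := by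
  rcases P.south_or_west_of_north hg h with h1 | h1
  · exact ⟨s, le_rfl, h1, fun j h2 h3 => by omega⟩
  · obtain ⟨t, h2, h3, h4⟩ := P.exists_south_of_east (by rwa [h1])
    have := (P.inGrid_of_east (by rwa [h1] : P.east r (s - 1) ≠ 0)).2.2.1
    exact ⟨t, by omega, by rw [h3, h1], fun j h5 h6 => by rw [h4 j h5 (by omega), h1]⟩

/-- A pipe meets every horizontal line at most once. -/
lemma south_injective (P : BPD n w) {r s s' : ℕ} (h : P.south r s ≠ 0)
    (h' : P.south r s' = P.south r s) : s = s' := by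
  have hg := P.inGrid_of_south h
  induction hk : n - r generalizing r s s' with
  | zero =>
    have hr : r = n := by have := hg.2.1; omega
    have hg' := P.inGrid_of_south (h' ▸ h)
    rw [hr, P.south_boundary s hg.2.2.1 hg.2.2.2, P.south_boundary s' hg'.2.2.1 hg'.2.2.2] at h'
    exact h'.symm
  | succ k ih =>
    wlog hlt : s < s' generalizing s s'
    · rcases (show s = s' ∨ s' < s by omega) with h1 | h1
      · exact h1
      · exact (this (h' ▸ h) h'.symm (P.inGrid_of_south (h' ▸ h)) h1).symm
    exfalso
    have hg' := P.inGrid_of_south (h' ▸ h)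
    have key : ∀ {a b}, P.south (r + 1) a = P.south r s → P.south (r + 1) b = P.south r s →
        a = b := fun {a b} ha hb => ih (by rwa [ha]) (by rw [ha, hb])
      (P.inGrid_of_south (by rwa [ha])) (by omega)
    have hgs : ∀ {j}, InGrid n r j → InGrid n (r + 1) j := fun hj =>
      ⟨by omega, by omega, hj.2.2.1, hj.2.2.2⟩
    obtain ⟨t, h1, h2, h3⟩ := P.exists_south_of_north (r := r + 1) (hgs hg) h
    obtain ⟨t', h1', h2', h3'⟩ := P.exists_south_of_north (r := r + 1) (hgs hg') (h' ▸ h)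
    rw [Nat.add_sub_cancel] at h2 h3 h2' h3'
    rw [h'] at h2' h3'
    obtain rfl := key h2 h2'
    -- Both upward edges come from the same edge below, so the pipe leaves the box under the first
    -- of them to the east as well as to the north. It would cross itself there and have two
    -- different edges on the line below.
    have hE := h3' s h1 hlt
    have hW : P.east (r + 1) (s - 1) = P.south r s := by
      rcases P.tile (r + 1) s (hgs hg) with hb | hb | hb | hb | hb | hb
      · exact absurd (hb.2.2.2.symm.trans hE) h.symm
      · exact absurd (hb.2.2.2.symm.trans hE) h.symm
      · exact absurd hb.2.2.2 h
      · exact absurd hb.2.2.2 h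
      · exact absurd (hb.2.2.2.symm.trans hE) h.symm
      · rw [← hb.2.1, hE]
    obtain ⟨t₂, h4, h5, -⟩ := P.exists_south_of_east (by rwa [hW])
    rw [hW] at h5
    obtain rfl := key h2 h5
    have := (P.inGrid_of_east (by rwa [hW] : P.east (r + 1) (s - 1) ≠ 0)).2.2.1
    have hc : P.south (r + 1) s = P.south r s := by
      rcases P.tile (r + 1) s (hgs hg) with hb | hb | hb | hb | hb | hb
      · exact absurd (hb.2.2.2.symm.trans hE) h.symm
      · exact absurd (hb.2.2.2.symm.trans hE) h.symm
      · exact absurd hb.2.2.2 h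
      · exact absurd hb.2.2.2 h
      · exact absurd (hb.2.2.2.symm.trans hE) h.symm
      · exact hb.2.2.2.symm
    have := key h2 hc
    omega

lemma IsCrossing.ne (P : BPD n w) (h : P.IsCrossing r s) : P.south r s ≠ P.east r s := by
  intro he
  obtain ⟨h1, h2, h3, h4⟩ := h
  obtain ⟨t, h5, h6, -⟩ := P.exists_south_of_east h1
  have h7 := (P.inGrid_of_east h1).2.2.1
  have := P.south_injective h3 (h6.trans (h2.symm.trans he.symm))
  omega

lemma symm_le_of_south (P : BPD n w) (h : P.south r s ≠ 0) : w.symm (P.south r s) ≤ r := by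
  induction r generalizing s with
  | zero => exact absurd (P.inGrid_of_south h).1 (by omega)
  | succ r ih =>
    have hg := P.inGrid_of_south h
    rcases P.exists_north_of_south h with ⟨t, h1, h2, -⟩ | h1
    · rw [Nat.add_sub_cancel] at h2
      have := ih (by rwa [h2])
      rw [h2] at this
      omega
    · rw [← h1 n hg.2.2.2 le_rfl, P.east_boundary _ hg.1 hg.2.1, symm_apply_apply]

/-- Two pipes in the wrong order on a horizontal line cross above it. -/
lemma exists_crossing (P : BPD n w) {s s' : ℕ} (h : P.south r s ≠ 0) (h' : P.south r s' ≠ 0)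
    (hlt : s < s') (hw : w.symm (P.south r s') < w.symm (P.south r s)) :
    ∃ r' j, r' ≤ r ∧ InGrid n r' j ∧ P.IsCrossing r' j ∧
      s(P.east r' j, P.south r' j) = s(P.south r s, P.south r s') := by
  induction r generalizing s s' with
  | zero => exact absurd (P.inGrid_of_south h).1 (by omega)
  | succ r ih =>
    have hg := P.inGrid_of_south h
    have hg' := P.inGrid_of_south h'
    have hcross : P.east (r + 1) (s' - 1) = P.south (r + 1) s →
        ∃ r' j, r' ≤ r + 1 ∧ InGrid n r' j ∧ P.IsCrossing r' j ∧
          s(P.east r' j, P.south r' j) = s(P.south (r + 1) s, P.south (r + 1) s') := by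
      intro he
      have hc := P.isCrossing_of_ne hg' h' (by rwa [he])
      exact ⟨r + 1, s', le_rfl, hg', hc, by rw [hc.2.1, he]⟩
    -- Either the first pipe passes under the second within this row and they cross, or both reach
    -- the next line in the same order. The second pipe cannot leave the grid here while the first
    -- goes on, as it ends in an earlier row.
    rcases P.exists_north_of_south h with ⟨t, h1, h2, h3⟩ | h1
    · by_cases hts : s' ≤ t
      · exact hcross (h3 _ (by omega) (by omega))
      rw [Nat.add_sub_cancel] at h2
      rcases P.exists_north_of_south h' with ⟨t', h1', h2', -⟩ | h1'
      · rw [Nat.add_sub_cancel] at h2'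
        obtain ⟨r', j, h4, h5, h6, h7⟩ := ih (s := t) (s' := t') (by rwa [h2]) (by rwa [h2'])
          (by omega) (by rwa [h2, h2'])
        exact ⟨r', j, by omega, h5, h6, by rw [h7, h2, h2']⟩
      · rw [← h1' n hg'.2.2.2 le_rfl, P.east_boundary _ hg.1 hg.2.1, symm_apply_apply] at hw
        have := P.symm_le_of_south (by rwa [h2] : P.south r t ≠ 0)
        rw [h2] at this
        omega
    · exact hcross (h1 _ (by omega) (by have := hg'.2.2.2; omega))

/-! ### Comparing bumpless pipedreams -/

/-- The south and east edges of a box determine its tile, except that an empty box and a NW elbow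
have both of them free. Hence a pipedream can be reconstructed from the southeast corner once its NW
elbows are known together with their pipes. -/
lemma west_north_eq (hg : InGrid n r s) (hs : P.south r s = P'.south r s)
    (he : P.east r s = P'.east r s) (h : ¬ P.IsNWElbow r s) (h' : ¬ P'.IsNWElbow r s) :
    P.east r (s - 1) = P'.east r (s - 1) ∧ P.south (r - 1) s = P'.south (r - 1) s := by
  have key : ∀ Q : BPD n w, ¬ Q.IsNWElbow r s →
      Q.east r (s - 1) = (if Q.south r s = Q.east r s then 0 else Q.east r s) ∧
      Q.south (r - 1) s = (if Q.south r s = Q.east r s then 0 else Q.south r s) := by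
    intro Q hQ
    rcases Q.tile r s hg with h | h | h | h | h | h
    · simp [h.1, h.2.1, h.2.2.1, h.2.2.2]
    · exact absurd h hQ
    · simp [h.2.1, h.2.2.1, h.2.2.2]
    · have h1 : Q.south r s ≠ Q.east r s := by rw [h.2.2.1, h.2.1]; exact h.1.symm
      rw [if_neg h1, if_neg h1, h.2.1, h.2.2.1, h.2.2.2]
      exact ⟨rfl, rfl⟩
    · have h1 : Q.south r s ≠ Q.east r s := by rw [h.2.2.2]; exact h.1
      rw [if_neg h1, if_neg h1, h.2.1, h.2.2.1, h.2.2.2]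
      exact ⟨rfl, rfl⟩
    · have h1 := IsCrossing.ne Q h
      rw [if_neg h1, if_neg h1, h.2.1, h.2.2.2]
      exact ⟨rfl, rfl⟩
  rw [(key P h).1, (key P h).2, (key P' h').1, (key P' h').2, hs, he]
  exact ⟨rfl, rfl⟩

/-- `P` and `P'` agree on the west and north edges of the boxes that do not precede `(p, c)`. -/
def Agree (P P' : BPD n w) (p c : ℕ) : Prop :=
  ∀ r s, InGrid n r s → ¬ Before r s p c →
    P.east r (s - 1) = P'.east r (s - 1) ∧ P.south (r - 1) s = P'.south (r - 1) s

lemma Agree.south_eq {p c : ℕ} (h : Agree P P' p c) (hg : InGrid n r s)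
    (hb : ¬ Before (r + 1) s p c) : P.south r s = P'.south r s := by
  rcases hg.2.1.lt_or_eq with h1 | rfl
  · exact (h (r + 1) s ⟨by omega, by omega, hg.2.2.1, hg.2.2.2⟩ hb).2
  · rw [P.south_boundary s hg.2.2.1 hg.2.2.2, P'.south_boundary s hg.2.2.1 hg.2.2.2]

lemma Agree.east_eq {p c : ℕ} (h : Agree P P' p c) (hg : InGrid n r s)
    (hb : ¬ Before r (s + 1) p c) : P.east r s = P'.east r s := by
  rcases hg.2.2.2.lt_or_eq with h1 | rfl
  · exact (h r (s + 1) ⟨hg.1, hg.2.1, by omega, by omega⟩ hb).1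
  · rw [P.east_boundary r hg.1 hg.2.1, P'.east_boundary r hg.1 hg.2.1]

lemma Agree.extend {p c p' c' : ℕ} (h : Agree P P' p c)
    (hn : ∀ r s, InGrid n r s → ¬ Before r s p' c' → Before r s p c → Agree P P' r (s + 1) →
      ¬ P.IsNWElbow r s ∧ ¬ P'.IsNWElbow r s) : Agree P P' p' c' := by
  intro r s hg hb
  -- Boxes are treated in reverse reading order; with the weight `n + 1` a row counts more than all
  -- its columns.
  induction hk : (n - r) * (n + 1) + (n - s) using Nat.strong_induction_on generalizing r s with
  | _ k ih =>
    by_cases hb' : Before r s p c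
    · have ha : Agree P P' r (s + 1) := by
        intro r' s' hg' hb''
        refine ih _ ?_ r' s' hg' ?_ rfl
        · have h1 := hg.2.1
          have h2 := hg'.2.1
          have h3 := hg'.2.2.2
          unfold Before at hb''
          rcases (show r' = r ∨ r < r' by omega) with rfl | h4
          · omega
          · have h5 := Nat.mul_le_mul_right (n + 1) (show n - r' + 1 ≤ n - r by omega)
            rw [add_mul, one_mul] at h5
            have h6 : n - s' ≤ n := Nat.sub_le _ _
            have h7 := Nat.zero_le (n - s)
            linarith
        · unfold Before at hb hb'' ⊢; omega
      have hn' := hn r s hg hb hb' ha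
      exact west_north_eq hg (ha.south_eq hg (by unfold Before; omega))
        (ha.east_eq hg (by unfold Before; omega)) hn'.1 hn'.2
    · exact h r s hg hb'

lemma Agree.eq (h : Agree P P' 0 0) : P = P' := by
  have hb : ∀ r s, ¬ Before r s 0 0 := fun r s => by unfold Before; omega
  refine BPD.ext ?_ ?_
  · funext r s
    by_cases hg : InGrid n r s
    · exact h.south_eq hg (hb _ _)
    · rw [P.south_off _ _ hg, P'.south_off _ _ hg]
  · funext r s
    by_cases hg : InGrid n r s
    · exact h.east_eq hg (hb _ _)
    · rw [P.east_off _ _ hg, P'.east_off _ _ hg]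

/-! ### The Rothe pipedream -/

lemma agree_top (P P' : BPD n w) : Agree P P' (n + 1) 1 := fun r s hg hb => by
  have := hg.2.1
  unfold Before at hb
  omega

lemma IsRothe.eq (h : P.IsRothe) (h' : P'.IsRothe) : P = P' :=
  Agree.eq ((agree_top P P').extend fun r s hg _ _ _ => ⟨h r s hg, h' r s hg⟩)

/-- All pipes are hooks: the pipe `w r` goes north in its column, turns at `(r, w r)` and leaves to
the east. -/
lemma exists_isRothe (hw : InSym n w) : ∃ P : BPD n w, P.IsRothe ∧ ∀ r s, InGrid n r s →
    (P.south r s ≠ 0 ↔ w.symm s ≤ r) ∧ (P.east r s ≠ 0 ↔ w r ≤ s) := by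
  classical
  have hsymm : ∀ s, 1 ≤ s → s ≤ n → 1 ≤ w.symm s ∧ w.symm s ≤ n := fun s h1 h2 =>
    hw.symm.mem h1 h2
  have hap : ∀ r, 1 ≤ r → r ≤ n → 1 ≤ w r ∧ w r ≤ n := fun r h1 h2 => hw.mem h1 h2
  set S : ℕ → ℕ → ℕ := fun r s => if 1 ≤ s ∧ s ≤ n ∧ r ≤ n ∧ w.symm s ≤ r then s else 0 with hS
  set E : ℕ → ℕ → ℕ := fun r s => if 1 ≤ r ∧ r ≤ n ∧ s ≤ n ∧ w r ≤ s then w r else 0 with hE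
  have hSn : ∀ {r s}, InGrid n r s → S r s = if w.symm s ≤ r then s else 0 := fun {r s} hg => by
    simp only [hS]
    obtain ⟨h1, h2, h3, h4⟩ := hg
    simp [h2, h3, h4]
  have hEn : ∀ {r s}, InGrid n r s → E r s = if w r ≤ s then w r else 0 := fun {r s} hg => by
    simp only [hE]
    obtain ⟨h1, h2, h3, h4⟩ := hg
    simp [h1, h2, h4]
  have hSn' : ∀ {r s}, InGrid n r s → S (r - 1) s = if w.symm s < r then s else 0 :=
      fun {r s} hg => by
    simp only [hS]
    obtain ⟨h1, h2, h3, h4⟩ := hg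
    congr 1
    simp only [eq_iff_iff]
    omega
  have hEn' : ∀ {r s}, InGrid n r s → E r (s - 1) = if w r < s then w r else 0 :=
      fun {r s} hg => by
    simp only [hE]
    obtain ⟨h1, h2, h3, h4⟩ := hg
    congr 1
    simp only [eq_iff_iff]
    omega
  have hcr : ∀ r s, InGrid n r s → (EdgeLabelling.mk S E).IsCrossing r s →
      S r s = s ∧ E r s = w r ∧ w r < s := by
    rintro r s hg ⟨h1, h2, h3, h4⟩
    simp only [hSn hg, hEn hg, hEn' hg] at h1 h2 h3 ⊢
    have h5 : w r < s := by
      by_contra h5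
      simp [h5] at h1
    have h6 : w.symm s ≤ r := by
      by_contra h6
      simp [h6] at h3
    simp [h6, h5, h5.le]
  refine ⟨⟨⟨S, E⟩, ?_, ?_, ?_, ?_, ?_, ?_⟩, ?_, ?_⟩
  · intro r s hg
    simp only [hS]
    rw [if_neg]
    rintro ⟨h1, h2, h3, h4⟩
    have := hsymm s h1 h2
    exact hg ⟨by omega, h3, h1, h2⟩
  · intro r s hg
    simp only [hE]
    rw [if_neg]
    rintro ⟨h1, h2, h3, h4⟩
    have := hap r h1 h2
    exact hg ⟨h1, h2, by omega, h3⟩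
  · intro s h1 h2
    simp [hS, h1, h2, (hsymm s h1 h2).2]
  · intro r h1 h2
    simp [hE, h1, h2, (hap r h1 h2).2]
  · intro r s hg
    have h1 := hap r hg.1 hg.2.1
    have h2 : w r = s ↔ w.symm s = r := by rw [symm_apply_eq, eq_comm]
    have h3 := hg.2.2.1
    simp only [EdgeLabelling.IsBlank, EdgeLabelling.IsNWElbow, EdgeLabelling.IsSEElbow,
      EdgeLabelling.IsHorizontal, EdgeLabelling.IsVertical, EdgeLabelling.IsCrossing, hSn hg,
      hEn hg, hSn' hg, hEn' hg]
    rcases lt_trichotomy (w r) s with h4 | h4 | h4 <;>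
      rcases lt_trichotomy (w.symm s) r with h5 | h5 | h5 <;> split_ifs <;> omega
  · intro r s r' s' hg hg' hc hc' he
    obtain ⟨h1, h2, h3⟩ := hcr r s hg hc
    obtain ⟨h1', h2', h3'⟩ := hcr r' s' hg' hc'
    simp only [h1, h2, h1', h2', Sym2.eq_iff] at he
    rcases he with ⟨h4, h5⟩ | ⟨h4, h5⟩
    · exact ⟨w.injective h4, h5⟩
    · omega
  · rintro r s hg ⟨h1, -, -, h4⟩
    simp only [hEn' hg, hEn hg] at h1 h4
    have := hap r hg.1 hg.2.1
    split_ifs at h1 h4 <;> omega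
  · intro r s hg
    have := hap r hg.1 hg.2.1
    have := hg.2.2.1
    simp only [hSn hg, hEn hg]
    constructor <;> split_ifs <;> omega

end BPD

end BumplessEG

/-! ### Straight segments and droops -/

namespace BumplessEG

open Equiv

namespace BPD

variable {n : ℕ} {w : Perm ℕ}

lemma east_eq_of_not_elbow (P : BPD n w) {r b d : ℕ}
    (hn : ∀ j, b ≤ j → j ≤ d → ¬ P.IsSEElbow r j) (h : P.east r d ≠ 0) {j : ℕ} (hj : b ≤ j + 1)
    (hjd : j ≤ d) : P.east r j = P.east r d := by
  induction hk : d - j generalizing j with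
  | zero => rw [show j = d by omega]
  | succ k ih =>
    have h1 := ih (j := j + 1) (by omega) (by omega) (by omega)
    have hne : P.east r (j + 1) ≠ 0 := by rwa [h1]
    rcases P.tile r (j + 1) (P.inGrid_of_east hne) with h | h | h | h | h | h
    · exact absurd h.2.2.2 hne
    · exact absurd h.2.2.2 hne
    · exact absurd h (hn _ hj (by omega))
    · rw [← h1, h.2.1, Nat.add_sub_cancel]
    · exact absurd h.2.2.2 hne
    · rw [← h1, h.2.1, Nat.add_sub_cancel]

lemma south_eq_of_not_elbow (P : BPD n w) {s a c : ℕ}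
    (hn : ∀ r, a ≤ r → r ≤ c → ¬ P.IsSEElbow r s) (h : P.south c s ≠ 0) {r : ℕ} (hr : a ≤ r + 1)
    (hrc : r ≤ c) : P.south r s = P.south c s := by
  induction hk : c - r generalizing r with
  | zero => rw [show r = c by omega]
  | succ k ih =>
    have h1 := ih (r := r + 1) (by omega) (by omega) (by omega)
    have hne : P.south (r + 1) s ≠ 0 := by rwa [h1]
    rcases P.tile (r + 1) s (P.inGrid_of_south hne) with h | h | h | h | h | h
    · exact absurd h.2.1 hne
    · exact absurd h.2.2.1 hne
    · exact absurd h (hn _ hr (by omega))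
    · exact absurd h.2.2.1 hne
    · rw [← h1, ← h.2.1, Nat.add_sub_cancel]
    · rw [← h1, ← h.2.2.2, Nat.add_sub_cancel]

/-- The edge labelling obtained by a droop. -/
def droop (P : BPD n w) (a b c d : ℕ) : EdgeLabelling where
  south i j :=
    if a ≤ i ∧ i < c ∧ j = b then 0
    else if a ≤ i ∧ i < c ∧ j = d then P.south a b
    else P.south i j
  east i j :=
    if b ≤ j ∧ j < d ∧ i = a then 0
    else if b ≤ j ∧ j < d ∧ i = c then P.south a b
    else P.east i j

/-- The conditions on the original pipedream under which a droop is possible. -/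
structure CanDroop (P : BPD n w) (a b c d : ℕ) : Prop where
  elbow_mem : InGrid n a b
  box_mem : InGrid n c d
  row_lt : a < c
  col_lt : b < d
  elbow : P.IsSEElbow a b
  box : P.IsBlank c d
  west : ∀ i, a ≤ i → i < c → P.south i b = P.south a b
  north : ∀ j, b ≤ j → j < d → P.east a j = P.south a b
  no_elbow : ∀ i j, a ≤ i → i ≤ c → b ≤ j → j ≤ d → (i, j) ≠ (a, b) →
    ¬ P.IsNWElbow i j ∧ ¬ P.IsSEElbow i j
  free_south : ∀ i, a ≤ i → i < c → P.south i d = 0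
  free_east : ∀ j, b ≤ j → j < d → P.east c j = 0

section

variable {P : BPD n w} {a b c d r j : ℕ}

lemma droop_south_west (h1 : a ≤ r) (h2 : r < c) : (P.droop a b c d).south r b = 0 :=
  if_pos ⟨h1, h2, rfl⟩

lemma droop_south_east (hbd : b < d) (h1 : a ≤ r) (h2 : r < c) :
    (P.droop a b c d).south r d = P.south a b := by
  rw [droop]
  simp only
  rw [if_neg (by omega), if_pos ⟨h1, h2, trivial⟩]

lemma droop_south_of_not (h : ¬ (a ≤ r ∧ r < c ∧ (j = b ∨ j = d))) :
    (P.droop a b c d).south r j = P.south r j := by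
  rw [droop]
  simp only
  rw [if_neg (by omega), if_neg (by omega)]

lemma droop_east_north (h1 : b ≤ j) (h2 : j < d) : (P.droop a b c d).east a j = 0 :=
  if_pos ⟨h1, h2, rfl⟩

lemma droop_east_south (hac : a < c) (h1 : b ≤ j) (h2 : j < d) :
    (P.droop a b c d).east c j = P.south a b := by
  rw [droop]
  simp only
  rw [if_neg (by omega), if_pos ⟨h1, h2, trivial⟩]

lemma droop_east_of_not (h : ¬ (b ≤ j ∧ j < d ∧ (r = a ∨ r = c))) :
    (P.droop a b c d).east r j = P.east r j := by
  rw [droop]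
  simp only
  rw [if_neg (by omega), if_neg (by omega)]

/-- Being on the frame of the rectangle. -/
def OnFrame (a b c d r j : ℕ) : Prop :=
  a ≤ r ∧ r ≤ c ∧ b ≤ j ∧ j ≤ d ∧ (r = a ∨ r = c ∨ j = b ∨ j = d)

lemma droop_of_not_onFrame (hac : a < c) (hbd : b < d) (hr : 1 ≤ r) (hj : 1 ≤ j)
    (h : ¬ OnFrame a b c d r j) :
    (P.droop a b c d).south r j = P.south r j ∧
      (P.droop a b c d).south (r - 1) j = P.south (r - 1) j ∧
      (P.droop a b c d).east r j = P.east r j ∧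
      (P.droop a b c d).east r (j - 1) = P.east r (j - 1) := by
  unfold OnFrame at h
  refine ⟨droop_south_of_not ?_, droop_south_of_not ?_, droop_east_of_not ?_,
    droop_east_of_not ?_⟩ <;> omega

lemma onFrame_cases (h : OnFrame a b c d r j) :
    (r = a ∧ j = b) ∨ (r = c ∧ j = b) ∨ (r = a ∧ j = d) ∨ (r = c ∧ j = d) ∨
      (r = a ∧ b < j ∧ j < d) ∨ (r = c ∧ b < j ∧ j < d) ∨ (j = b ∧ a < r ∧ r < c) ∨
      (j = d ∧ a < r ∧ r < c) := by
  unfold OnFrame at h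
  omega

namespace CanDroop

variable (H : P.CanDroop a b c d)
include H

lemma ne_zero : P.south a b ≠ 0 := H.elbow.1

lemma inGrid (h1 : a ≤ r) (h2 : r ≤ c) (h3 : b ≤ j) (h4 : j ≤ d) : InGrid n r j :=
  ⟨H.elbow_mem.1.trans h1, h2.trans H.box_mem.2.1, H.elbow_mem.2.2.1.trans h3,
    h4.trans H.box_mem.2.2.2⟩

lemma blank_nw : (P.droop a b c d).IsBlank a b := by
  have h1 := H.elbow_mem.1
  have h2 := H.elbow_mem.2.2.1
  refine ⟨?_, droop_south_west le_rfl H.row_lt, ?_, droop_east_north le_rfl H.col_lt⟩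
  · rw [droop_east_of_not (by omega)]; exact H.elbow.2.2.1
  · rw [droop_south_of_not (by omega)]; exact H.elbow.2.2.2

lemma seElbow_sw : (P.droop a b c d).IsSEElbow c b := by
  have h2 := H.elbow_mem.2.2.1
  have hac := H.row_lt
  have hbd := H.col_lt
  have hN := H.west (c - 1) (by omega) (by omega)
  have hE := H.free_east b le_rfl hbd
  have hS : P.south c b = P.south a b ∧ P.east c (b - 1) = 0 := by
    rcases P.tile c b (H.inGrid hac.le le_rfl le_rfl hbd.le) with h | h | h | h | h | h
    · exact absurd (hN.symm.trans h.2.2.1) H.ne_zero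
    · exact absurd h (H.no_elbow c b hac.le le_rfl le_rfl hbd.le (by simp; omega)).1
    · exact absurd (hN.symm.trans h.2.2.2) H.ne_zero
    · exact absurd (hN.symm.trans h.2.2.2) H.ne_zero
    · exact ⟨by rw [← hN, h.2.1], h.2.2.1⟩
    · exact absurd (h.2.1.symm.trans hE) h.1
  have hx := H.ne_zero
  refine ⟨?_, ?_, ?_, droop_south_west (by omega) (by omega)⟩
  · rwa [droop_south_of_not (by omega), hS.1]
  · rw [droop_east_south hac le_rfl hbd, droop_south_of_not (by omega), hS.1]
  · rw [droop_east_of_not (by omega), hS.2]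

lemma seElbow_ne : (P.droop a b c d).IsSEElbow a d := by
  have h1 := H.elbow_mem.1
  have hac := H.row_lt
  have hbd := H.col_lt
  have hW := H.north (d - 1) (by omega) (by omega)
  have hS := H.free_south a le_rfl hac
  have hE : P.east a d = P.south a b ∧ P.south (a - 1) d = 0 := by
    rcases P.tile a d (H.inGrid le_rfl hac.le hbd.le le_rfl) with h | h | h | h | h | h
    · exact absurd (hW.symm.trans h.1) H.ne_zero
    · exact absurd h (H.no_elbow a d le_rfl hac.le hbd.le le_rfl (by simp; omega)).1
    · exact absurd (hW.symm.trans h.2.2.1) H.ne_zero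
    · exact ⟨by rw [← hW, h.2.1], h.2.2.2⟩
    · exact absurd (hW.symm.trans h.2.2.1) H.ne_zero
    · exact absurd hS h.2.2.1
  have hx := H.ne_zero
  refine ⟨?_, ?_, droop_east_north (by omega) (by omega), ?_⟩
  · rwa [droop_south_east hbd le_rfl hac]
  · rw [droop_east_of_not (by omega), hE.1, droop_south_east hbd le_rfl hac]
  · rw [droop_south_of_not (by omega), hE.2]

lemma nwElbow_se : (P.droop a b c d).IsNWElbow c d := by
  have hac := H.row_lt
  have hbd := H.col_lt
  have h1 := H.elbow_mem.1
  have h2 := H.elbow_mem.2.2.1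
  have hx := H.ne_zero
  rw [EdgeLabelling.IsNWElbow, droop_east_south hac (by omega) (by omega),
    droop_south_east hbd (by omega) (by omega), droop_south_of_not (by omega),
    droop_east_of_not (by omega)]
  exact ⟨hx, rfl, H.box.2.1, H.box.2.2.2⟩

lemma north_side (h1 : b < j) (h2 : j < d) :
    (P.droop a b c d).IsBlank a j ∨ (P.droop a b c d).IsVertical a j := by
  have hac := H.row_lt
  have hbd := H.col_lt
  have ha := H.elbow_mem.1
  have hE := H.north j h1.le h2
  have hx := H.ne_zero
  rw [EdgeLabelling.IsBlank, EdgeLabelling.IsVertical, droop_east_north h1.le h2,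
    droop_east_north (by omega) (by omega), droop_south_of_not (by omega),
    droop_south_of_not (by omega)]
  rcases P.tile a j (H.inGrid le_rfl hac.le h1.le h2.le) with h | h | h | h | h | h
  · exact absurd (hE.symm.trans h.2.2.2) hx
  · exact absurd (hE.symm.trans h.2.2.2) hx
  · exact absurd h (H.no_elbow a j le_rfl hac.le h1.le h2.le (by simp; omega)).2
  · exact .inl ⟨rfl, h.2.2.1, h.2.2.2, rfl⟩
  · exact absurd (hE.symm.trans h.2.2.2) hx
  · exact .inr ⟨h.2.2.1, h.2.2.2, rfl, rfl⟩

lemma west_side (h1 : a < r) (h2 : r < c) :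
    (P.droop a b c d).IsBlank r b ∨ (P.droop a b c d).IsHorizontal r b := by
  have hac := H.row_lt
  have hbd := H.col_lt
  have hb := H.elbow_mem.2.2.1
  have hS := H.west r h1.le h2
  have hx := H.ne_zero
  rw [EdgeLabelling.IsBlank, EdgeLabelling.IsHorizontal, droop_south_west h1.le h2,
    droop_south_west (by omega) (by omega), droop_east_of_not (by omega),
    droop_east_of_not (by omega)]
  rcases P.tile r b (H.inGrid h1.le h2.le le_rfl hbd.le) with h | h | h | h | h | h
  · exact absurd (hS.symm.trans h.2.1) hx
  · exact absurd (hS.symm.trans h.2.2.1) hx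
  · exact absurd h (H.no_elbow r b h1.le h2.le le_rfl hbd.le (by simp; omega)).2
  · exact absurd (hS.symm.trans h.2.2.1) hx
  · exact .inl ⟨h.2.2.1, rfl, rfl, h.2.2.2⟩
  · exact .inr ⟨h.1, h.2.1, rfl, rfl⟩

lemma south_side (h1 : b < j) (h2 : j < d) :
    (P.IsBlank c j ∧ (P.droop a b c d).IsHorizontal c j) ∨
      (P.IsVertical c j ∧ (P.droop a b c d).IsCrossing c j) := by
  have hac := H.row_lt
  have hbd := H.col_lt
  have ha := H.elbow_mem.1
  have hE := H.free_east j h1.le h2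
  have hW := H.free_east (j - 1) (by omega) (by omega)
  have hx := H.ne_zero
  rw [EdgeLabelling.IsHorizontal, EdgeLabelling.IsCrossing, droop_east_south hac h1.le h2,
    droop_east_south hac (by omega) (by omega), droop_south_of_not (by omega),
    droop_south_of_not (by omega)]
  rcases P.tile c j (H.inGrid hac.le le_rfl h1.le h2.le) with h | h | h | h | h | h
  · exact .inl ⟨h, hx, rfl, h.2.1, h.2.2.1⟩
  · exact absurd hW h.1
  · exact absurd (h.2.1.symm.trans hE) h.1
  · exact absurd hW h.1
  · exact .inr ⟨h, hx, rfl, h.1, h.2.1⟩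
  · exact absurd hW h.1

lemma east_side (h1 : a < r) (h2 : r < c) :
    (P.IsBlank r d ∧ (P.droop a b c d).IsVertical r d) ∨
      (P.IsHorizontal r d ∧ (P.droop a b c d).IsCrossing r d) := by
  have hac := H.row_lt
  have hbd := H.col_lt
  have hb := H.elbow_mem.2.2.1
  have hS := H.free_south r h1.le h2
  have hN := H.free_south (r - 1) (by omega) (by omega)
  have hx := H.ne_zero
  rw [EdgeLabelling.IsVertical, EdgeLabelling.IsCrossing, droop_south_east hbd h1.le h2,
    droop_south_east hbd (by omega) (by omega), droop_east_of_not (by omega),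
    droop_east_of_not (by omega)]
  rcases P.tile r d (H.inGrid h1.le h2.le hbd.le le_rfl) with h | h | h | h | h | h
  · exact .inl ⟨h, hx, rfl, h.1, h.2.2.2⟩
  · exact absurd (h.2.1.symm.trans hN) h.1
  · exact absurd hS h.1
  · exact .inr ⟨h, h.1, h.2.1, hx, rfl⟩
  · exact absurd hS h.1
  · exact absurd hS h.2.2.1

lemma tile (r j : ℕ) (hg : InGrid n r j) :
    (P.droop a b c d).IsBlank r j ∨ (P.droop a b c d).IsNWElbow r j ∨
    (P.droop a b c d).IsSEElbow r j ∨ (P.droop a b c d).IsHorizontal r j ∨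
    (P.droop a b c d).IsVertical r j ∨ (P.droop a b c d).IsCrossing r j := by
  by_cases hf : OnFrame a b c d r j
  · rcases onFrame_cases hf with ⟨rfl, rfl⟩ | ⟨rfl, rfl⟩ | ⟨rfl, rfl⟩ | ⟨rfl, rfl⟩ |
      ⟨rfl, h1, h2⟩ | ⟨rfl, h1, h2⟩ | ⟨rfl, h1, h2⟩ | ⟨rfl, h1, h2⟩
    · exact .inl H.blank_nw
    · exact .inr (.inr (.inl H.seElbow_sw))
    · exact .inr (.inr (.inl H.seElbow_ne))
    · exact .inr (.inl H.nwElbow_se)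
    · have := H.north_side h1 h2; tauto
    · have := H.south_side h1 h2; tauto
    · have := H.west_side h1 h2; tauto
    · have := H.east_side h1 h2; tauto
  · obtain ⟨h1, h2, h3, h4⟩ := droop_of_not_onFrame (P := P) H.row_lt H.col_lt hg.1 hg.2.2.1 hf
    simp only [EdgeLabelling.IsBlank, EdgeLabelling.IsNWElbow, EdgeLabelling.IsSEElbow,
      EdgeLabelling.IsHorizontal, EdgeLabelling.IsVertical, EdgeLabelling.IsCrossing, h1, h2, h3,
      h4]
    exact P.tile r j hg

/-- The crossings after a droop come from crossings of the same pipes before. -/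
lemma exists_isCrossing (hg : InGrid n r j) (hc : (P.droop a b c d).IsCrossing r j) :
    ∃ r₀ j₀, InGrid n r₀ j₀ ∧ P.IsCrossing r₀ j₀ ∧
      s(P.east r₀ j₀, P.south r₀ j₀) =
        s((P.droop a b c d).east r j, (P.droop a b c d).south r j) ∧
      (r, j) = if j₀ = b ∧ a < r₀ ∧ r₀ < c then (r₀, d)
        else if r₀ = a ∧ b < j₀ ∧ j₀ < d then (c, j₀) else (r₀, j₀) := by
  have hac := H.row_lt
  have hbd := H.col_lt
  have ha := H.elbow_mem.1
  have hb := H.elbow_mem.2.2.1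
  by_cases hf : OnFrame a b c d r j
  · rcases onFrame_cases hf with ⟨rfl, rfl⟩ | ⟨rfl, rfl⟩ | ⟨rfl, rfl⟩ | ⟨rfl, rfl⟩ |
      ⟨rfl, h1, h2⟩ | ⟨rfl, h1, h2⟩ | ⟨rfl, h1, h2⟩ | ⟨rfl, h1, h2⟩
    · exact absurd H.blank_nw.1 hc.1
    · exact absurd H.seElbow_sw.2.2.1 hc.1
    · exact absurd H.seElbow_ne.2.2.1 hc.1
    · exact absurd H.nwElbow_se.2.2.1 hc.2.2.1
    · rcases H.north_side h1 h2 with h | h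
      · exact absurd h.1 hc.1
      · exact absurd h.2.2.1 hc.1
    · rcases H.south_side h1 h2 with h | h
      · exact absurd h.2.2.2.1 hc.2.2.1
      · have hS := h.1.1
        -- Without elbows inside the rectangle, the vertical pipe crossing the new south side runs
        -- straight up and has crossed the old north side in the same column.
        have key : ∀ i, a ≤ i + 1 → i ≤ r → P.south i j = P.south r j := fun i hi hi' =>
          P.south_eq_of_not_elbow (a := a) (fun i hi hi' =>
            (H.no_elbow i j hi hi' h1.le h2.le (by simp; omega)).2) hS hi hi'
        have hE := H.north j h1.le h2
        have hW := H.north (j - 1) (by omega) (by omega)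
        have hx := H.ne_zero
        have hSa := key a (by omega) hac.le
        have hNa := key (a - 1) (by omega) (by omega)
        refine ⟨a, j, H.inGrid le_rfl hac.le h1.le h2.le, ⟨by rwa [hW], by rw [hE, hW],
          by rwa [hSa], by rw [hNa, hSa]⟩, ?_, ?_⟩
        · rw [hE, hSa, droop_east_south hac h1.le h2, droop_south_of_not (by omega)]
        · rw [if_neg (by omega), if_pos (by omega)]
    · rcases H.west_side h1 h2 with h | h
      · exact absurd h.2.1 hc.2.2.1
      · exact absurd h.2.2.1 hc.2.2.1
    · rcases H.east_side h1 h2 with h | h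
      · exact absurd h.2.2.2.1 hc.1
      · have hE : P.east r j ≠ 0 := by rw [h.1.2.1]; exact h.1.1
        have key : ∀ i, b ≤ i + 1 → i ≤ j → P.east r i = P.east r j := fun i hi hi' =>
          P.east_eq_of_not_elbow (b := b) (fun i hi hi' =>
            (H.no_elbow r i h1.le h2.le hi hi' (by simp; omega)).2) hE hi hi'
        have hS := H.west r h1.le h2
        have hN := H.west (r - 1) (by omega) (by omega)
        have hx := H.ne_zero
        have hEb := key b (by omega) hbd.le
        have hWb := key (b - 1) (by omega) (by omega)
        refine ⟨r, b, H.inGrid h1.le h2.le le_rfl hbd.le, ⟨by rwa [hWb], by rw [hEb, hWb],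
          by rwa [hS], by rw [hN, hS]⟩, ?_, ?_⟩
        · rw [hEb, hS, droop_south_east hbd h1.le h2, droop_east_of_not (by omega)]
        · rw [if_pos (by omega)]
  · obtain ⟨h1, h2, h3, h4⟩ := droop_of_not_onFrame (P := P) hac hbd hg.1 hg.2.2.1 hf
    rw [EdgeLabelling.IsCrossing, h1, h2, h3, h4] at hc
    refine ⟨r, j, hg, hc, by rw [h1, h3], ?_⟩
    unfold OnFrame at hf
    rw [if_neg (by omega), if_neg (by omega)]

/-- A droop is always possible under the stated conditions. -/
theorem exists_isDroop : ∃ P' : BPD n w, IsDroop P P' a b c d := by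
  have hac := H.row_lt
  have hbd := H.col_lt
  refine ⟨⟨P.droop a b c d, ?_, ?_, ?_, ?_, H.tile, ?_⟩, H.elbow_mem, H.box_mem, hac, hbd, H.elbow,
    H.box, H.west, H.north, H.no_elbow, H.free_south, H.free_east, fun _ _ => rfl, fun _ _ => rfl⟩
  · intro r j hg
    rw [droop_south_of_not, P.south_off r j hg]
    rintro ⟨h1, h2, h3⟩
    exact hg (H.inGrid h1 h2.le (by omega) (by omega))
  · intro r j hg
    rw [droop_east_of_not, P.east_off r j hg]
    rintro ⟨h1, h2, h3⟩
    exact hg (H.inGrid (by omega) (by omega) h1 h2.le)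
  · intro j h1 h2
    have := H.box_mem.2.1
    rw [droop_south_of_not (by omega), P.south_boundary j h1 h2]
  · intro r h1 h2
    have := H.box_mem.2.2.2
    rw [droop_east_of_not (by omega), P.east_boundary r h1 h2]
  · intro r j r' j' hg hg' hc hc' he
    obtain ⟨r₀, j₀, h1, h2, h3, h4⟩ := H.exists_isCrossing hg hc
    obtain ⟨r₀', j₀', h1', h2', h3', h4'⟩ := H.exists_isCrossing hg' hc'
    -- The place of a crossing after the droop is a function of its place before, so a second
    -- crossing of the same pipes cannot arise.
    obtain ⟨rfl, rfl⟩ := P.cross_once r₀ j₀ r₀' j₀' h1 h1' h2 h2' (by rw [h3, h3', he])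
    rw [← h4'] at h4
    exact Prod.ext_iff.1 h4

end CanDroop

end

end BPD

end BumplessEG

namespace BumplessEG

open Equiv

/-! ### Transitions -/

lemma exists_isTransition {n : ℕ} {u : Perm ℕ} (h : ¬ IsDominant n u) :
    ∃ p q, IsTransition n u p q := by
  have key : ∀ S : Set ℕ, S.Nonempty → (∀ x ∈ S, x ≤ n) → ∃ m, IsGreatest S m := fun S hS hb =>
    ⟨sSup S, Nat.sSup_mem hS ⟨n, hb⟩, fun x hx => le_csSup ⟨n, hb⟩ hx⟩
  rw [IsDominant, not_not] at h
  obtain ⟨i, t, j, h1, h2, h3, h4, h5, h6⟩ := h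
  obtain ⟨p, hp⟩ := key {t | ∃ i j, 1 ≤ i ∧ i < t ∧ t < j ∧ j ≤ n ∧ u i < u j ∧ u j < u t}
    ⟨t, i, j, h1, h2, h3, h4, h5, h6⟩ (by rintro t ⟨i, j, -, -, h3, h4, -⟩; omega)
  obtain ⟨i', j', h1', h2', h3', h4', h5', h6'⟩ := hp.1
  obtain ⟨q, hq⟩ := key {j | p < j ∧ j ≤ n ∧ u j < u p ∧ ∃ i, 1 ≤ i ∧ i < p ∧ u i < u j}
    ⟨j', h3', h4', h6', i', h1', h2', h5'⟩ (by rintro j ⟨-, h, -⟩; exact h)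
  exact ⟨p, q, hp, hq⟩

namespace IsTransition

variable {n : ℕ} {u : Perm ℕ} {p q : ℕ} (ht : IsTransition n u p q)
include ht

lemma lt : p < q := ht.2.1.1

lemma le : q ≤ n := ht.2.1.2.1

lemma apply_lt : u q < u p := ht.2.1.2.2.1

lemma exists_lt : ∃ i, 1 ≤ i ∧ i < p ∧ u i < u q := ht.2.1.2.2.2

lemma one_lt : 1 < p := by
  obtain ⟨i, h1, h2, -⟩ := ht.exists_lt
  omega

lemma no_pattern {i r j : ℕ} (hr : p < r) (hi : 1 ≤ i) (hir : i < r) (hrj : r < j) (hj : j ≤ n)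
    (h1 : u i < u j) : u r ≤ u j := by
  by_contra! h2
  have := ht.1.2 ⟨i, j, hi, hir, hrj, hj, h1, h2⟩
  omega

/-- An entry strictly between `u q` and `u p` at a position after `p` contradicts the choice of `q`
if it comes after `q`, and is the "3" of a later pattern if it comes before `q`. -/
lemma no_between {j : ℕ} (hpj : p < j) (hj : j ≤ n) (h1 : u q < u j) : u p ≤ u j := by
  by_contra! h2
  obtain ⟨i, hi, hip, hiq⟩ := ht.exists_lt
  have hjq : j ≤ q := ht.2.2 ⟨hpj, hj, h2, i, hi, hip, by omega⟩
  rcases hjq.lt_or_eq with h3 | rfl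
  · have := ht.no_pattern hpj hi (by omega) h3 ht.le hiq
    omega
  · omega

lemma not_isDominant : ¬ IsDominant n u := fun hd => by
  obtain ⟨i, h1, h2, h3⟩ := ht.exists_lt
  exact hd ⟨i, p, q, h1, h2, ht.lt, ht.le, h3, ht.apply_lt⟩

lemma unique {p' q' : ℕ} (ht' : IsTransition n u p' q') : p = p' ∧ q = q' := by
  obtain rfl := ht.1.unique ht'.1
  exact ⟨rfl, ht.2.unique ht'.2⟩

lemma inSym_left (hu : InSym n u) : InSym n (u * swap p q) := by
  have := ht.one_lt
  have := ht.lt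
  have := ht.le
  exact hu.mul (inSym_swap (by omega) (by omega) (by omega) (by omega))

lemma inv_eq (hu : InSym n u) : inv (u * swap p q * swap p q) = inv (u * swap p q) + 1 := by
  have hlt := ht.lt
  have hle := ht.le
  rw [inv_mul_swap_eq_iff (ht.inSym_left hu).finSupp hlt]
  refine ⟨by simpa using ht.apply_lt, fun k h1 h2 h3 => ?_⟩
  simp only [Perm.mul_apply, swap_apply_left, swap_apply_right,
    swap_apply_of_ne_of_ne (show k ≠ p by omega) (show k ≠ q by omega)] at h3
  have := ht.no_between h1 (by omega) h3.1
  omega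

/-- By `no_between`, the entry at another such `q'` would exceed `u p`. If `q' < q` it is the "3" of
a pattern after `p`; if `q < q'`, the entry `u p`, now at position `q`, lies in between and destroys
the cover. -/
lemma eq_of_inv_eq (hu : InSym n u) {q' : ℕ} (h1 : p < q') (h2 : q' ≤ n)
    (h : inv (u * swap p q * swap p q') = inv (u * swap p q) + 1) : q' = q := by
  have hlt := ht.lt
  have hle := ht.le
  have hap := ht.apply_lt
  rw [inv_mul_swap_eq_iff (ht.inSym_left hu).finSupp h1] at h
  by_contra hne
  simp only [Perm.mul_apply, swap_apply_left,
    swap_apply_of_ne_of_ne (show q' ≠ p by omega) hne] at h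
  have h3 := ht.no_between h1 h2 h.1
  have h4 := u.injective.ne (show q' ≠ p by omega)
  rcases (show q' < q ∨ q < q' by omega) with h5 | h5
  · obtain ⟨i, hi, hip, hiq⟩ := ht.exists_lt
    have := ht.no_pattern h1 hi (by omega) h5 hle hiq
    omega
  · exact h.2 q hlt h5 (by rw [swap_apply_right]; omega)

lemma mem_coverSet_iff (hu : InSym n u) {i : ℕ} : i ∈ coverSet (u * swap p q) p ↔
    1 ≤ i ∧ i < p ∧ u i < u q ∧ ∀ k, i < k → k < p → ¬ (u i < u k ∧ u k < u q) := by
  have hlt := ht.lt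
  have hy := ht.inSym_left hu
  have hne : ∀ {k}, k < p → (u * swap p q) k = u k := fun {k} hk => by
    rw [Perm.mul_apply, swap_apply_of_ne_of_ne (by omega) (by omega)]
  rw [BumplessEG.mem_coverSet_iff hy.finSupp hy.zero]
  refine and_congr_right fun h1 => and_congr_right fun h2 => ?_
  rw [inv_mul_swap_eq_iff hy.finSupp h2, hne h2, Perm.mul_apply, swap_apply_left]
  refine and_congr_right fun _ => forall_congr' fun k => forall_congr' fun h3 =>
    forall_congr' fun h4 => ?_
  rw [hne h4]

lemma isStep (hu : InSym n u) {i : ℕ} (hi : i ∈ coverSet (u * swap p q) p) :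
    IsStep n (u * swap p q) i p q := by
  have hy := ht.inSym_left hu
  have := (BumplessEG.mem_coverSet_iff hy.finSupp hy.zero).1 hi
  exact ⟨hy, this.1, this.2.1, ht.lt, ht.le, this.2.2, ht.inv_eq hu⟩

lemma hasBelow : HasBelow (u * swap p q) p := by
  obtain ⟨i, h1, h2, h3⟩ := ht.exists_lt
  have hlt := ht.lt
  refine ⟨i, h1, h2, ?_⟩
  rw [Perm.mul_apply, swap_apply_of_ne_of_ne (by omega) (by omega), Perm.mul_apply,
    swap_apply_left]
  exact h3

lemma inRothe : InRothe u p (u q) := ⟨ht.apply_lt, by simpa using ht.lt⟩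

end IsTransition

/-- The child of `u` in the modified Lascoux–Schützenberger tree. -/
def child (u : Perm ℕ) (p q i : ℕ) : Perm ℕ := u * swap p q * swap i p

section child

variable {n : ℕ} {u : Perm ℕ} {p q i : ℕ}

lemma child_apply (hip : i < p) (hpq : p < q) (r : ℕ) : child u p q i r =
    if r = i then u q else if r = p then u i else if r = q then u p else u r := by
  simp only [child, Perm.mul_apply, swap_apply_def]
  split_ifs <;> first | rfl | omega

lemma child_symm (hip : i < p) (hpq : p < q) (s : ℕ) : (child u p q i).symm s =
    if s = u q then i else if s = u i then p else if s = u p then q else u.symm s := by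
  have h1 : (child u p q i).symm s = swap i p (swap p q (u.symm s)) := rfl
  rw [h1]
  have h2 : ∀ k, u.symm s = k ↔ s = u k := fun k => by rw [symm_apply_eq]
  simp only [← h2, swap_apply_def]
  split_ifs <;> omega

variable (hu : InSym n u) (ht : IsTransition n u p q) (hi : i ∈ coverSet (u * swap p q) p)
include hu ht hi

lemma inSym_child : InSym n (child u p q i) := (ht.isStep hu hi).inSym_left

/-- In this region the diagrams could differ only in the rows `p` and `q` and in the columns `u q`
and `u p`; `no_between` and `no_pattern` exclude the boxes in question. -/
lemma inRothe_child_iff {r s : ℕ} (h : p < r ∨ r = p ∧ u q < s) :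
    InRothe (child u p q i) r s ↔ InRothe u r s := by
  obtain ⟨hi1, hip, hiq, -⟩ := (ht.mem_coverSet_iff hu).1 hi
  have hpq := ht.lt
  have hqn := ht.le
  have hap := ht.apply_lt
  have hsymm : ∀ k, u.symm s = k ↔ s = u k := fun k => by rw [symm_apply_eq]
  have hle : InRothe u r s → u.symm s ≤ n := fun h => (h.le hu).2.2
  have hle' : InRothe (child u p q i) r s → (child u p q i).symm s ≤ n :=
    fun h => (h.le (inSym_child hu ht hi)).2.2
  rw [InRothe, child_symm hip hpq] at hle'
  rw [InRothe, InRothe, child_apply hip hpq, child_symm hip hpq]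
  rw [child_apply hip hpq] at hle'
  have nb : p < u.symm s → u.symm s ≤ n → u q < s → u p ≤ s := fun h1 h2 h3 => by
    have := ht.no_between h1 h2 (by rwa [apply_symm_apply])
    rwa [apply_symm_apply] at this
  rcases h with h | ⟨rfl, h⟩
  · rw [if_neg (by omega), if_neg (by omega)] at hle' ⊢
    by_cases hrq : r = q
    · subst hrq
      rw [if_pos rfl] at hle' ⊢
      rw [InRothe] at hle
      have h3 := hsymm r
      have h4 := hsymm i
      have h5 := hsymm p
      split_ifs at hle' ⊢ <;> omega
    · rw [if_neg hrq] at hle' ⊢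
      have h3 := hsymm q
      have h4 := hsymm i
      have h5 := hsymm p
      have npq : r < q → u r ≤ u q := fun hrq =>
        ht.no_pattern h hi1 (by omega) hrq hqn hiq
      split_ifs at hle' ⊢ <;> omega
  · rw [if_neg (by omega), if_pos rfl]
    constructor
    · rintro ⟨h1, -⟩; omega
    · intro h1
      have h2 := hle h1
      have := nb h1.2 h2 h
      omega

/-- Row `p` of the child has no boxes this far to the right. In a later row, a smaller entry above
the box would give a 132-pattern of `u` whose "3" comes after `p`. -/
lemma isolated_child {r s j : ℕ} (h : p < r ∨ r = p ∧ u q ≤ s)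
    (hrs : InRothe (child u p q i) r s) (hj : 1 ≤ j) (hjr : j < r) :
    s ≤ child u p q i j := by
  obtain ⟨hi1, hip, hiq, -⟩ := (ht.mem_coverSet_iff hu).1 hi
  have hpq := ht.lt
  have hap := ht.apply_lt
  by_contra! hlt
  rcases h with h | ⟨rfl, h⟩
  · have h1 := (inRothe_child_iff hu ht hi (.inl h)).1 hrs
    obtain ⟨h2, h3⟩ := h1
    have hle := (InRothe.le hu ⟨h2, h3⟩).2.2
    have key : ∀ k, 1 ≤ k → k < r → ¬ u k < s := fun k hk hkr hks => by
      have := ht.no_pattern h hk hkr h3 hle (by rwa [apply_symm_apply])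
      rw [apply_symm_apply] at this
      omega
    rw [child_apply hip hpq] at hlt
    have k1 := key i hi1 (by omega)
    have k2 := key p (by omega) h
    split_ifs at hlt with h4 h5 h6
    · omega
    · omega
    · omega
    · exact key j hj hjr hlt
  · have := hrs.1
    rw [child_apply hip hpq, if_neg (by omega), if_pos rfl] at this
    omega

end child

/-! ### Pipedreams matching a label of the tree -/

namespace BPD

variable {n : ℕ} {w : Perm ℕ} {P P' : BPD n w} {u : Perm ℕ} {p c : ℕ}

/-- Before the box `(p, c)`, the pipedream `P` has the tiles of the Rothe pipedream of `u`; from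
there on its empty boxes are those of the Rothe diagram of `u`, and they do not give rise to
`132`-patterns. -/
structure Matches (P : BPD n w) (u : Perm ℕ) (p c : ℕ) : Prop where
  inSym : InSym n u
  south : ∀ r s, InGrid n r s → Before r s p c → (P.south r s ≠ 0 ↔ u.symm s ≤ r)
  east : ∀ r s, InGrid n r s → Before r s p c → (P.east r s ≠ 0 ↔ u r ≤ s)
  blank : ∀ r s, InGrid n r s → ¬ Before r s p c → (P.IsBlank r s ↔ InRothe u r s)
  isolated : ∀ r s i, ¬ Before r s p c → InRothe u r s → 1 ≤ i → i < r → s ≤ u i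

lemma IsRothe.matches (h : P.IsRothe) (hw : InSym n w) : P.Matches w (n + 1) 1 := by
  obtain ⟨P', h1, h2⟩ := exists_isRothe hw
  obtain rfl := h.eq h1
  refine ⟨hw, fun r s hg _ => (h2 r s hg).1, fun r s hg _ => (h2 r s hg).2, fun r s hg hb => ?_,
    fun r s i hb hr => ?_⟩
  · have := hg.2.1
    unfold Before at hb
    omega
  · have := (hr.le hw).1
    unfold Before at hb
    omega

namespace Matches

variable (h : P.Matches u p c) {r s : ℕ}
include h

lemma north (hg : InGrid n r s) (hb : Before r s p c) :
    P.south (r - 1) s ≠ 0 ↔ u.symm s < r := by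
  have h1 := hg.1
  rcases (show r = 1 ∨ 2 ≤ r by omega) with rfl | hr
  · have := h.inSym.symm.mem hg.2.2.1 hg.2.2.2
    rw [P.south_off _ _ (fun hg => by have := hg.1; omega)]
    omega
  · rw [h.south (r - 1) s ⟨by omega, by have := hg.2.1; omega, hg.2.2.1, hg.2.2.2⟩
      (by unfold Before at hb ⊢; omega)]
    omega

lemma west (hg : InGrid n r s) (hb : Before r s p c) : P.east r (s - 1) ≠ 0 ↔ u r < s := by
  have h1 := hg.2.2.1
  rcases (show s = 1 ∨ 2 ≤ s by omega) with rfl | hr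
  · have := h.inSym.mem hg.1 hg.2.1
    rw [P.east_off _ _ (fun hg => by have := hg.2.2.1; omega)]
    omega
  · rw [h.east r (s - 1) ⟨hg.1, hg.2.1, by omega, by have := hg.2.2.2; omega⟩
      (by unfold Before at hb ⊢; omega)]
    omega

lemma isBlank_iff (hg : InGrid n r s) : P.IsBlank r s ↔ InRothe u r s := by
  by_cases hb : Before r s p c
  · have h1 := h.north hg hb
    have h2 := h.west hg hb
    have h3 := h.south r s hg hb
    have h4 := h.east r s hg hb
    rw [EdgeLabelling.IsBlank, InRothe]
    omega
  · exact h.blank r s hg hb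

lemma not_isNWElbow (hg : InGrid n r s) (hb : Before r s p c) : ¬ P.IsNWElbow r s := by
  rintro ⟨h1, -, -, h4⟩
  rw [h.west hg hb] at h1
  have := (h.east r s hg hb).2 h1.le
  exact this h4

lemma isSEElbow_iff (hg : InGrid n r s) (hb : Before r s p c) : P.IsSEElbow r s ↔ u r = s := by
  have h1 := h.north hg hb
  have h2 := h.west hg hb
  have h3 := h.south r s hg hb
  have h4 := h.east r s hg hb
  have h5 : u.symm s = r ↔ s = u r := symm_apply_eq u
  constructor
  · rintro ⟨k1, k2, k3, k4⟩
    rw [k2] at h4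
    omega
  · intro he
    rcases P.tile r s hg with k | k | k | k | k | k
    · exact absurd k.2.1 (h3.2 (by omega))
    · exact absurd k (h.not_isNWElbow hg hb)
    · exact k
    · exact absurd (h2.1 k.1) (by omega)
    · exact absurd k.2.2.2 (h4.2 (by omega))
    · exact absurd (h2.1 k.1) (by omega)

end Matches

variable {q i : ℕ}

/-- The box `(p₀, u q₀)` belongs to a 132-pattern, which boxes from the frontier on do not. So each
step moves the frontier strictly back, which is why the process ends. -/
lemma Matches.before (h : P.Matches u p c) {p₀ q₀ : ℕ} (ht : IsTransition n u p₀ q₀) :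
    Before p₀ (u q₀) p c := by
  obtain ⟨i, h1, h2, h3⟩ := ht.exists_lt
  by_contra hb
  have := h.isolated _ _ i hb ht.inRothe h1 h2
  omega

/-- Before the frontier there are no NW elbows, and the SE elbows are the dots `(r, u r)`. The
covering condition says that the rectangle contains no dot but `(i, u i)`. -/
lemma Matches.canDroop {p₀ c₀ : ℕ} (h : P.Matches u p₀ c₀) (ht : IsTransition n u p q)
    (hi : i ∈ coverSet (u * swap p q) p) : P.CanDroop i (u i) p (u q) := by
  obtain ⟨hi1, hip, hiq, hcov⟩ := (ht.mem_coverSet_iff h.inSym).1 hi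
  have hpq := ht.lt
  have hqn := ht.le
  have hap := ht.apply_lt
  have hmi := h.inSym.mem hi1 (by omega)
  have hmq := h.inSym.mem (i := q) (by omega) hqn
  have hbt := h.before ht
  have hg : ∀ {r s}, i ≤ r → r ≤ p → u i ≤ s → s ≤ u q → InGrid n r s ∧ Before r s p₀ c₀ :=
    fun {r s} h1 h2 h3 h4 => by unfold InGrid Before at *; omega
  have hse : ∀ {r s}, i ≤ r → r ≤ p → u i ≤ s → s ≤ u q → (r, s) ≠ (i, u i) →
      ¬ P.IsSEElbow r s := fun {r s} h1 h2 h3 h4 h5 h6 => by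
    obtain ⟨hg1, hb1⟩ := hg h1 h2 h3 h4
    rw [h.isSEElbow_iff hg1 hb1] at h6
    have hri : r ≠ i := by rintro rfl; exact h5 (by rw [h6])
    have hrp : r ≠ p := by rintro rfl; omega
    have e1 := u.injective.ne hri
    have e2 := u.injective.ne (show r ≠ q by omega)
    exact hcov r (by omega) (by omega) ⟨by omega, by omega⟩
  have hel : P.IsSEElbow i (u i) :=
    (h.isSEElbow_iff (hg le_rfl hip.le le_rfl hiq.le).1 (hg le_rfl hip.le le_rfl hiq.le).2).2 rfl
  refine ⟨(hg le_rfl hip.le le_rfl hiq.le).1, (hg hip.le le_rfl hiq.le le_rfl).1, hip, hiq, hel,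
    ?_, ?_, ?_, ?_, ?_, ?_⟩
  · rw [h.isBlank_iff (hg hip.le le_rfl hiq.le le_rfl).1]
    exact ht.inRothe
  · intro r h1 h2
    obtain ⟨k1, k2⟩ := hg (s := u i) (show i ≤ p - 1 by omega) (by omega) le_rfl hiq.le
    have hne : P.south (p - 1) (u i) ≠ 0 := by
      rw [h.south _ _ k1 k2, symm_apply_apply]
      omega
    have key := fun r hr hr' => P.south_eq_of_not_elbow (s := u i) (a := i + 1) (c := p - 1)
      (fun r h1 h2 => hse (by omega) (by omega) le_rfl hiq.le (by simp; omega)) hne (r := r) hr hr'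
    rw [key r (by omega) (by omega), key i (by omega) (by omega)]
  · intro s h1 h2
    obtain ⟨k1, k2⟩ := hg (r := i) (s := u q - 1) le_rfl hip.le (by omega) (by omega)
    have hne : P.east i (u q - 1) ≠ 0 := by
      rw [h.east _ _ k1 k2]
      omega
    have key := fun s hs hs' => P.east_eq_of_not_elbow (r := i) (b := u i + 1) (d := u q - 1)
      (fun s h1 h2 => hse le_rfl hip.le (by omega) (by omega) (by simp; omega)) hne (j := s) hs hs'
    rw [key s (by omega) (by omega), ← hel.2.1, key (u i) (by omega) (by omega)]
  · intro r s h1 h2 h3 h4 h5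
    exact ⟨h.not_isNWElbow (hg h1 h2 h3 h4).1 (hg h1 h2 h3 h4).2, hse h1 h2 h3 h4 h5⟩
  · intro r h1 h2
    obtain ⟨k1, k2⟩ := hg h1 h2.le hiq.le le_rfl
    by_contra hne
    rw [← ne_eq, h.south _ _ k1 k2, symm_apply_apply] at hne
    omega
  · intro s h1 h2
    obtain ⟨k1, k2⟩ := hg hip.le le_rfl h1 h2.le
    by_contra hne
    rw [← ne_eq, h.east _ _ k1 k2] at hne
    omega

namespace IsDroop

variable {a b d r s : ℕ}

lemma unique {P'' : BPD n w} (h : IsDroop P P' a b c d) (h' : IsDroop P P'' a b c d) :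
    P' = P'' := by
  refine BPD.ext ?_ ?_
  · funext r s
    rw [h.new_south, h'.new_south]
  · funext r s
    rw [h.new_east, h'.new_east]

lemma edges_eq (h : IsDroop P P' a b c d) (hr : 1 ≤ r) (hs : 1 ≤ s)
    (hrs : ¬ (a ≤ r ∧ r ≤ c ∧ b ≤ s ∧ s ≤ d)) :
    P'.south r s = P.south r s ∧ P'.south (r - 1) s = P.south (r - 1) s ∧
      P'.east r s = P.east r s ∧ P'.east r (s - 1) = P.east r (s - 1) := by
  have := h.row_lt
  have := h.col_lt
  simp only [h.new_south, h.new_east]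
  refine ⟨?_, ?_, ?_, ?_⟩ <;> rw [if_neg (by omega), if_neg (by omega)]

lemma isNWElbow (h : IsDroop P P' a b c d) : P'.IsNWElbow c d ∧ P'.east c (d - 1) = P.south a b := by
  have h1 := h.row_lt
  have h2 := h.col_lt
  have h3 : P'.east c (d - 1) = P.south a b := by
    rw [h.new_east, if_neg (by omega), if_pos (by omega)]
  have h4 : P'.south (c - 1) d = P.south a b := by
    rw [h.new_south, if_neg (by omega), if_pos (by omega)]
  refine ⟨⟨by rw [h3]; exact h.elbow.1, by rw [h3, h4], ?_, ?_⟩, h3⟩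
  · rw [h.new_south, if_neg (by omega), if_neg (by omega), h.box.2.1]
  · rw [h.new_east, if_neg (by omega), if_neg (by omega), h.box.2.2.2]

end IsDroop

lemma Matches.droop {p₀ c₀ : ℕ} (h : P.Matches u p₀ c₀) (ht : IsTransition n u p q)
    (hi : i ∈ coverSet (u * swap p q) p) (hd : IsDroop P P' i (u i) p (u q)) :
    P'.Matches (child u p q i) p (u q) := by
  have hu := h.inSym
  obtain ⟨hi1, hip, hiq, hcov⟩ := (ht.mem_coverSet_iff h.inSym).1 hi
  have hpq := ht.lt
  have hqn := ht.le
  have hap := ht.apply_lt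
  have hbt := h.before ht
  have hb : ∀ {r s}, Before r s p (u q) → Before r s p₀ c₀ := fun hrs => by
    unfold Before at *; omega
  have hx := hd.elbow.1
  refine ⟨inSym_child hu ht hi, fun r s hg hrs => ?_, fun r s hg hrs => ?_, fun r s hg hrs => ?_,
    fun r s j hrs => ?_⟩
  · have h1 := h.south r s hg (hb hrs)
    have h2 : ∀ k, u.symm s = k ↔ s = u k := fun k => by rw [symm_apply_eq]
    have h3 := h2 q
    have h4 := h2 i
    have h5 := h2 p
    rw [hd.new_south, child_symm hip hpq]
    unfold Before at hrs
    split_ifs <;> omega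
  · have h1 := h.east r s hg (hb hrs)
    rw [hd.new_east, child_apply hip hpq]
    unfold Before at hrs
    by_cases hri : r = i
    · subst hri
      split_ifs <;> omega
    · by_cases hrp : r = p
      · subst hrp
        split_ifs <;> omega
      · split_ifs <;> omega
  · rcases (show (r = p ∧ s = u q) ∨ (p < r ∨ r = p ∧ u q < s) by unfold Before at hrs; omega) with
      ⟨rfl, rfl⟩ | hrs'
    · refine iff_of_false (fun h1 => hd.isNWElbow.1.1 h1.1) fun h1 => ?_
      have := h1.1
      rw [child_apply hip hpq, if_neg (by omega), if_pos rfl] at this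
      omega
    · obtain ⟨e1, e2, e3, e4⟩ := hd.edges_eq hg.1 hg.2.2.1 (by omega)
      rw [inRothe_child_iff hu ht hi hrs', ← h.isBlank_iff hg, EdgeLabelling.IsBlank,
        EdgeLabelling.IsBlank, e1, e2, e3, e4]
  · exact isolated_child hu ht hi (by unfold Before at hrs; omega)

end BPD

end BumplessEG

namespace BumplessEG

open Equiv

namespace BPD

variable {n : ℕ} {w : Perm ℕ} {P P' : BPD n w} {u : Perm ℕ} {p c q i : ℕ}

/-! ### The list of NW elbows -/

lemma mem_nwElbows {x : ℕ × ℕ} : x ∈ P.nwElbows ↔ InGrid n x.1 x.2 ∧ P.IsNWElbow x.1 x.2 := by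
  obtain ⟨r, s⟩ := x
  simp only [nwElbows, List.mem_filter, List.mem_product, List.mem_range'_1, InGrid,
    decide_eq_true_eq]
  refine and_congr_left fun _ => ?_
  omega

lemma pairwise_nwElbows (P : BPD n w) :
    P.nwElbows.Pairwise fun x y => Before x.1 x.2 y.1 y.2 := by
  refine List.Pairwise.filter _ ?_
  refine List.pairwise_flatMap.2 ⟨fun r _ => ?_, ?_⟩
  · rw [List.pairwise_map]
    exact (List.pairwise_lt_range' 1).imp fun h => .inr ⟨rfl, h⟩
  · refine (List.pairwise_lt_range' 1).imp fun h x hx y hy => ?_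
    obtain ⟨_, -, rfl⟩ := List.mem_map.1 hx
    obtain ⟨_, -, rfl⟩ := List.mem_map.1 hy
    exact .inl h

lemma eq_of_pairwise_before {l l' : List (ℕ × ℕ)}
    (h : l.Pairwise fun x y => Before x.1 x.2 y.1 y.2)
    (h' : l'.Pairwise fun x y => Before x.1 x.2 y.1 y.2) (hm : ∀ x, x ∈ l ↔ x ∈ l') : l = l' := by
  have nodup : ∀ {l : List (ℕ × ℕ)}, (l.Pairwise fun x y => Before x.1 x.2 y.1 y.2) → l.Nodup :=
    fun h => h.imp fun {x y} hxy => by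
      rintro rfl
      unfold Before at hxy
      omega
  refine List.Perm.eq_of_pairwise (fun x y _ _ hxy hyx => ?_) h h'
    ((List.perm_ext_iff_of_nodup (nodup h) (nodup h')).2 hm)
  unfold Before at hxy hyx
  omega

lemma IsRothe.nwElbows_eq (h : P.IsRothe) : P.nwElbows = [] :=
  List.eq_nil_iff_forall_not_mem.2 fun _ hx => h _ _ (mem_nwElbows.1 hx).1 (mem_nwElbows.1 hx).2

/-- All old NW elbows lie at or beyond the old frontier, hence after the new elbow, and the droop
does not touch them. -/
lemma Matches.nwElbows_eq {p₀ c₀ : ℕ} (h : P.Matches u p₀ c₀) (ht : IsTransition n u p q)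
    (hi : i ∈ coverSet (u * swap p q) p) (hd : IsDroop P P' i (u i) p (u q)) :
    P'.nwElbows = (p, u q) :: P.nwElbows := by
  have hbt := h.before ht
  have hm := h.droop ht hi hd
  have hafter : ∀ {r s}, InGrid n r s → P.IsNWElbow r s → Before p (u q) r s := fun hg hn => by
    have : ¬ Before _ _ p₀ c₀ := fun hb => h.not_isNWElbow hg hb hn
    unfold Before at *
    omega
  have hiff : ∀ {r s}, InGrid n r s → Before p (u q) r s → (P'.IsNWElbow r s ↔ P.IsNWElbow r s) :=
    fun {r s} hg hb => by
      unfold Before at hb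
      obtain ⟨e1, e2, e3, e4⟩ := hd.edges_eq hg.1 hg.2.2.1 (by omega)
      rw [EdgeLabelling.IsNWElbow, EdgeLabelling.IsNWElbow, e1, e2, e3, e4]
  refine eq_of_pairwise_before P'.pairwise_nwElbows ?_ ?_
  · refine List.pairwise_cons.2 ⟨fun x hx => ?_, P.pairwise_nwElbows⟩
    rw [mem_nwElbows] at hx
    exact hafter hx.1 hx.2
  · rintro ⟨r, s⟩
    rw [mem_nwElbows, List.mem_cons, mem_nwElbows, Prod.mk.injEq]
    constructor
    · rintro ⟨hg, hn⟩
      have : ¬ Before r s p (u q) := fun hb => hm.not_isNWElbow hg hb hn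
      by_cases he : r = p ∧ s = u q
      · exact .inl he
      · exact .inr ⟨hg, (hiff hg (by unfold Before at *; omega)).1 hn⟩
    · rintro (⟨rfl, rfl⟩ | ⟨hg, hn⟩)
      · exact ⟨hd.box_mem, hd.isNWElbow.1⟩
      · exact ⟨hg, (hiff hg (hafter hg hn)).2 hn⟩

/-! ### Reaching every EG-pipedream -/

lemma mem_emptyCells {x : ℕ × ℕ} :
    x ∈ P.emptyCells ↔ InGrid n (x.1 + 1) (x.2 + 1) ∧ P.IsBlank (x.1 + 1) (x.2 + 1) := by
  simp only [emptyCells, Finset.mem_filter, Finset.mem_product, Finset.mem_range, InGrid]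
  refine and_congr_left fun _ => ?_
  omega

lemma IsEG.isBlank_of_le (h : P.IsEG) {r s r' s' : ℕ} (hg : InGrid n r s) (hb : P.IsBlank r s)
    (hr : 1 ≤ r') (hr' : r' ≤ r) (hs : 1 ≤ s') (hs' : s' ≤ s) : P.IsBlank r' s' := by
  obtain ⟨r, rfl⟩ := Nat.exists_eq_add_of_le' hg.1
  obtain ⟨s, rfl⟩ := Nat.exists_eq_add_of_le' hg.2.2.1
  obtain ⟨r', rfl⟩ := Nat.exists_eq_add_of_le' hr
  obtain ⟨s', rfl⟩ := Nat.exists_eq_add_of_le' hs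
  have h1 : (r, s) ∈ P.emptyCells := mem_emptyCells.2 ⟨hg, hb⟩
  have h2 : ((r', s') : ℕ × ℕ) ≤ (r, s) := ⟨by simpa using hr', by simpa using hs'⟩
  exact (mem_emptyCells.1 (Finset.mem_coe.1 (h h2 (Finset.mem_coe.2 h1)))).2

namespace Matches

variable (h : P.Matches u p c)
include h

/-- Matching only compares which edges are occupied. The pipes are identified here: the one turning
at `(i, u i)` runs straight east to the boundary, where it has to be `w i`. -/
lemma south_apply (hi : 1 ≤ i) (hip : i < p) (hin : i ≤ n) : P.south i (u i) = w i := by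
  have hm := h.inSym.mem hi hin
  have hse := (h.isSEElbow_iff ⟨hi, hin, hm.1, hm.2⟩ (.inl hip)).2 rfl
  have hne : P.east i n ≠ 0 :=
    (h.east i n ⟨hi, hin, by omega, le_rfl⟩ (.inl hip)).2 hm.2
  have := P.east_eq_of_not_elbow (r := i) (b := u i + 1) (d := n) (fun s h1 h2 => by
    rw [h.isSEElbow_iff ⟨hi, hin, by omega, h2⟩ (.inl hip)]
    omega) hne (j := u i) le_rfl hm.2
  rw [← hse.2.1, this, P.east_boundary i hi hin]

lemma south_apply_of_lt {r : ℕ} (hi : 1 ≤ i) (hir : i < r) (hr : r ≤ n) (hb : Before r (u i) p c) :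
    P.south r (u i) = w i := by
  have hm := h.inSym.mem hi (by omega)
  have hne : P.south r (u i) ≠ 0 := by
    rw [h.south r (u i) ⟨by omega, hr, hm.1, hm.2⟩ hb, symm_apply_apply]
    omega
  have := P.south_eq_of_not_elbow (s := u i) (a := i + 1) (c := r) (fun k h1 h2 => by
    rw [h.isSEElbow_iff ⟨by omega, by omega, hm.1, hm.2⟩ (by unfold Before at *; omega)]
    exact u.injective.ne (by omega)) hne (r := i) le_rfl hir.le
  rw [← this, h.south_apply hi (by unfold Before at hb; omega) (by omega)]

/-- The NW elbows of a pipedream which agrees with `P` after some box. -/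
lemma of_isNWElbow {r s : ℕ} (hg : InGrid n r s) (hb : Before r s p c) (ha : Agree P P' r (s + 1))
    (hn : P'.IsNWElbow r s) : InRothe u r s ∧ ∃ i, 1 ≤ i ∧ i < r ∧ u i < s ∧
      P'.south r (u i) = P'.east r (s - 1) ∧
      ∀ j, u i ≤ j → j < s → P'.east r j = P'.east r (s - 1) := by
  have hS : ∀ t, InGrid n r t → P.south r t = P'.south r t := fun t ht =>
    ha.south_eq ht (by unfold Before; omega)
  have hE := ha.east_eq hg (by unfold Before; omega)
  have hblank : P.IsBlank r s := by
    have h1 := hS s hg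
    rw [hn.2.2.1] at h1
    rw [hn.2.2.2] at hE
    rcases P.tile r s hg with k | k | k | k | k | k
    · exact k
    · exact absurd k (h.not_isNWElbow hg hb)
    · exact absurd h1 k.1
    · exact absurd (k.2.1.symm.trans hE) k.1
    · exact absurd h1 k.1
    · exact absurd h1 k.2.2.1
  have hro := (h.isBlank_iff hg).1 hblank
  obtain ⟨t, h1, h2, h3⟩ := P'.exists_south_of_east hn.1
  have hs := hg.2.2.1
  have hgt := P'.inGrid_of_south (by rw [h2]; exact hn.1 : P'.south r t ≠ 0)
  have hne : P.south r t ≠ 0 := by rw [hS t hgt, h2]; exact hn.1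
  rw [h.south r t hgt (by unfold Before at *; omega)] at hne
  have h4 : u.symm t ≠ r := fun he => by
    rw [symm_apply_eq] at he
    have := hro.1
    omega
  have h5 := h.inSym.symm.mem hgt.2.2.1 hgt.2.2.2
  refine ⟨hro, u.symm t, h5.1, by omega, ?_⟩
  rw [apply_symm_apply]
  exact ⟨by omega, h2, fun j h6 h7 => h3 j h6 (by omega)⟩

/-- The pipe in the elbow is the one turning at `(i, u i)` in the matching pipedream. If a dot `(k,
u k)` obstructed the cover, the pipes `w i` and `w k` would cross in row `p₀`, and they would have
to cross again above it to leave the grid in the rows `i < k`. -/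
lemma mem_coverSet_of_isNWElbow (ht : IsTransition n u p₀ q) (ha : Agree P P' p₀ (u q + 1))
    (hn : P'.IsNWElbow p₀ (u q)) : ∃ i ∈ coverSet (u * swap p₀ q) p₀,
      P'.east p₀ (u q - 1) = w i := by
  have hb := h.before ht
  have hgt := P'.inGrid_of_east hn.1
  have hlt := ht.lt
  have hqn := ht.le
  have hmq := h.inSym.mem (i := q) (by omega) hqn
  have hg : InGrid n p₀ (u q) := ⟨hgt.1, hgt.2.1, hmq.1, hmq.2⟩
  obtain ⟨hro, i, hi1, hip, hiq, hS, hE⟩ := h.of_isNWElbow hg hb ha hn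
  have hlab : ∀ k, 1 ≤ k → k < p₀ → u k < u q → P'.south p₀ (u k) = w k := fun k h1 h2 h3 => by
    have hm := h.inSym.mem h1 (by have := hg.2.1; omega)
    rw [← ha.south_eq ⟨hg.1, hg.2.1, hm.1, hm.2⟩ (by unfold Before; omega),
      h.south_apply_of_lt h1 h2 hg.2.1 (by unfold Before at *; omega)]
  have hL := hlab i hi1 hip hiq
  refine ⟨i, (ht.mem_coverSet_iff h.inSym).2 ⟨hi1, hip, hiq, ?_⟩, by rw [← hS, hL]⟩
  rintro k hik hkp ⟨h1, h2⟩
  have hM := hlab k (by omega) hkp h2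
  have hm := h.inSym.mem (i := k) (by omega) (by have := hg.2.1; omega)
  have hwk : w k ≠ 0 := by
    rw [← hM, ← ha.south_eq ⟨hg.1, hg.2.1, hm.1, hm.2⟩ (by unfold Before; omega),
      h.south _ _ ⟨hg.1, hg.2.1, hm.1, hm.2⟩ (by unfold Before at *; omega), symm_apply_apply]
    omega
  have hW := hE (u k - 1) (by omega) (by omega)
  have hgk : InGrid n p₀ (u k) := ⟨hg.1, hg.2.1, hm.1, hm.2⟩
  have hcr := P'.isCrossing_of_ne hgk (by rwa [hM]) (by rw [hW]; exact hn.1)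
  have hwi : w i ≠ 0 := by rw [← hL, hS]; exact hn.1
  have e1 : P'.south (p₀ - 1) (u k) = w k := by rw [hcr.2.2.2, hM]
  have e2 : P'.south (p₀ - 1) (u q) = w i := by rw [hn.2.1, ← hS, hL]
  obtain ⟨r', j, h3, h4, h5, h6⟩ := P'.exists_crossing (by rwa [e1]) (by rwa [e2]) h2
    (by rw [e1, e2, symm_apply_apply, symm_apply_apply]; exact hik)
  rw [e1, e2] at h6
  have h7 : s(P'.east p₀ (u k), P'.south p₀ (u k)) = s(P'.east r' j, P'.south r' j) := by
    rw [h6, hcr.2.1, hW, hM, ← hS, hL, Sym2.eq_swap]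
  have := (P'.cross_once _ _ _ _ hgk h4 hcr h5 h7).1
  have := hg.1
  omega

end Matches

/-- Descend in the tree while keeping agreement with `P'` from the frontier on. At a dominant label
agreement extends to the whole grid, since a NW elbow of `P'` before the frontier would produce a
132-pattern. Otherwise it extends to all boxes after the transition box, where `P'` has an elbow
that selects the droop. -/
lemma exists_egNode_aux (P' : BPD n w) (hP' : P'.IsEG) (k : ℕ) : ∀ (u : Perm ℕ) (P : BPD n w)
    (p c : ℕ), p * (n + 1) + c ≤ k → EGNode n w u P → P.Matches u p c → Agree P P' p c →
    ∃ u', EGNode n w u' P' ∧ IsDominant n u' := by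
  induction k using Nat.strong_induction_on with
  | _ k ih =>
    intro u P p c hk hP h ha
    have hu := h.inSym
    by_cases hd : IsDominant n u
    · have hA : Agree P P' 0 0 := ha.extend fun r s hg _ hb ha' => by
        refine ⟨h.not_isNWElbow hg hb, fun hn => ?_⟩
        obtain ⟨hro, i, h1, h2, h3, -⟩ := h.of_isNWElbow hg hb ha' hn
        have := hd.avoids hu h1 h2 hro.2 (by rwa [apply_symm_apply])
        rw [apply_symm_apply] at this
        have := hro.1
        omega
      obtain rfl := hA.eq
      exact ⟨u, hP, hd⟩
    obtain ⟨p₀, q, ht⟩ := exists_isTransition hd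
    have hlt := ht.lt
    have hqn := ht.le
    have hp1 := ht.one_lt
    have hbt := h.before ht
    have hmq := hu.mem (i := q) (by omega) hqn
    have hg : InGrid n p₀ (u q) := ⟨by omega, by omega, hmq.1, hmq.2⟩
    have hA : Agree P P' p₀ (u q + 1) := ha.extend fun r s hg hnb hb ha' => by
      refine ⟨h.not_isNWElbow hg hb, fun hn => ?_⟩
      obtain ⟨hro, i, h1, h2, h3, -⟩ := h.of_isNWElbow hg hb ha' hn
      have hle := (hro.le hu).2.2
      have h4 := hro.1
      rcases (show p₀ < r ∨ r = p₀ ∧ u q < s by unfold Before at hnb; omega) with h5 | ⟨rfl, h5⟩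
      · have := ht.no_pattern h5 h1 h2 hro.2 hle (by rwa [apply_symm_apply])
        rw [apply_symm_apply] at this
        omega
      · have := ht.no_between hro.2 hle (by rwa [apply_symm_apply])
        rw [apply_symm_apply] at this
        omega
    have hblank := (h.isBlank_iff hg).2 ht.inRothe
    have hS := hA.south_eq hg (by unfold Before; omega)
    have hE := hA.east_eq hg (by unfold Before; omega)
    rw [hblank.2.1] at hS
    rw [hblank.2.2.2] at hE
    have hn : P'.IsNWElbow p₀ (u q) := by
      rcases P'.tile p₀ (u q) hg with k | k | k | k | k | k
      -- This is where the EG condition enters: if the transition box were empty in `P'`, so would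
      -- be the box `(p₀, u i)` to its left, but the south edge of that box is occupied.
      · exfalso
        obtain ⟨i, h1, h2, h3⟩ := ht.exists_lt
        have hmi := hu.mem h1 (by omega)
        have h4 := hP'.isBlank_of_le hg k (r' := p₀) (s' := u i) (by omega) le_rfl hmi.1 h3.le
        have hgi : InGrid n p₀ (u i) := ⟨by omega, by omega, hmi.1, hmi.2⟩
        have h5 := hA.south_eq hgi (by unfold Before; omega)
        rw [h4.2.1] at h5
        refine (h.south _ _ hgi (by unfold Before at *; omega)).2 ?_ h5
        rw [symm_apply_apply]
        exact h2.le
      · exact k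
      · exact absurd hS.symm k.1
      · exact absurd (k.2.1.symm.trans hE.symm) k.1
      · exact absurd hS.symm k.1
      · exact absurd hS.symm k.2.2.1
    obtain ⟨i, hi, hlab⟩ := h.mem_coverSet_of_isNWElbow ht hA hn
    obtain ⟨hi1, hip, hiq, -⟩ := (ht.mem_coverSet_iff hu).1 hi
    obtain ⟨P₁, hdr⟩ := (h.canDroop ht hi).exists_isDroop
    refine ih (p₀ * (n + 1) + u q) ?_ _ P₁ p₀ (u q) le_rfl (.child hP ht hi hdr)
      (h.droop ht hi hdr) ?_
    · unfold Before at hbt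
      rcases hbt with h1 | ⟨rfl, h1⟩
      · have := Nat.mul_le_mul_right (n + 1) h1
        rw [Nat.succ_mul] at this
        omega
      · omega
    · intro r s hg' hb
      by_cases he : r = p₀ ∧ s = u q
      · obtain ⟨rfl, rfl⟩ := he
        have h1 : P₁.east r (u q - 1) = P'.east r (u q - 1) := by
          rw [hdr.isNWElbow.2, hlab, h.south_apply hi1 (by unfold Before at hbt; omega) (by omega)]
        exact ⟨h1, by rw [hdr.isNWElbow.1.2.1, hn.2.1, h1]⟩
      · obtain ⟨-, e2, -, e4⟩ := hdr.edges_eq hg'.1 hg'.2.2.1 (by unfold Before at hb; omega)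
        rw [e2, e4]
        exact hA r s hg' (by unfold Before at *; omega)

/-- Every EG-pipedream is the label of a leaf of the Edelman–Greene tree. -/
theorem exists_egNode (hw : InSym n w) (P : BPD n w) (hP : P.IsEG) :
    ∃ u, EGNode n w u P ∧ IsDominant n u := by
  obtain ⟨P₀, h₀, -⟩ := exists_isRothe hw
  exact exists_egNode_aux P hP _ w P₀ (n + 1) 1 le_rfl (.root h₀) (h₀.matches hw) (agree_top _ _)

end BPD

end BumplessEG

namespace BumplessEG

open Equiv

variable {n : ℕ} {w u : Perm ℕ}

/-! ### Nodes of the Edelman–Greene tree -/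

lemma EGNode.exists_matches (hw : InSym n w) {P : BPD n w} (h : EGNode n w u P) :
    ∃ p c, P.Matches u p c := by
  induction h with
  | root h => exact ⟨_, _, h.matches hw⟩
  | child _ ht hi hd ih =>
    obtain ⟨_, _, hm⟩ := ih
    exact ⟨_, _, hm.droop ht hi hd⟩

namespace BPD.Matches

variable {P : BPD n w} {p c : ℕ}

lemma inRothe_iff (h : P.Matches u p c) (r s : ℕ) :
    InRothe u r s ↔ InGrid n r s ∧ P.IsBlank r s := by
  constructor
  · intro hr
    have h1 := hr.pos h.inSym.zero
    have h2 := hr.le h.inSym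
    have hg : InGrid n r s := ⟨h1.1, h2.1, h1.2, h2.2.1⟩
    exact ⟨hg, (h.isBlank_iff hg).2 hr⟩
  · rintro ⟨hg, hb⟩
    exact (h.isBlank_iff hg).1 hb

lemma isEG (h : P.Matches u p c) (hd : IsDominant n u) : P.IsEG := by
  rintro ⟨r, s⟩ ⟨r', s'⟩ ⟨h1, h2⟩ h3
  rw [Finset.mem_coe, mem_emptyCells, ← h.inRothe_iff] at h3 ⊢
  exact hd.inRothe_of_le h.inSym h3 (by simp) (by simpa using h1) (by simp) (by simpa using h2)

end BPD.Matches

/-- The empty boxes of a node are the Rothe diagram of its label, so the inverse construction does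
not depend on which leaf with the given pipedream is taken. -/
lemma EGNode.perm_eq (hw : InSym n w) {P : BPD n w} {u' : Perm ℕ} (h : EGNode n w u P)
    (h' : EGNode n w u' P) : u = u' := by
  obtain ⟨_, _, hm⟩ := h.exists_matches hw
  obtain ⟨_, _, hm'⟩ := h'.exists_matches hw
  exact inRothe_injective fun r s => by rw [hm.inRothe_iff, hm'.inRothe_iff]

lemma EGNode.mem_shape_iff (hw : InSym n w) {P : EG n w} (h : EGNode n w u P.1) (r s : ℕ) :
    (r, s) ∈ P.shape ↔ InRothe u (r + 1) (s + 1) := by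
  obtain ⟨_, _, hm⟩ := h.exists_matches hw
  rw [hm.inRothe_iff, ← YoungDiagram.mem_cells]
  exact BPD.mem_emptyCells

lemma EGNode.exists_rt (hw : InSym n w) {P : EG n w} (h : EGNode n w u P.1) : Nonempty (RT u) := by
  obtain ⟨_, _, hm⟩ := h.exists_matches hw
  exact ⟨⟨.frozen P.shape, (IncreasingTableau.isFrozen_frozen _).isReducedWord hm.inSym.zero
    fun r s => (h.mem_shape_iff hw r s).symm⟩⟩

/-- A reduced word tableau for the label of a node comes from a path. -/
lemma EGNode.exists_path (hw : InSym n w) {P : BPD n w} (h : EGNode n w u P) (T' : RT u) :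
    ∃ T : RT w, T.shape = T'.shape ∧ Path n w T.1.column u T'.1.column P := by
  induction h with
  | root h => exact ⟨T', rfl, .root h⟩
  | @child u P P' p q i hP ht hi hd ih =>
    obtain ⟨_, _, hm⟩ := hP.exists_matches hw
    have hstep := ht.isStep hm.inSym hi
    -- The word of the child has a preimage under the Little map. The relation read backwards is
    -- again compatible with descents and moves, so this preimage is the reading word of a tableau
    -- of the same shape.
    obtain ⟨a, ha, hab⟩ := hstep.exists_littleMap_to (fun q' => ht.eq_of_inv_eq hm.inSym) T'.2
    rw [mul_assoc, swap_mul_self, mul_one] at ha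
    rw [Perm.mul_apply, swap_apply_left] at hab
    obtain ⟨T₁, h1, rfl⟩ := (isBisim_littleMap ht.hasBelow).flip.exists_tableau T'.1 ⟨ha, hab⟩
    obtain ⟨T, h2, h3⟩ := ih ⟨T₁, ha⟩
    exact ⟨T, h2.trans h1, .step h3 ht hab hi T'.2 hd⟩

/-! ### Paths -/

namespace Path

variable {a₀ a : List ℕ} {P : BPD n w}

lemma egNode (h : Path n w a₀ u a P) : EGNode n w u P := by
  induction h with
  | root h => exact .root h
  | step _ ht _ hi _ hd ih => exact .child ih ht hi hd

lemma isReducedWord (h₀ : IsReducedWord w a₀) (h : Path n w a₀ u a P) : IsReducedWord u a := by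
  cases h with
  | root => exact h₀
  | step _ _ _ _ h _ => exact h

lemma exists_tableau {T : RT w} (h : Path n w T.1.column u a P) :
    ∃ T' : RT u, T'.shape = T.shape ∧ T'.1.column = a := by
  induction h with
  | root => exact ⟨T, rfl, rfl⟩
  | @step u a a' P P' p q i h ht hl hi hw hd ih =>
    obtain ⟨T₁, h1, rfl⟩ := ih
    obtain ⟨T', h2, rfl⟩ := (isBisim_littleMap ht.hasBelow).exists_tableau T₁.1 ⟨T₁.2, hl⟩
    exact ⟨⟨T', hw⟩, h2.trans h1, rfl⟩

/-- The inverse Little maps given by the NW elbows lead back to the start of a path. -/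
lemma littleMapInvSeq_iff (hw : InSym n w) (h₀ : IsReducedWord w a₀) (h : Path n w a₀ u a P)
    (b : List ℕ) : LittleMapInvSeq n P.nwElbows a b ↔ b = a₀ := by
  induction h with
  | root h =>
    rw [h.nwElbows_eq]
    refine ⟨fun h => by cases h; rfl, ?_⟩
    rintro rfl
    exact .nil
  | @step u a a' P P' p q i h ht hl hi hb hd ih =>
    obtain ⟨_, _, hm⟩ := h.egNode.exists_matches hw
    have hstep := ht.isStep hm.inSym hi
    have huq : u q = (u * swap p q) p := by simp
    have hinv := hl.inv (h.isReducedWord h₀) hm.inSym (by have := ht.one_lt; omega) ht.le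
      ht.hasBelow
    -- The elbow created last comes first in the list, so the first inverse Little map undoes the
    -- last step.
    rw [hm.nwElbows_eq ht hi hd, ← ih]
    constructor
    · intro hs
      cases hs with
      | cons h1 h2 =>
        rw [huq] at h1 hinv
        rwa [← hstep.littleMapInv_unique hb h1 hinv]
    · exact .cons hinv

/-- One step of the construction of `Γ`. -/
def Step (n : ℕ) (w : Perm ℕ) (x y : Perm ℕ × List ℕ × BPD n w) : Prop :=
  ∃ p q i, IsReducedWord x.1 x.2.1 ∧ IsTransition n x.1 p q ∧ LittleMap p (x.1 q) x.2.1 y.2.1 ∧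
    IsReducedWord (x.1 * swap p q * swap i p) y.2.1 ∧ y.1 = x.1 * swap p q * swap i p ∧
    BPD.IsDroop x.2.2 y.2.2 i (x.1 i) p (x.1 q)

lemma rightUnique_step : Relator.RightUnique (Step n w) := by
  rintro ⟨u, a, P⟩ ⟨u₁, a₁, P₁⟩ ⟨u₂, a₂, P₂⟩ ⟨p, q, i, h1, h2, h3, h4, h5, h6⟩
    ⟨p', q', i', h1', h2', h3', h4', h5', h6'⟩
  simp only at *
  obtain ⟨rfl, rfl⟩ := h2.unique h2'
  obtain rfl := h3.unique h1 h2.hasBelow h3'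
  have h7 : swap i p = swap i' p := mul_left_cancel (h4.2.symm.trans h4'.2)
  obtain rfl : i = i' := by
    have := congrArg (fun f => f p) h7
    simpa using this
  rw [h5, h5', h6.unique h6']

lemma reflTransGen (h₀ : IsReducedWord w a₀) {R : BPD n w} (hR : R.IsRothe)
    (h : Path n w a₀ u a P) :
    Relation.ReflTransGen (Step n w) (w, a₀, R) (u, a, P) := by
  induction h with
  | root h => rw [hR.eq h]
  | @step u a a' P P' p q i h ht hl hi hb hd ih =>
    exact ih.tail ⟨p, q, i, h.isReducedWord h₀, ht, hl, hb, rfl, hd⟩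

/-- Steps are deterministic, so of two paths from the same word one continues the other, and no step
leaves a dominant label. -/
lemma eq_of_isDominant (hw : InSym n w) (h₀ : IsReducedWord w a₀) {u' : Perm ℕ} {a' : List ℕ}
    {P' : BPD n w} (h : Path n w a₀ u a P) (hd : IsDominant n u) (h' : Path n w a₀ u' a' P')
    (hd' : IsDominant n u') : P = P' := by
  obtain ⟨R, hR, -⟩ := BPD.exists_isRothe hw
  have hend : ∀ {x y : Perm ℕ × List ℕ × BPD n w}, IsDominant n x.1 →
      Relation.ReflTransGen (Step n w) x y → x = y := fun {x y} hx hxy => by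
    rcases hxy.cases_head with h | ⟨z, ⟨p, q, i, -, ht, -⟩, -⟩
    · exact h
    · exact absurd hx ht.not_isDominant
  rcases Relation.ReflTransGen.total_of_right_unique rightUnique_step (h.reflTransGen h₀ hR)
    (h'.reflTransGen h₀ hR) with h1 | h1
  · exact congrArg (fun x => x.2.2) (hend hd h1)
  · exact congrArg (fun x => x.2.2) (hend hd' h1).symm

lemma exists_isDominant_aux (h₀ : IsReducedWord w a₀) (k : ℕ) : ∀ (u : Perm ℕ) (a : List ℕ)
    (P : BPD n w) (p c : ℕ), p * (n + 1) + c ≤ k → Path n w a₀ u a P → P.Matches u p c →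
    ∃ u' a' P', Path n w a₀ u' a' P' ∧ IsDominant n u' := by
  induction k using Nat.strong_induction_on with
  | _ k ih =>
    intro u a P p c hk hP h
    have hu := h.inSym
    by_cases hd : IsDominant n u
    · exact ⟨u, a, P, hP, hd⟩
    obtain ⟨p₀, q, ht⟩ := exists_isTransition hd
    have hlt := ht.lt
    have hbt := h.before ht
    have hmq := hu.mem (i := q) (by omega) ht.le
    have hinv := ht.inv_eq hu
    rw [mul_assoc u, swap_mul_self, mul_one] at hinv
    obtain ⟨b, i, hl, hi, hb⟩ := exists_littleMap (hP.isReducedWord h₀) hlt hinv ht.hasBelow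
    obtain ⟨P', hdr⟩ := (h.canDroop ht hi).exists_isDroop
    refine ih (p₀ * (n + 1) + u q) ?_ _ b P' p₀ (u q) le_rfl (.step hP ht hl hi hb hdr)
      (h.droop ht hi hdr)
    unfold Before at hbt
    rcases hbt with h1 | ⟨rfl, h1⟩
    · have := Nat.mul_le_mul_right (n + 1) h1
      rw [Nat.succ_mul] at this
      omega
    · omega

lemma exists_isDominant (hw : InSym n w) (h₀ : IsReducedWord w a₀) :
    ∃ u a, ∃ P : BPD n w, Path n w a₀ u a P ∧ IsDominant n u := by
  obtain ⟨R, hR, -⟩ := BPD.exists_isRothe hw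
  exact exists_isDominant_aux h₀ _ w a₀ R (n + 1) 1 le_rfl (.root hR) (hR.matches hw)

end Path

/-! ### The bijection -/

lemma existsUnique_gammaConstruction (hw : InSym n w) (T : RT w) :
    ∃! P : EG n w, GammaConstruction T P := by
  obtain ⟨u, a, P, hP, hd⟩ := Path.exists_isDominant hw T.2
  obtain ⟨_, _, hm⟩ := hP.egNode.exists_matches hw
  refine ⟨⟨P, hm.isEG hd⟩, ⟨u, a, hP, hd⟩, ?_⟩
  rintro P' ⟨u', a', hP', hd'⟩
  exact Subtype.ext (hP'.eq_of_isDominant hw T.2 hd' hP hd)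

lemma GammaConstruction.shape_eq (hw : InSym n w) {T : RT w} {P : EG n w}
    (h : GammaConstruction T P) : P.shape = T.shape := by
  obtain ⟨u, a, hP, hd⟩ := h
  obtain ⟨_, _, hm⟩ := hP.egNode.exists_matches hw
  obtain ⟨T', hs, -⟩ := hP.exists_tableau
  rw [← hs]
  ext ⟨r, s⟩
  rw [YoungDiagram.mem_cells, YoungDiagram.mem_cells, hP.egNode.mem_shape_iff hw]
  exact (T'.mem_shape_iff hm.inSym hd r s).symm

lemma exists_gammaConstruction (hw : InSym n w) (P : EG n w) :
    ∃ T : RT w, GammaConstruction T P := by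
  obtain ⟨u, hP, hd⟩ := BPD.exists_egNode hw P.1 P.2
  obtain ⟨T'⟩ := hP.exists_rt hw
  obtain ⟨T, -, hT⟩ := hP.exists_path hw T'
  exact ⟨T, u, _, hT, hd⟩

lemma inverseConstruction_of_gammaConstruction (hw : InSym n w) {T : RT w} {P : EG n w}
    (h : GammaConstruction T P) : InverseConstruction P T := by
  obtain ⟨u, a, hP, hd⟩ := h
  obtain ⟨_, _, hm⟩ := hP.egNode.exists_matches hw
  obtain ⟨T', -, rfl⟩ := hP.exists_tableau
  exact ⟨u, T', T.1.column, hP.egNode, hd,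
    IncreasingTableau.isFrozen_of_isDominant hm.inSym hd T'.2,
    (hP.littleMapInvSeq_iff hw T.2 _).2 rfl, T.2, T.1.insertionTableau_reverse_column.symm⟩

lemma InverseConstruction.eq (hw : InSym n w) {T T' : RT w} {P : EG n w}
    (h : GammaConstruction T P) (h' : InverseConstruction P T') : T = T' := by
  obtain ⟨u, a, hP, hd⟩ := h
  obtain ⟨_, _, hm⟩ := hP.egNode.exists_matches hw
  obtain ⟨T₁, -, rfl⟩ := hP.exists_tableau
  obtain ⟨u', T₂, b, hP', hd', -, hseq, -, hrows⟩ := h'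
  obtain rfl := hP'.perm_eq hw hP.egNode
  -- The dominant label has only one reduced word tableau, so both constructions start from the same
  -- word, and the elbows lead from it back to the reading word of `T`.
  rw [RT.eq_of_isDominant hm.inSym hd T₂ T₁, hP.littleMapInvSeq_iff hw T.2] at hseq
  rw [hseq, IncreasingTableau.insertionTableau_reverse_column] at hrows
  exact Subtype.ext (IncreasingTableau.rows_injective hrows.symm)

end BumplessEG

theorem theorem6p1 (n : ℕ) (w : Equiv.Perm ℕ) (hw : BumplessEG.InSym n w) :
    ∃ Γ : BumplessEG.RT w ≃ BumplessEG.EG n w,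
      (∀ T : BumplessEG.RT w, (Γ T).shape = T.shape) ∧
      (∀ (T : BumplessEG.RT w) (P : BumplessEG.EG n w),
        Γ T = P ↔ BumplessEG.GammaConstruction T P) ∧
      (∀ (P : BumplessEG.EG n w) (T : BumplessEG.RT w),
        Γ.symm P = T ↔ BumplessEG.InverseConstruction P T) := by
  choose G hG hG' using BumplessEG.existsUnique_gammaConstruction hw
  have hG'' : ∀ T P, G T = P ↔ BumplessEG.GammaConstruction T P := fun T P =>
    ⟨fun h => h ▸ hG T, fun h => (hG' T P h).symm⟩
  have hbij : Function.Bijective G := by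
    -- Injectivity holds because the inverse construction recovers the tableau from the pipedream.
    refine ⟨fun T T' h => BumplessEG.InverseConstruction.eq hw (hG T)
      (BumplessEG.inverseConstruction_of_gammaConstruction hw (h ▸ hG T')), fun P => ?_⟩
    obtain ⟨T, hT⟩ := BumplessEG.exists_gammaConstruction hw P
    exact ⟨T, (hG'' T P).2 hT⟩
  refine ⟨Equiv.ofBijective G hbij, fun T => (hG T).shape_eq hw, hG'', fun P T => ?_⟩
  rw [Equiv.symm_apply_eq, eq_comm, Equiv.ofBijective_apply, hG'']
  refine ⟨BumplessEG.inverseConstruction_of_gammaConstruction hw, fun h => ?_⟩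
  obtain ⟨T', hT'⟩ := BumplessEG.exists_gammaConstruction hw P
  rwa [← BumplessEG.InverseConstruction.eq hw hT' h]
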